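/- Let $\mathfrak{h}_4$ be the complex Lie algebra with basis $E,F,I,J$ and nonzero brackets $[E,F]=I$, $[J,E]=E$, $[J,F]=-F$, with invariant symmetric form given by $(E,F)=(I,J)=1$ and all other pairings of basis vectors $0$. Let $\widehat{\mathfrak{h}}_4=\mathfrak{h}_4\otimes\mathbb{C}[t,t^{-1}]\oplus\mathbb{C}K$ be its affinisation, with $K$ central and $[A_m,B_n]=[A,B]_{m+n}+m\,(A,B)\,\delta_{m+n,0}K$, where $A_n=A\otimes t^n$. All modules have $K$ acting as $1$, and $L_0$ denotes the zero mode of $T={:}EF{:}+{:}IJ{:}-\tfrac12\partial I-\tfrac12{:}II{:}$ (central charge $4$). Inducing an $\mathfrak{h}_4$-module to $\widehat{\mathfrak{h}}_4$ means letting $A_n$ ($n>0$) act as $0$ and $K$ as $1$ on it before inducing. For $i,j\in\mathbb{C}$, let $V^+_{i,j}$ (resp. $V^-_{i,j}$) be the module induced from the Verma $\mathfrak{h}_4$-module generated by a vector annihilated by $E$ (resp. $F$) on which $I,J$ act as $i,j$. Let $L^\pm_{i,j}$ be the irreducible quotient of $V^\pm_{i,j}$, i.e. its quotient by the sum of all proper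 submodules. For $i\neq0$ and $h\in\mathbb{C}$, let $R^+_{i;h}$ (resp. $R^-_{i;h}$) be the module induced from the dense $\mathfrak{h}_4$-module $U(\mathfrak{h}_4)\otimes_{\mathbb{C}[I,J,Q]}\mathbb{C}_{i,j,h}$, where $Q=FE+IJ$, where $I,J,Q$ act on $\mathbb{C}_{i,j,h}$ as $i,j,h$, and where $j\in\frac hi+\mathbb{Z}_{>0}$ (resp. $j\in\frac hi+\mathbb{Z}_{\le0}$); up to isomorphism this does not depend on the choice of such $j$, and the result below holds for every choice. Let $E^\pm_{i;h}$ be the quotient of $R^\pm_{i;h}$ by the sum of all submodules that have zero intersection with the space of ground states, i.e. of vectors of the minimal conformal weight $h+\frac i2-\frac{i^2}{2}$ (generalised $L_0$-eigenvalue). A weight space $W(a,b;\Delta)$ of a module $W$ is the intersection of the eigenspaces of $I_0$ and $J_0$ with eigenvalues $a$ and $b$ and the generalised eigenspace of $L_0$ with eigenvalue $\Delta$ (with $K$ acting as $1$); $W$ is a weight module if it is the direct sum of its weight spaces and these are finite-dimensional. The character of a weight module is the formal sum $\mathrm{ch}\,W=\sum_{a,b,\Delta\in\mathbb{C}}\dim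 W(a,b;\Delta)\,y^az^bq^{\Delta-1/6}$. **Corollary.** Let $i\in\mathbb{Z}\setminus\{0\}$ and $j,h\in\mathbb{C}$. The modules $V^\pm_{i,j}$, $L^\pm_{i,j}$, $R^\pm_{i;h}$, $E^\pm_{i;h}$ are weight modules, the $L^\pm_{i,j}$ are irreducible, and $$\mathrm{ch}\,L^\pm_{i,j}=\bigl(1-z^{\operatorname{sgn} i}q^{|i|}\bigr)\,\mathrm{ch}\,V^\pm_{i,j},\qquad \mathrm{ch}\,E^\pm_{i;h}=\bigl(1-q^{|i|}\bigr)\,\mathrm{ch}\,R^\pm_{i;h}.$$ -/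

import Mathlib

open scoped TensorProduct
open LieAlgebra

noncomputable section

namespace NappiWitten

attribute [local instance 100] LieRing.ofAssociativeRing

/-! ### The finite-dimensional Lie algebra -/

/-- The underlying space of the four-dimensional complex Lie algebra with basis `E, F, I, J`
(coordinates in this order). -/
def H4 : Type := Fin 4 → ℂ

namespace H4

instance : AddCommGroup H4 := inferInstanceAs (AddCommGroup (Fin 4 → ℂ))
instance : Module ℂ H4 := inferInstanceAs (Module ℂ (Fin 4 → ℂ))

@[ext] theorem ext {x y : H4} (h : ∀ a, x a = y a) : x = y := funext h

@[simp] theorem add_apply (x y : H4) (a : Fin 4) : (x + y) a = x a + y a := rfl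
@[simp] theorem zero_apply (a : Fin 4) : (0 : H4) a = 0 := rfl
@[simp] theorem neg_apply (x : H4) (a : Fin 4) : (-x) a = -x a := rfl
@[simp] theorem smul_apply (c : ℂ) (x : H4) (a : Fin 4) : (c • x) a = c * x a := rfl

def E : H4 := (![1, 0, 0, 0] : Fin 4 → ℂ)
def F : H4 := (![0, 1, 0, 0] : Fin 4 → ℂ)
def I : H4 := (![0, 0, 1, 0] : Fin 4 → ℂ)
def J : H4 := (![0, 0, 0, 1] : Fin 4 → ℂ)

/-- The bilinear extension of `[E, F] = I`, `[J, E] = E`, `[J, F] = -F`, `I` central. -/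
instance : Bracket H4 H4 where
  bracket x y := (![x 3 * y 0 - x 0 * y 3, x 1 * y 3 - x 3 * y 1, x 0 * y 1 - x 1 * y 0, 0] :
    Fin 4 → ℂ)

@[simp] theorem lie_apply_zero (x y : H4) : ⁅x, y⁆ 0 = x 3 * y 0 - x 0 * y 3 := rfl
@[simp] theorem lie_apply_one (x y : H4) : ⁅x, y⁆ 1 = x 1 * y 3 - x 3 * y 1 := rfl
@[simp] theorem lie_apply_two (x y : H4) : ⁅x, y⁆ 2 = x 0 * y 1 - x 1 * y 0 := rfl
@[simp] theorem lie_apply_three (x y : H4) : ⁅x, y⁆ 3 = 0 := rfl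

theorem ext4 {x y : H4} (h0 : x 0 = y 0) (h1 : x 1 = y 1) (h2 : x 2 = y 2) (h3 : x 3 = y 3) :
    x = y := by
  ext a; fin_cases a <;> assumption

instance : LieRing H4 where
  add_lie x y z := by apply ext4 <;> simp <;> ring
  lie_add x y z := by apply ext4 <;> simp <;> ring
  lie_self x := by apply ext4 <;> simp <;> ring
  leibniz_lie x y z := by apply ext4 <;> simp <;> ring

instance : LieAlgebra ℂ H4 where
  lie_smul c x y := by apply ext4 <;> simp <;> ring

theorem lie_E_F : ⁅E, F⁆ = I := by apply ext4 <;> simp <;> simp [E, F, I]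
theorem lie_J_E : ⁅J, E⁆ = E := by apply ext4 <;> simp <;> simp [E, J]
theorem lie_J_F : ⁅J, F⁆ = -F := by apply ext4 <;> simp <;> simp [F, J]
theorem lie_I (x : H4) : ⁅I, x⁆ = 0 := by apply ext4 <;> simp <;> simp [I]

/-- The invariant symmetric form with `(E, F) = (I, J) = 1`, all other pairings of basis vectors
being zero. -/
def form : LinearMap.BilinForm ℂ H4 :=
  LinearMap.mk₂ ℂ (fun x y => x 0 * y 1 + x 1 * y 0 + x 2 * y 3 + x 3 * y 2)
    (by intros; simp; ring) (by intros; simp; ring) (by intros; simp; ring)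
    (by intros; simp; ring)

theorem form_apply (x y : H4) :
    form x y = x 0 * y 1 + x 1 * y 0 + x 2 * y 3 + x 3 * y 2 := rfl

theorem form_isSymm : form.IsSymm := ⟨fun x y => by simp [form_apply]; ring⟩

theorem form_lieInvariant : form.lieInvariant H4 := fun x y z => by
  simp only [form_apply, lie_apply_zero, lie_apply_one, lie_apply_two, lie_apply_three]; ring

end H4

/-! ### The affine Lie algebra -/

/-- The residue cocycle `(A ⊗ t^m, B ⊗ t^n) ↦ n (A, B) δ_{m+n,0}` on the loop algebra. -/
def cocycle := LoopAlgebra.twoCocycleOfBilinear ℂ ℤ H4 H4.form H4.form_lieInvariant H4.form_isSymm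

/-- The affinisation `𝔥₄ ⊗ ℂ[t, t⁻¹] ⊕ ℂ K`. -/
abbrev AffH4 : Type := LieAlgebra.ofTwoCocycle cocycle

/-- `A_n = A ⊗ t^n`. -/
def mode (n : ℤ) : H4 →ₗ[ℂ] AffH4 where
  toFun x := ofProd cocycle (AddMonoidAlgebra.single n 1 ⊗ₜ[ℂ] x, 0)
  map_add' x y := by rw [← of_add]; simp [TensorProduct.tmul_add]
  map_smul' c x := by simp [← of_smul]

/-- The central element `K`; the sign is explained by `lie_mode_mode`. -/
def K : AffH4 :=
  ofProd cocycle (0, -(TrivialLieModule.equiv ℂ (loopAlgebra ℂ ℤ H4) ℂ).symm 1)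

theorem cocycle_single (m n : ℤ) (x y : H4) :
    (cocycle : loopAlgebra ℂ ℤ H4 →ₗ[ℂ] loopAlgebra ℂ ℤ H4 →ₗ[ℂ] _)
      (AddMonoidAlgebra.single m 1 ⊗ₜ[ℂ] x) (AddMonoidAlgebra.single n 1 ⊗ₜ[ℂ] y) =
    (TrivialLieModule.equiv ℂ (loopAlgebra ℂ ℤ H4) ℂ).symm
      (if m + n = 0 then (n : ℂ) * H4.form x y else 0) := by
  change (TrivialLieModule.equiv ℂ (loopAlgebra ℂ ℤ H4) ℂ).symm
    (LoopAlgebra.residuePairing ℂ ℤ H4 H4.form _ _) = _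
  congr 1
  rw [LoopAlgebra.residuePairing_apply_apply, LoopAlgebra.toFinsupp_single_tmul,
    LoopAlgebra.toFinsupp_single_tmul, Finsupp.sum_single_index (by simp)]
  split_ifs with h
  · obtain rfl : m = -n := by omega
    simp
  · rw [Finsupp.single_eq_of_ne (by omega)]
    simp

theorem lie_mode_mode (m n : ℤ) (x y : H4) :
    ⁅mode m x, mode n y⁆ =
      mode (m + n) ⁅x, y⁆ + (if m + n = 0 then (m : ℂ) * H4.form x y else 0) • K := by
  rw [bracket_ofTwoCocycle]
  simp only [mode, K, LinearMap.coe_mk, AddHom.coe_mk, Equiv.symm_apply_apply, ← of_smul, ← of_add,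
    cocycle_single, ExtendScalars.bracket_tmul, AddMonoidAlgebra.single_mul_single, mul_one,
    lie_zero, add_zero, sub_zero, Prod.smul_mk, smul_zero, Prod.mk_add_mk, zero_add]
  congr 2
  rw [smul_neg, ← map_smul, ← map_neg]
  congr 1
  split_ifs with h
  · obtain rfl : m = -n := by omega
    simp
  · simp

theorem lie_K (x : AffH4) : ⁅x, K⁆ = 0 := by
  rw [bracket_ofTwoCocycle, ← of_zero]
  refine Equiv.congr_arg ?_
  ext
  · simp [K]
  · simp only [K, Equiv.symm_apply_apply, map_zero, zero_lie, sub_zero, zero_add, Prod.snd_zero]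
    exact LieModule.IsTrivial.trivial _ _

theorem aff_induction {p : AffH4 → Prop} (mode : ∀ m x, p (mode m x)) (K : p K)
    (add : ∀ y z, p y → p z → p (y + z)) (smul : ∀ (c : ℂ) y, p y → p (c • y)) (y : AffH4) :
    p y := by
  have h0 : p 0 := by simpa using smul 0 _ K
  have hs (s : loopAlgebra ℂ ℤ H4) : p (ofProd cocycle (s, 0)) := by
    induction s using TensorProduct.induction_on with
    | zero => exact h0
    | tmul f x =>
      induction f using AddMonoidAlgebra.induction_linear with
      | zero => rw [TensorProduct.zero_tmul]; exact h0
      | add f g hf hg =>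
        rw [TensorProduct.add_tmul]
        simpa [← of_add] using add _ _ hf hg
      | single m c =>
        have := smul c _ (mode m x)
        rw [← map_smul, NappiWitten.mode, LinearMap.coe_mk, AddHom.coe_mk, ← TensorProduct.smul_tmul,
          AddMonoidAlgebra.smul_single, smul_eq_mul, mul_one] at this
        exact this
    | add s t hs ht => simpa [← of_add] using add _ _ hs ht
  have hc (c : TrivialLieModule ℂ (loopAlgebra ℂ ℤ H4) ℂ) : p (ofProd cocycle (0, c)) := by
    have := smul (-(TrivialLieModule.equiv ℂ (loopAlgebra ℂ ℤ H4) ℂ c)) _ K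
    rw [NappiWitten.K, ← of_smul] at this
    convert this using 2
    ext
    · simp
    · simp [← map_smul]
  have := add _ _ (hs ((ofProd cocycle).symm y).1) (hc ((ofProd cocycle).symm y).2)
  rw [← of_add] at this
  simpa using this

/-- The inclusion of the zero modes. -/
def zeroMode : H4 →ₗ⁅ℂ⁆ AffH4 where
  toLinearMap := mode 0
  map_lie' {x y} := by
    have h := lie_mode_mode 0 0 x y
    simp only [add_zero, Int.cast_zero, zero_mul, if_true, zero_smul] at h
    exact h.symm

/-- The enveloping algebra of the finite-dimensional algebra. -/
abbrev UH4 : Type := UniversalEnvelopingAlgebra ℂ H4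

/-- The enveloping algebra of the affine algebra. -/
abbrev UAff : Type := UniversalEnvelopingAlgebra ℂ AffH4

theorem uAff_mem (T : Subalgebra ℂ UAff)
    (hT : ∀ y : AffH4, UniversalEnvelopingAlgebra.ι ℂ y ∈ T) (a : UAff) : a ∈ T := by
  let g : AffH4 →ₗ⁅ℂ⁆ T :=
    { toFun y := ⟨UniversalEnvelopingAlgebra.ι ℂ y, hT y⟩
      map_add' y z := by ext; simp
      map_smul' c y := by ext; simp
      map_lie' {y z} := by
        ext
        simp [LieRing.of_associative_ring_bracket] }
  have h : T.val.comp (UniversalEnvelopingAlgebra.lift ℂ g) = AlgHom.id ℂ UAff := by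
    apply UniversalEnvelopingAlgebra.hom_ext
    ext y
    simp only [LieHom.comp_apply, AlgHom.coe_toLieHom, AlgHom.comp_apply,
      UniversalEnvelopingAlgebra.lift_ι_apply]
    rfl
  have ha := DFunLike.congr_fun h a
  rw [AlgHom.id_apply] at ha
  rw [← ha]
  exact (UniversalEnvelopingAlgebra.lift ℂ g a).2

/-- The element of the finite enveloping algebra given by a Lie algebra element. -/
abbrev u (x : H4) : UH4 := UniversalEnvelopingAlgebra.ι ℂ x

/-- The element `A_n` of the affine enveloping algebra. -/
abbrev uMode (n : ℤ) (x : H4) : UAff := UniversalEnvelopingAlgebra.ι ℂ (mode n x)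

/-- The algebra map between enveloping algebras induced by `A ↦ A_0`. -/
def zeroModeU : UH4 →ₐ[ℂ] UAff :=
  UniversalEnvelopingAlgebra.lift ℂ ((UniversalEnvelopingAlgebra.ι ℂ).comp zeroMode)

/-! ### Modules over the affine algebra, the Virasoro zero mode, weight spaces, characters -/

section Modules

variable (M : Type*) [AddCommGroup M] [Module ℂ M] [Module UAff M] [IsScalarTower ℂ UAff M]

/-- The action of an element of the enveloping algebra as a `ℂ`-linear operator. -/
def act (a : UAff) : Module.End ℂ M := Algebra.lsmul ℂ ℂ M a

@[simp] theorem act_apply (a : UAff) (v : M) : act M a v = a • v := rfl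

/-- Every vector is annihilated by all modes of sufficiently large index, so that the normally
ordered sum defining `L_0` is finite on it. -/
class IsSmooth : Prop where
  exists_bound : ∀ v : M, ∃ N : ℕ, ∀ n : ℤ, (N : ℤ) ≤ n → ∀ x : H4, uMode n x • v = 0

open H4 in
/-- The terms of `L_0` involving the modes of index `±m`, for `m ≥ 1`. -/
def sugawaraTerm (m : ℤ) : UAff :=
  uMode (-m) E * uMode m F + uMode (-m) F * uMode m E
    + uMode (-m) I * uMode m J + uMode (-m) J * uMode m I
    - uMode (-m) I * uMode m I

open H4 in
/-- The terms of `L_0` involving the zero modes. -/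
def sugawaraZero : UAff :=
  uMode 0 F * uMode 0 E + uMode 0 I * uMode 0 J
    + (1 / 2 : ℂ) • uMode 0 I - (1 / 2 : ℂ) • (uMode 0 I * uMode 0 I)

variable {M} in
theorem finite_support_sugawara [IsSmooth M] (v : M) :
    (Function.support fun m : ℕ => sugawaraTerm (m + 1) • v).Finite := by
  obtain ⟨N, hN⟩ := IsSmooth.exists_bound v
  refine (Set.finite_lt_nat N).subset fun m hm => ?_
  by_contra hlt
  refine hm ?_
  have hle : (N : ℤ) ≤ (m : ℤ) + 1 := by
    simp only [Set.mem_ofPred_eq, not_lt] at hlt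
    omega
  simp only [sugawaraTerm, add_smul, sub_smul, mul_smul, hN _ hle, smul_zero, add_zero, sub_zero]

/-- The zero mode `L_0` of the level-one conformal field
`T = :EF: + :IJ: - ∂I / 2 - :II: / 2`, acting on a smooth module. -/
def L0 [IsSmooth M] : Module.End ℂ M where
  toFun v := sugawaraZero • v + ∑ᶠ m : ℕ, sugawaraTerm (m + 1) • v
  map_add' v w := by
    have h := finsum_add_distrib (finite_support_sugawara v) (finite_support_sugawara w)
    simp only [smul_add, h]
    abel
  map_smul' c v := by
    simp only [smul_comm _ c v, RingHom.id_apply, smul_add, smul_finsum]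

/-- The weight space of a level-one module: the intersection of the eigenspaces of `I_0` (eigenvalue
`a`), `J_0` (eigenvalue `b`) and `K` (eigenvalue `1`) with the generalised eigenspace of `L_0`
(eigenvalue `Δ`). -/
def weightSpace [IsSmooth M] (w : ℂ × ℂ × ℂ) : Submodule ℂ M :=
  (act M (uMode 0 H4.I)).eigenspace w.1 ⊓ (act M (uMode 0 H4.J)).eigenspace w.2.1 ⊓
    (act M (UniversalEnvelopingAlgebra.ι ℂ K)).eigenspace 1 ⊓
    (L0 M).maxGenEigenspace w.2.2

/-- A (level-one) weight module: the direct sum of its weight spaces, all of which are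
finite-dimensional. -/
structure IsWeight [IsSmooth M] : Prop where
  finite : ∀ w, FiniteDimensional ℂ (weightSpace M w)
  indep : iSupIndep (weightSpace M)
  span : ⨆ w, weightSpace M w = ⊤

/-- The character `tr y^{I_0} z^{J_0} q^{L_0 - 1/6}` as a formal sum of monomials `y^a z^b q^d` with
`a, b, d ∈ ℂ`; the value at `(a, b, d)` is the coefficient of `y^a z^b q^d`. -/
def ch [IsSmooth M] : ℂ × ℂ × ℂ → ℤ := fun w =>
  Module.finrank ℂ (weightSpace M (w.1, w.2.1, w.2.2 + 1 / 6))

instance (N : Submodule UAff M) [IsSmooth M] : IsSmooth (M ⧸ N) where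
  exists_bound v := by
    obtain ⟨v, rfl⟩ := N.mkQ_surjective v
    obtain ⟨n, hn⟩ := IsSmooth.exists_bound v
    exact ⟨n, fun k hk x => by rw [← map_smul, hn k hk x, map_zero]⟩

/-- The quotient by the sum of all proper submodules. -/
abbrev IrredQuotient : Type _ := M ⧸ sSup {N : Submodule UAff M | N ≠ ⊤}

end Modules

/-- The monomial `y^a z^b q^d`. -/
def mono (a b d : ℂ) : AddMonoidAlgebra ℤ (ℂ × ℂ × ℂ) := AddMonoidAlgebra.single (a, b, d) 1

/-- Multiplication of a formal sum of monomials by a finite one. -/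
def mulFormal (P : AddMonoidAlgebra ℤ (ℂ × ℂ × ℂ)) (f : ℂ × ℂ × ℂ → ℤ) : ℂ × ℂ × ℂ → ℤ :=
  fun w => P.coeff.sum fun s c => c * f (w - s)

theorem mulFormal_one_sub_mono (a b d : ℂ) (f : ℂ × ℂ × ℂ → ℤ) (w : ℂ × ℂ × ℂ) :
    mulFormal (1 - mono a b d) f w = f w - f (w - (a, b, d)) := by
  have h : (1 - mono a b d).coeff = Finsupp.single 0 1 - Finsupp.single (a, b, d) 1 := rfl
  rw [mulFormal, h, Finsupp.sum_sub_index (by intros; ring), Finsupp.sum_single_index (by simp),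
    Finsupp.sum_single_index (by simp)]
  simp

/-! ### Induced modules -/

/-- The left ideal of the affine enveloping algebra generated by all `A_n` with `n > 0`, by `K - 1`
and by the image under `A ↦ A_0` of a left ideal of the finite enveloping algebra. -/
def inducedIdeal (N : Submodule UH4 UH4) : Submodule UAff UAff :=
  Submodule.span UAff
    ({a | ∃ n : ℤ, 0 < n ∧ ∃ x : H4, a = uMode n x} ∪
      {UniversalEnvelopingAlgebra.ι ℂ K - 1} ∪ zeroModeU '' N)

/-- The level-one module induced from the cyclic module `U(𝔥₄) / N`, on which the positive modes
act as zero and `K` as the identity. -/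
abbrev Induced (N : Submodule UH4 UH4) : Type := UAff ⧸ inducedIdeal N

theorem exists_bound_mul (N : Submodule UH4 UH4) (a : UAff) :
    ∃ n : ℕ, ∀ k : ℤ, (n : ℤ) ≤ k → ∀ x : H4, uMode k x * a ∈ inducedIdeal N := by
  let P : Submodule ℂ UAff :=
    { carrier := {b | ∃ n : ℕ, ∀ k : ℤ, (n : ℤ) ≤ k → ∀ x : H4, uMode k x * b ∈ inducedIdeal N}
      add_mem' := by
        rintro b c ⟨n, hn⟩ ⟨m, hm⟩
        refine ⟨max n m, fun k hk x => ?_⟩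
        rw [mul_add]
        exact add_mem (hn k (by omega) x) (hm k (by omega) x)
      zero_mem' := ⟨0, fun k _ x => by rw [mul_zero]; exact zero_mem _⟩
      smul_mem' := by
        rintro c b ⟨n, hn⟩
        refine ⟨n, fun k hk x => ?_⟩
        rw [mul_smul_comm]
        exact Submodule.smul_of_tower_mem _ c (hn k hk x) }
  have key (y : AffH4) (z : H4) (k : ℤ) (b : UAff) : uMode k z * (UniversalEnvelopingAlgebra.ι ℂ y * b) =
      UniversalEnvelopingAlgebra.ι ℂ y * (uMode k z * b) +
        UniversalEnvelopingAlgebra.ι ℂ ⁅mode k z, y⁆ * b := by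
    rw [LieHom.map_lie, LieRing.of_associative_ring_bracket]
    noncomm_ring
  have hmode (m : ℤ) (y : H4) (b : UAff) (hb : b ∈ P) : uMode m y * b ∈ P := by
    obtain ⟨n, hn⟩ := hb
    refine ⟨n + m.natAbs + 1, fun k hk x => ?_⟩
    rw [key, lie_mode_mode, if_neg (by omega), zero_smul, add_zero]
    exact add_mem (Submodule.smul_mem _ _ (hn k (by omega) x)) (hn _ (by omega) _)
  have hK (b : UAff) (hb : b ∈ P) : UniversalEnvelopingAlgebra.ι ℂ K * b ∈ P := by
    obtain ⟨n, hn⟩ := hb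
    refine ⟨n, fun k hk x => ?_⟩
    rw [key, lie_K, map_zero, zero_mul, add_zero]
    exact Submodule.smul_mem _ _ (hn k hk x)
  have hgen (y : AffH4) (b : UAff) (hb : b ∈ P) : UniversalEnvelopingAlgebra.ι ℂ y * b ∈ P := by
    induction y using aff_induction with
    | mode m x => exact hmode m x b hb
    | K => exact hK b hb
    | add y z hy hz => rw [map_add, add_mul]; exact add_mem hy hz
    | smul c y hy => rw [map_smul, smul_mul_assoc]; exact P.smul_mem c hy
  let T : Subalgebra ℂ UAff :=
    { carrier := {a | ∀ b ∈ P, a * b ∈ P}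
      mul_mem' := fun {a c} ha hc b hb => by rw [mul_assoc]; exact ha _ (hc b hb)
      add_mem' := fun {a c} ha hc b hb => by rw [add_mul]; exact add_mem (ha b hb) (hc b hb)
      algebraMap_mem' := fun c b hb => by rw [← Algebra.smul_def]; exact P.smul_mem c hb }
  have hT : a ∈ T := uAff_mem T (fun y b hb => hgen y b hb) a
  have h1 : (1 : UAff) ∈ P := ⟨1, fun k hk x => by
    rw [mul_one]
    exact Submodule.subset_span (Or.inl (Or.inl ⟨k, by omega, x, rfl⟩))⟩
  have := hT 1 h1
  rwa [mul_one] at this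

instance (N : Submodule UH4 UH4) : IsSmooth (Induced N) where
  exists_bound v := by
    obtain ⟨a, rfl⟩ := (inducedIdeal N).mkQ_surjective v
    obtain ⟨n, hn⟩ := exists_bound_mul N a
    exact ⟨n, fun k hk x => by
      rw [← map_smul, smul_eq_mul, Submodule.mkQ_apply, Submodule.Quotient.mk_eq_zero]
      exact hn k hk x⟩

/-- The left ideal of the highest-weight Verma module of the finite algebra. -/
def finVermaPlus (i j : ℂ) : Submodule UH4 UH4 :=
  Submodule.span UH4
    {u H4.E, u H4.I - algebraMap ℂ UH4 i, u H4.J - algebraMap ℂ UH4 j}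

/-- The left ideal of the lowest-weight Verma module of the finite algebra. -/
def finVermaMinus (i j : ℂ) : Submodule UH4 UH4 :=
  Submodule.span UH4
    {u H4.F, u H4.I - algebraMap ℂ UH4 i, u H4.J - algebraMap ℂ UH4 j}

/-- The left ideal of the dense module of the finite algebra induced from the one-dimensional module
of `ℂ[I, J, Q]`, `Q = F E + I J`, with eigenvalues `i`, `j`, `h`. -/
def finDense (i j h : ℂ) : Submodule UH4 UH4 :=
  Submodule.span UH4
    {u H4.I - algebraMap ℂ UH4 i, u H4.J - algebraMap ℂ UH4 j,
      u H4.F * u H4.E + u H4.I * u H4.J - algebraMap ℂ UH4 h}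

/-- The Verma module `V^+_{i,j}`. -/
abbrev VPlus (i j : ℂ) : Type := Induced (finVermaPlus i j)

/-- The Verma module `V^-_{i,j}`. -/
abbrev VMinus (i j : ℂ) : Type := Induced (finVermaMinus i j)

/-- The irreducible quotient `L^+_{i,j}`. -/
abbrev LPlus (i j : ℂ) : Type := IrredQuotient (VPlus i j)

/-- The irreducible quotient `L^-_{i,j}`. -/
abbrev LMinus (i j : ℂ) : Type := IrredQuotient (VMinus i j)

/-- The relaxed Verma module `R_{i,j;h}`. For `i ≠ 0` it is a model of `R^+_{i;h}` when
`j ∈ h/i + ℤ_{>0}`, and of `R^-_{i;h}` when `j ∈ h/i + ℤ_{≤0}`. -/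
abbrev Rel (i j h : ℂ) : Type := Induced (finDense i j h)

/-- The minimal conformal weight of a relaxed Verma module. -/
def relWeight (i h : ℂ) : ℂ := h + i * (1 / 2 - i / 2)

/-- The space of ground states: the vectors of minimal conformal weight. -/
def groundStates (i j h : ℂ) : Submodule ℂ (Rel i j h) :=
  (L0 (Rel i j h)).maxGenEigenspace (relWeight i h)

/-- The quotient of `R_{i,j;h}` by the sum of all submodules that have zero intersection with the
space of ground states. -/
abbrev RelQuotient (i j h : ℂ) : Type :=
  Rel i j h ⧸ sSup {N : Submodule UAff (Rel i j h) |
    N.restrictScalars ℂ ⊓ groundStates i j h = ⊥}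

/-- `R^+_{i;h}` (for `i ≠ 0`), realised on the generator with `J_0`-eigenvalue `h/i + 1 + n`; all
choices of `n` give isomorphic modules. -/
abbrev RPlus (i h : ℂ) (n : ℕ) : Type := Rel i (h / i + 1 + n) h

/-- `R^-_{i;h}` (for `i ≠ 0`), realised on the generator with `J_0`-eigenvalue `h/i - n`; all
choices of `n` give isomorphic modules. -/
abbrev RMinus (i h : ℂ) (n : ℕ) : Type := Rel i (h / i - n) h

/-- The quotient `E^+_{i;h}` of `R^+_{i;h}`. -/
abbrev EPlus (i h : ℂ) (n : ℕ) : Type := RelQuotient i (h / i + 1 + n) h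

/-- The quotient `E^-_{i;h}` of `R^-_{i;h}`. -/
abbrev EMinus (i h : ℂ) (n : ℕ) : Type := RelQuotient i (h / i - n) h

end NappiWitten

end

/-! Everything is reduced to free oscillators. Among the nonzero modes, the fields E and F fail to
be free only because [E_m, F_n] contains I_{m+n} and [J_m, E_n], [J_m, F_n] contain E_{m+n},
-F_{m+n}. Multiplying E and F by mutually inverse exponentials built from the nonzero modes of I
removes both defects: the dressed modes satisfy [Ê_m, F̂_n] = (m + i) δ_{m+n,0}, they commute with
J_m for m ≠ 0, and I, J remain a Heisenberg pair (`Sys.twist`, `IsCentralIdeal.hat_sys`). The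
dressing is invertible and respects conformal weights, and a subspace is a submodule exactly when it
is stable under the dressed modes (`Stable.smul_mem`, `stable_hat`).

Let W be a cyclic 𝔥₄-module on which I and Q act by scalars. The module induced from W is then a
Fock space ℂ[x_{τ,k}] ⊗ W: dressed creation operators multiply by variables, and dressed
annihilation operators of index n are partial derivatives times n + i, n - i or n. To see that there
are no further relations, the opposite dressing is applied to the free Fock space, which makes it a
module over the affine algebra and gives an inverse map (`toFock_hatPoly`, `fockEquiv`). Monomials
tensored with weight vectors of W therefore form a weight basis.

For an integer i ≠ 0 exactly one of these derivative coefficients vanishes. The corresponding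
variable x_s is the creation operator Ê_{-|i|} if i > 0 and F̂_{-|i|} if i < 0; it commutes with all
dressed modes except J_0, so x_s times the Fock space is a submodule S. A vector outside S involves
a monomial free of x_s, whose variables can all be differentiated away; weight projections then show
that a submodule not contained in S contains a weight vector of W (`exists_inclusion_mem`). In the
Verma case each weight vector of W regenerates W, so S is the largest proper submodule. In the
relaxed case S is the largest submodule meeting the ground states trivially.

Multiplication by x_s is injective and shifts weights by (0, sgn i, |i|), whence the factor 1 -
z^{sgn i} q^{|i|}. The ground states of a relaxed module have the J_0-eigenvalues j + ℤ, each with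
multiplicity one, so the power of z can be absorbed by a shift of W and only 1 - q^{|i|} remains. -/

noncomputable section

namespace NappiWitten

attribute [local instance 100] LieRing.ofAssociativeRing

/-! ### Locally finite sums of operators -/

section LSum

variable {M : Type*} [AddCommGroup M] [Module ℂ M]

/-- `S` is the sum of the pointwise finite family of operators `T`. -/
def LSum {ι : Type*} (T : ι → Module.End ℂ M) (S : Module.End ℂ M) : Prop :=
  ∀ v, (Function.support fun i => T i v).Finite ∧ ∑ᶠ i, T i v = S v

namespace LSum

variable {ι κ : Type*} {T T' : ι → Module.End ℂ M} {S S' : Module.End ℂ M}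

/-- This is how operator identities are proved below: both sides are written as pointwise finite
sums over one index set, and the terms are compared. -/
theorem unique (h : LSum T S) (h' : LSum T S') : S = S' :=
  LinearMap.ext fun v => (h v).2.symm.trans (h' v).2

theorem congr (h : LSum T S) (hT : ∀ i, T' i = T i) : LSum T' S := by
  obtain rfl : T' = T := funext hT
  exact h

theorem exists_of_finite (h : ∀ v, (Function.support fun i => T i v).Finite) :
    ∃ S, LSum T S :=
  ⟨{ toFun v := ∑ᶠ i, T i v
     map_add' v w := by
      simp only [map_add]
      exact finsum_add_distrib (h v) (h w)
     map_smul' c v := by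
      simp only [map_smul, RingHom.id_apply]
      exact (smul_finsum c _).symm }, fun v => ⟨h v, rfl⟩⟩

theorem exists_finset (h : LSum T S) (v : M) :
    ∃ s : Finset ι, (∀ i ∉ s, T i v = 0) ∧ ∑ i ∈ s, T i v = S v := by
  refine ⟨(h v).1.toFinset, fun i hi => by simpa using hi, ?_⟩
  exact (finsum_eq_sum _ (h v).1).symm.trans (h v).2

theorem of_finset (h : ∀ v, ∃ s : Finset ι, (∀ i ∉ s, T i v = 0) ∧ ∑ i ∈ s, T i v = S v) :
    LSum T S := fun v => by
  obtain ⟨s, hs, hS⟩ := h v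
  have hsub : (Function.support fun i => T i v) ⊆ s := fun i hi => by
    by_contra hn
    exact hi (hs i hn)
  exact ⟨s.finite_toSet.subset hsub, by rw [finsum_eq_sum_of_support_subset _ hsub, hS]⟩

theorem add (h : LSum T S) (h' : LSum T' S') : LSum (fun i => T i + T' i) (S + S') := fun v => by
  refine ⟨((h v).1.union (h' v).1).subset (Function.support_add _ _), ?_⟩
  simp only [LinearMap.add_apply, ← (h v).2, ← (h' v).2]
  exact finsum_add_distrib (h v).1 (h' v).1

theorem mul_left (R : Module.End ℂ M) (h : LSum T S) : LSum (fun i => R * T i) (R * S) := fun v => by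
  refine ⟨(h v).1.subset fun i hi hn => hi ?_, ?_⟩
  · change T i v = 0 at hn
    simp [hn]
  · simp only [Module.End.mul_apply, ← (h v).2]
    exact (R.toAddMonoidHom.map_finsum (h v).1).symm

theorem mul_right (R : Module.End ℂ M) (h : LSum T S) : LSum (fun i => T i * R) (S * R) :=
  fun v => h (R v)

theorem smul (c : ℂ) (h : LSum T S) : LSum (fun i => c • T i) (c • S) := by
  have := h.mul_left (c • 1)
  simpa using this

theorem neg (h : LSum T S) : LSum (fun i => - T i) (-S) := by
  have := h.smul (-1)
  simpa using this

theorem sub (h : LSum T S) (h' : LSum T' S') : LSum (fun i => T i - T' i) (S - S') := by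
  have := h.add h'.neg
  simpa [sub_eq_add_neg] using this

theorem equiv (h : LSum T S) (e : κ ≃ ι) : LSum (fun k => T (e k)) S := fun v => by
  refine ⟨(h v).1.preimage e.injective.injOn, ?_⟩
  rw [← (h v).2]
  exact finsum_comp_equiv e (f := fun i => T i v)

theorem single (i₀ : ι) (h : ∀ i, i ≠ i₀ → T i = 0) : LSum T (T i₀) :=
  of_finset fun v => ⟨{i₀}, fun i hi => by simp [h i (by simpa using hi)], by simp⟩

theorem zero (h : ∀ i, T i = 0) : LSum T 0 := of_finset fun v => ⟨∅, fun i _ => by simp [h i], by simp⟩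

/-- On a given `v` only finitely many vectors `T' k v` are nonzero, and each of them meets only
finitely many `T i`; this makes the double family pointwise finite. -/
theorem mul {T' : κ → Module.End ℂ M} (h : LSum T S) (h' : LSum T' S') :
    LSum (fun p : ι × κ => T p.1 * T' p.2) (S * S') := of_finset fun v => by
  classical
  obtain ⟨s', hs', hS'⟩ := h'.exists_finset v
  choose s hs hS using fun k => h.exists_finset (T' k v)
  refine ⟨(s'.biUnion s) ×ˢ s', ?_, ?_⟩
  · rintro ⟨i, k⟩ hik
    by_cases hk : k ∈ s'
    · refine hs k i fun hi => hik ?_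
      simp only [Finset.mem_product, Finset.mem_biUnion]
      exact ⟨⟨k, hk, hi⟩, hk⟩
    · simp [hs' k hk]
  · rw [Finset.sum_product_right, Module.End.mul_apply, ← hS', map_sum]
    refine Finset.sum_congr rfl fun k hk => ?_
    rw [← hS k]
    refine (Finset.sum_subset (Finset.subset_biUnion_of_mem s hk) fun i _ hi => hs k i hi).symm

/-- Fubini for pointwise finite sums. Combined with `equiv` it regroups a double sum along another
pair of coordinates. -/
theorem fiberwise {T : ι × κ → Module.End ℂ M} {S' : ι → Module.End ℂ M} (h : LSum T S)
    (h' : ∀ i, LSum (fun k => T (i, k)) (S' i)) : LSum S' S := of_finset fun v => by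
  classical
  obtain ⟨s, hs, hS⟩ := h.exists_finset v
  have key (i : ι) (t : Finset κ) (ht : ∀ k ∉ t, T (i, k) v = 0) : ∑ k ∈ t, T (i, k) v = S' i v := by
    have hsub : (Function.support fun k => T (i, k) v) ⊆ t := fun k hk => by
      by_contra hn
      exact hk (ht k hn)
    rw [← (h' i v).2, finsum_eq_sum_of_support_subset _ hsub]
  refine ⟨s.image Prod.fst, fun i hi => ?_, ?_⟩
  · rw [← key i ∅, Finset.sum_empty]
    intro k _
    exact hs _ fun hm => hi (Finset.mem_image_of_mem _ hm)
  · rw [← hS, Finset.sum_subset (s₁ := s) (s₂ := s.image Prod.fst ×ˢ s.image Prod.snd)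
      (fun p hp => Finset.mem_product.2 ⟨Finset.mem_image_of_mem _ hp, Finset.mem_image_of_mem _ hp⟩)
      (fun p _ hp => hs p hp), Finset.sum_product]
    refine Finset.sum_congr rfl fun i _ => (key i _ fun k hk => hs _ fun hm => hk ?_).symm
    exact Finset.mem_image_of_mem Prod.snd hm

theorem succ {T : ℕ → Module.End ℂ M} (h : LSum (fun k => T (k + 1)) S) : LSum T (T 0 + S) :=
  of_finset fun v => by
    obtain ⟨s, hs, hS⟩ := h.exists_finset v
    refine ⟨insert 0 (s.map ⟨Nat.succ, Nat.succ_injective⟩), ?_, ?_⟩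
    · rintro (_ | k) hk
      · simp at hk
      · exact hs k fun hm => hk (by simp [hm])
    · rw [Finset.sum_insert (by simp), Finset.sum_map, LinearMap.add_apply, ← hS]
      rfl

theorem commute (h : LSum T S) {R : Module.End ℂ M} (hR : ∀ i, Commute R (T i)) : Commute R S :=
  (h.mul_left R).unique ((h.mul_right R).congr fun i => hR i)

theorem apply_mem (h : LSum T S) {v : M} (N : Submodule ℂ M) (hN : ∀ i, T i v ∈ N) : S v ∈ N := by
  obtain ⟨s, -, hs⟩ := h.exists_finset v
  rw [← hs]
  exact N.sum_mem fun i _ => hN i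

theorem apply_eq_zero (h : LSum T S) {v : M} (hN : ∀ i, T i v = 0) : S v = 0 := by
  simpa using h.apply_mem ⊥ (by simpa using hN)

theorem map {M' : Type*} [AddCommGroup M'] [Module ℂ M'] {T' : ι → Module.End ℂ M'}
    {S' : Module.End ℂ M'} (h : LSum T S) (h' : LSum T' S') (f : M →ₗ[ℂ] M') {v : M}
    (hf : ∀ i, f (T i v) = T' i (f v)) : f (S v) = S' (f v) := by
  rw [← (h v).2, ← (h' (f v)).2]
  refine (f.toAddMonoidHom.map_finsum (h v).1).trans ?_
  exact finsum_congr hf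

end LSum

end LSum

/-! ### Exponentials of power series -/

section Exp

variable {R : Type*} [CommRing R] [Algebra ℂ R]

/-- The coefficients of `exp (∑_{n ≥ 1} x_n z^n / n)`. -/
def expCoeff (x : ℕ → R) : ℕ → R
  | 0 => 1
  | k + 1 => ((k : ℂ) + 1)⁻¹ • ∑ n : Fin (k + 1), x (n + 1) * expCoeff x (k - n)

theorem expCoeff_zero (x : ℕ → R) : expCoeff x 0 = 1 := by rw [expCoeff]

theorem expCoeff_succ (x : ℕ → R) (k : ℕ) :
    ((k : ℂ) + 1) • expCoeff x (k + 1) =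
      ∑ n ∈ Finset.range (k + 1), x (n + 1) * expCoeff x (k - n) := by
  rw [expCoeff, smul_smul, mul_inv_cancel₀ (by exact_mod_cast k.succ_ne_zero), one_smul,
    Finset.sum_range]

-- The recursion defining `expCoeff` is the differential equation of the exponential, read
-- coefficientwise.
open PowerSeries in
theorem derivative_mk_expCoeff (x : ℕ → R) :
    derivative R (PowerSeries.mk (expCoeff x)) = PowerSeries.mk (fun n => x (n + 1)) * PowerSeries.mk (expCoeff x) := by
  ext k
  rw [coeff_derivative, coeff_mk, coeff_mul, Finset.Nat.sum_antidiagonal_eq_sum_range_succ_mk]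
  simp only [coeff_mk]
  rw [← expCoeff_succ, Algebra.smul_def, mul_comm]
  simp

-- The product has zero derivative by the differential equation and constant term 1; absence of
-- torsion makes these two data determine a power series.
open PowerSeries in
theorem mk_expCoeff_mul_neg [IsAddTorsionFree R] (x : ℕ → R) :
    PowerSeries.mk (expCoeff x) * PowerSeries.mk (expCoeff (fun n => - x n)) = 1 := by
  apply derivative.ext
  · rw [Derivation.leibniz, derivative_mk_expCoeff, derivative_mk_expCoeff, Derivation.map_one_eq_zero]
    have : (PowerSeries.mk fun n => - x (n + 1)) = - PowerSeries.mk fun n => x (n + 1) := by ext; simp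
    rw [this]
    simp only [smul_eq_mul]
    ring
  · rw [map_mul, map_one, ← coeff_zero_eq_constantCoeff_apply, ← coeff_zero_eq_constantCoeff_apply,
      coeff_mk, coeff_mk, expCoeff_zero, expCoeff_zero, one_mul]

open PowerSeries in
theorem sum_expCoeff_mul [IsAddTorsionFree R] (x : ℕ → R) (l : ℕ) :
    ∑ p ∈ Finset.HasAntidiagonal.antidiagonal l, expCoeff x p.1 * expCoeff (fun n => - x n) p.2 =
      if l = 0 then 1 else 0 := by
  have := congrArg (coeff l) (mk_expCoeff_mul_neg x)
  simpa [coeff_mul, coeff_one] using this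

-- These are the coefficients of z G′ G⁻¹ for the exponential G, that is, of its logarithmic
-- derivative. In `Sys.twist` this sum produces the correction proportional to I in the commutator
-- of the dressed fields.
open PowerSeries in
theorem sum_smul_expCoeff_mul [IsAddTorsionFree R] (x : ℕ → R) (l : ℕ) :
    ∑ p ∈ Finset.HasAntidiagonal.antidiagonal l, (p.1 : ℂ) • (expCoeff x p.1 * expCoeff (fun n => - x n) p.2) =
      if l = 0 then 0 else x l := by
  have h : X * derivative R (PowerSeries.mk (expCoeff x)) * PowerSeries.mk (expCoeff (fun n => - x n)) =
      X * PowerSeries.mk (fun n => x (n + 1)) := by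
    rw [derivative_mk_expCoeff, mul_assoc, mul_assoc, mk_expCoeff_mul_neg, mul_one]
  have := congrArg (coeff l) h
  rw [coeff_mul] at this
  rcases l with _ | l
  · simp
  · rw [coeff_succ_X_mul, coeff_mk] at this
    rw [if_neg l.succ_ne_zero, ← this]
    refine Finset.sum_congr rfl fun p _ => ?_
    rcases p with ⟨_ | a, b⟩
    · simp
    · rw [coeff_succ_X_mul, coeff_derivative, coeff_mk, coeff_mk, Algebra.smul_def]
      push_cast
      ring

/-- `expCoeff` extended by zero to negative indices. -/
def expCoeffZ (x : ℕ → R) (k : ℤ) : R := if 0 ≤ k then expCoeff x k.toNat else 0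

theorem expCoeffZ_natCast (x : ℕ → R) (k : ℕ) : expCoeffZ x k = expCoeff x k := by
  simp [expCoeffZ]

theorem expCoeffZ_of_neg (x : ℕ → R) {k : ℤ} (hk : k < 0) : expCoeffZ x k = 0 := by
  simp [expCoeffZ, not_le.2 hk]

/-- Terms with n + 1 > k have negative index and vanish, so the summation bound is free; this allows
the recursions for two different indices to share a range. -/
theorem expCoeffZ_recursion (x : ℕ → R) (k : ℤ) (N : ℕ) (hN : k ≤ N) :
    (k : ℂ) • expCoeffZ x k =
      ∑ n ∈ Finset.range N, x (n + 1) * expCoeffZ x (k - (n + 1 : ℕ)) := by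
  rcases lt_trichotomy k 0 with hk | rfl | hk
  · rw [expCoeffZ_of_neg x hk, smul_zero]
    refine (Finset.sum_eq_zero fun n _ => ?_).symm
    rw [expCoeffZ_of_neg x (by omega), mul_zero]
  · simp only [Int.cast_zero, zero_smul]
    refine (Finset.sum_eq_zero fun n _ => ?_).symm
    rw [expCoeffZ_of_neg x (by omega), mul_zero]
  · obtain ⟨k, rfl⟩ : ∃ m : ℕ, k = m + 1 := ⟨(k - 1).toNat, by omega⟩
    have h := expCoeff_succ x k
    have e : expCoeffZ x ((k : ℤ) + 1) = expCoeff x (k + 1) := by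
      rw [← expCoeffZ_natCast]; push_cast; rfl
    rw [e]
    push_cast
    rw [h, ← Finset.sum_subset (Finset.range_subset_range.2 (show k + 1 ≤ N by omega))]
    · refine Finset.sum_congr rfl fun n hn => ?_
      rw [Finset.mem_range] at hn
      rw [← expCoeffZ_natCast]
      congr 2
      omega
    · intro n _ hn
      rw [Finset.mem_range, not_lt] at hn
      rw [expCoeffZ_of_neg x (by omega), mul_zero]

/-- A derivation that sees only x_m multiplies the generating function of the exponential by t z^m.
The induction divides the recursion by k, using t (k - m) + t m = k t. -/
theorem derivation_expCoeffZ (D : Derivation ℂ R R) (x : ℕ → R) (m : ℕ) (hm : 0 < m) (t : ℂ)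
    (hD : ∀ n, 0 < n → D (x n) = if n = m then (t * m) • 1 else 0) (k : ℤ) :
    D (expCoeffZ x k) = t • expCoeffZ x (k - m) := by
  suffices h : ∀ (K : ℕ) (k : ℤ), k ≤ K → D (expCoeffZ x k) = t • expCoeffZ x (k - m) from
    h k.toNat k (by omega)
  intro K
  induction K with
  | zero =>
    intro k hk
    rw [expCoeffZ_of_neg x (show k - m < 0 by omega), smul_zero]
    rcases (show k < 0 ∨ k = 0 by omega) with h | rfl
    · rw [expCoeffZ_of_neg x h, map_zero]
    · rw [show (0 : ℤ) = (0 : ℕ) from rfl, expCoeffZ_natCast, expCoeff_zero, Derivation.map_one_eq_zero]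
  | succ K ih =>
    intro k hk
    rcases (show k ≤ K ∨ k = K + 1 by omega) with h | h
    · exact ih k h
    have hk0 : (k : ℂ) ≠ 0 := by exact_mod_cast (show k ≠ 0 by omega)
    -- The bound is enlarged by m so that the exceptional summand n = m - 1 lies in the range even
    -- when m > k.
    have h1 := congrArg D (expCoeffZ_recursion x k (K + 1 + m) (by omega))
    rw [D.map_smul, map_sum] at h1
    have h2 : ∀ n ∈ Finset.range (K + 1 + m), D (x (n + 1) * expCoeffZ x (k - (n + 1 : ℕ))) =
        t • (x (n + 1) * expCoeffZ x (k - m - (n + 1 : ℕ))) +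
          if n = m - 1 then (t * m) • expCoeffZ x (k - m) else 0 := by
      intro n _
      rw [D.leibniz, hD _ n.succ_pos, ih _ (by omega), smul_eq_mul, smul_eq_mul,
        show k - ((n + 1 : ℕ) : ℤ) - m = k - m - ((n + 1 : ℕ) : ℤ) by ring, mul_smul_comm]
      congr 1
      by_cases hnm : n = m - 1
      · rw [if_pos (by omega), if_pos hnm, mul_smul_comm, mul_one]
        congr 3
        omega
      · rw [if_neg (by omega), if_neg hnm, mul_zero]
    rw [Finset.sum_congr rfl h2, Finset.sum_add_distrib, ← Finset.smul_sum,
      ← expCoeffZ_recursion x (k - m) (K + 1 + m) (by omega),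
      Finset.sum_ite_eq' (Finset.range (K + 1 + m)), if_pos (by simp; omega), smul_smul,
      ← add_smul] at h1
    have h3 : t * ((k - m : ℤ) : ℂ) + t * m = k * t := by push_cast; ring
    rw [h3, mul_smul] at h1
    exact smul_right_injective R hk0 h1

theorem derivation_expCoeffZ_eq_zero (D : Derivation ℂ R R) (x : ℕ → R)
    (hD : ∀ n, 0 < n → D (x n) = 0) (k : ℤ) : D (expCoeffZ x k) = 0 := by
  have := derivation_expCoeffZ D x 1 one_pos 0 (by intro n hn; simp [hD n hn]) k
  simpa using this

/-- If each x_n is homogeneous of degree c n, the recursion makes the k-th coefficient homogeneous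
of degree c k. -/
theorem derivation_expCoeffZ_degree (D : Derivation ℂ R R) (x : ℕ → R) (c : ℂ)
    (hD : ∀ n : ℕ, 0 < n → D (x n) = (c * n) • x n) (k : ℤ) :
    D (expCoeffZ x k) = (c * k) • expCoeffZ x k := by
  suffices h : ∀ (K : ℕ) (k : ℤ), k ≤ K → D (expCoeffZ x k) = (c * k) • expCoeffZ x k from
    h k.toNat k (by omega)
  intro K
  induction K with
  | zero =>
    intro k hk
    rcases (show k < 0 ∨ k = 0 by omega) with h | rfl
    · rw [expCoeffZ_of_neg x h, map_zero, smul_zero]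
    · rw [Int.cast_zero, mul_zero, zero_smul, show (0 : ℤ) = (0 : ℕ) from rfl, expCoeffZ_natCast,
        expCoeff_zero, Derivation.map_one_eq_zero]
  | succ K ih =>
    intro k hk
    rcases (show k ≤ K ∨ k = K + 1 by omega) with h | h
    · exact ih k h
    have hk0 : (k : ℂ) ≠ 0 := by exact_mod_cast (show k ≠ 0 by omega)
    have h1 := congrArg D (expCoeffZ_recursion x k (K + 1) (by omega))
    rw [D.map_smul, map_sum] at h1
    have h2 : ∀ n ∈ Finset.range (K + 1), D (x (n + 1) * expCoeffZ x (k - (n + 1 : ℕ))) =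
        (c * k) • (x (n + 1) * expCoeffZ x (k - (n + 1 : ℕ))) := by
      intro n _
      rw [D.leibniz, hD _ n.succ_pos, ih _ (by omega), smul_eq_mul, smul_eq_mul, mul_smul_comm,
        mul_smul_comm, mul_comm (expCoeffZ x _) (x (n + 1)), ← add_smul]
      congr 1
      push_cast
      ring
    rw [Finset.sum_congr rfl h2, ← Finset.smul_sum,
      ← expCoeffZ_recursion x k (K + 1) (by omega), smul_comm] at h1
    exact smul_right_injective R hk0 h1

end Exp

/-! ### Dressing by exponentials of a commuting family -/

section Twist

variable {M : Type*} [AddCommGroup M] [Module ℂ M]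

/-- The modes of the product of two fields, `∑_k A_k E_{n+k}`. -/
def tw (A E : ℤ → Module.End ℂ M) (n : ℤ) : Module.End ℂ M := by
  classical
  exact if h : ∃ S, LSum (fun k => A k * E (n + k)) S then h.choose else 0

/-- Every vector is annihilated by the operators of sufficiently large index. -/
def BddModes (E : ℤ → Module.End ℂ M) : Prop := ∀ v, ∃ N : ℤ, ∀ n, N ≤ n → E n v = 0

/-- Every vector is annihilated by the operators of sufficiently negative index. -/
def BddCoeffs (A : ℤ → Module.End ℂ M) : Prop := ∀ v, ∃ K : ℤ, ∀ k, k < K → A k v = 0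

theorem lsum_tw {A E : ℤ → Module.End ℂ M} (hA : BddCoeffs A) (hE : BddModes E)
    (hAE : ∀ k n, Commute (A k) (E n)) (n : ℤ) :
    LSum (fun k => A k * E (n + k)) (tw A E n) := by
  have h : ∃ S, LSum (fun k => A k * E (n + k)) S := by
    refine LSum.exists_of_finite fun v => ?_
    obtain ⟨K, hK⟩ := hA v
    obtain ⟨N, hN⟩ := hE v
    refine (Set.finite_Icc K (N - n)).subset fun k hk => ?_
    by_contra hn
    rw [Set.mem_Icc, not_and_or, not_le, not_le] at hn
    refine hk ?_
    rcases hn with hn | hn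
    · change (A k * E (n + k)) v = 0
      rw [(hAE _ _).eq, Module.End.mul_apply, hK k hn, map_zero]
    · change A k (E (n + k) v) = 0
      rw [hN _ (by omega), map_zero]
  rw [tw, dif_pos h]
  exact h.choose_spec

theorem bddModes_tw {A E : ℤ → Module.End ℂ M} (hA : BddCoeffs A) (hE : BddModes E)
    (hAE : ∀ k n, Commute (A k) (E n)) : BddModes (tw A E) := fun v => by
  obtain ⟨K, hK⟩ := hA v
  obtain ⟨N, hN⟩ := hE v
  refine ⟨N - K, fun n hn => (lsum_tw hA hE hAE n).apply_eq_zero fun k => ?_⟩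
  by_cases hk : k < K
  · rw [(hAE _ _).eq, Module.End.mul_apply, hK k hk, map_zero]
  · rw [Module.End.mul_apply, hN _ (by omega), map_zero]

theorem commute_tw {A E : ℤ → Module.End ℂ M} {T : Module.End ℂ M} (hA : BddCoeffs A)
    (hE : BddModes E) (hAE : ∀ k n, Commute (A k) (E n)) (hTA : ∀ k, Commute T (A k))
    (hTE : ∀ n, Commute T (E n)) (n : ℤ) : Commute T (tw A E n) :=
  (lsum_tw hA hE hAE n).commute fun _ => (hTA _).mul_right (hTE _)

/-- Regrouping the double sum of B_k A_l E_{n+k+l} by s = k + l turns it into a convolution of B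
with A, which is the identity at s = 0 and zero elsewhere. -/
theorem tw_tw {A B E : ℤ → Module.End ℂ M} (hA : BddCoeffs A) (hB : BddCoeffs B)
    (hE : BddModes E) (hAE : ∀ k n, Commute (A k) (E n)) (hBE : ∀ k n, Commute (B k) (E n))
    (hBA : ∀ k l, Commute (B k) (A l))
    (hconv : ∀ l, LSum (fun k => B k * A (l - k)) (if l = 0 then 1 else 0)) (n : ℤ) :
    tw B (tw A E) n = E n := by
  have hE' := bddModes_tw hA hE hAE
  have hBE' : ∀ k n, Commute (B k) (tw A E n) := fun k n =>
    commute_tw hA hE hAE (hBA k) (hBE k) n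
  -- On a vector, B bounds k from below, A bounds l from below and E bounds k + l from above, so the
  -- surviving pairs lie in a finite box.
  obtain ⟨S, hS⟩ : ∃ S, LSum (fun p : ℤ × ℤ => B p.1 * A p.2 * E (n + p.1 + p.2)) S := by
    refine LSum.exists_of_finite fun v => ?_
    obtain ⟨K, hK⟩ := hA v
    obtain ⟨K', hK'⟩ := hB v
    obtain ⟨N, hN⟩ := hE v
    refine ((Set.finite_Icc K' (N - n - K)).prod (Set.finite_Icc K (N - n - K'))).subset
      fun p hp => ?_
    obtain ⟨k, l⟩ := p
    have h1 : K' ≤ k := by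
      by_contra hn
      refine hp ?_
      change (B k * A l * E (n + k + l)) v = 0
      rw [mul_assoc, ((hBA k l).mul_right (hBE k _)).eq, Module.End.mul_apply, hK' k (by omega),
        map_zero]
    have h2 : K ≤ l := by
      by_contra hn
      refine hp ?_
      change (B k * A l * E (n + k + l)) v = 0
      rw [mul_assoc, (hAE l _).eq, Module.End.mul_apply, Module.End.mul_apply, hK l (by omega),
        map_zero, map_zero]
    have h3 : k + l ≤ N - n := by
      by_contra hn
      refine hp ?_
      change (B k * A l * E (n + k + l)) v = 0
      rw [Module.End.mul_apply, hN _ (by omega), map_zero]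
    exact ⟨⟨h1, by simp only; omega⟩, ⟨h2, by simp only; omega⟩⟩
  have h1 : tw B (tw A E) n = S := by
    refine (lsum_tw hB hE' hBE' n).unique (hS.fiberwise fun k => ?_)
    exact ((lsum_tw hA hE hAE (n + k)).mul_left (B k)).congr fun l => mul_assoc _ _ _
  rw [h1]
  let e : ℤ × ℤ ≃ ℤ × ℤ :=
    { toFun p := (p.2, p.1 - p.2)
      invFun p := (p.1 + p.2, p.1)
      left_inv p := by ext <;> simp
      right_inv p := by ext <;> simp }
  have h2 := (hS.equiv e).fiberwise (S' := fun s => (if s = 0 then 1 else 0) * E (n + s)) fun s =>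
    ((hconv s).mul_right (E (n + s))).congr fun k => by simp [e, add_assoc]
  have h3 := LSum.single (T := fun s : ℤ => (if s = 0 then 1 else 0) * E (n + s)) 0
    (fun s hs => by simp [hs])
  rw [h2.unique h3]
  simp

/-- A pair of mutually inverse exponentials of a field built from the modes `I`, with logarithmic
derivative `∑ t_l I_{-l} z^l`. -/
structure ExpData (I J : ℤ → Module.End ℂ M) (t : ℤ → ℂ) (A B : ℤ → Module.End ℂ M) : Prop where
  comm_left : ∀ T : Module.End ℂ M, (∀ n, Commute T (I n)) → ∀ k, Commute T (A k)
  comm_right : ∀ T : Module.End ℂ M, (∀ n, Commute T (I n)) → ∀ k, Commute T (B k)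
  bdd_left : BddCoeffs A
  bdd_right : BddCoeffs B
  conv : ∀ l, LSum (fun k => A k * B (l - k)) (if l = 0 then 1 else 0)
  deriv : ∀ l : ℤ, LSum (fun k : ℤ => (k : ℂ) • (A k * B (l - k))) (t l • I (-l))
  lie_left : ∀ m k, J m * A k - A k * J m = t m • A (k - m)
  lie_right : ∀ m k, J m * B k - B k * J m = -t m • B (k - m)

/-- The relations of the modes of a Heisenberg pair `I, J` and of two further fields `E, F`, with
structure constants `c`, `d`. -/
structure Sys (i : ℂ) (c d : ℤ → ℂ) (E F I J : ℤ → Module.End ℂ M) : Prop where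
  EE : ∀ m n, Commute (E m) (E n)
  FF : ∀ m n, Commute (F m) (F n)
  II : ∀ m n, Commute (I m) (I n)
  JJ : ∀ m n, Commute (J m) (J n)
  EI : ∀ m n, Commute (E m) (I n)
  FI : ∀ m n, Commute (F m) (I n)
  EF : ∀ m n, E m * F n - F n * E m =
    c (m + n) • I (m + n) + (if m + n = 0 then (m : ℂ) + i else 0) • 1
  JE : ∀ m n, J m * E n - E n * J m = d m • E (m + n)
  JF : ∀ m n, J m * F n - F n * J m = -d m • F (m + n)
  IJ : ∀ m n, I m * J n - J n * I m = (if m + n = 0 then (m : ℂ) else 0) • 1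
  bddE : BddModes E
  bddF : BddModes F

variable {i : ℂ} {c d t : ℤ → ℂ} {A B E F I J : ℤ → Module.End ℂ M}

/-- The commutator acts by the Leibniz rule. The part falling on A moves k to k - m, and reindexing
the sum turns this into a shift of the mode number by m. -/
theorem lie_tw {d' t' : ℤ → ℂ} {D : Module.End ℂ M} (hA : BddCoeffs A) (hE : BddModes E)
    (hAE : ∀ k n, Commute (A k) (E n)) (m : ℤ)
    (hDA : ∀ k, D * A k - A k * D = t' m • A (k - m))
    (hDE : ∀ n, D * E n - E n * D = d' m • E (m + n)) (n : ℤ) :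
    D * tw A E n - tw A E n * D = (d' m + t' m) • tw A E (m + n) := by
  have h := lsum_tw hA hE hAE
  have h1 := ((h n).mul_left D).sub ((h n).mul_right D)
  have h2 := ((h (m + n)).smul (d' m)).add (((h (m + n)).equiv (Equiv.subRight m)).smul (t' m))
  rw [add_smul]
  refine h1.unique (h2.congr fun k => ?_)
  have h3 : D * (A k * E (n + k)) - A k * E (n + k) * D =
      (D * A k - A k * D) * E (n + k) + A k * (D * E (n + k) - E (n + k) * D) := by noncomm_ring
  rw [h3, hDA, hDE, smul_mul_assoc, mul_smul_comm, add_comm, Equiv.subRight_apply,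
    show m + n + (k - m) = n + k by ring, show m + (n + k) = m + n + k by ring]

/-- The factors of E and F are mutually inverse, so in [AE, BF] the convolution of A and B collapses
for every contribution that depends only on s = k + l. The central term of [E_{m+k}, F_{n+s-k}] is m
+ k + i, however, and the extra k gives the logarithmic derivative of A, a multiple of I_{m+n}. This
changes c_n by t_{-n}; the commutators of J with A and B change d_n by t_n. -/
theorem Sys.twist (h : Sys i c d E F I J) (hA : ExpData I J t A B) :
    Sys i (fun n => c n + t (-n)) (fun n => d n + t n) (tw A E) (tw B F) I J := by
  have hAI m n : Commute (I n) (A m) := hA.comm_left _ (fun k => h.II n k) m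
  have hBI m n : Commute (I n) (B m) := hA.comm_right _ (fun k => h.II n k) m
  have hAA m n : Commute (A m) (A n) := hA.comm_left _ (fun k => (hAI m k).symm) n
  have hBA m n : Commute (B m) (A n) := hA.comm_left _ (fun k => (hBI m k).symm) n
  have hBB m n : Commute (B m) (B n) := hA.comm_right _ (fun k => (hBI m k).symm) n
  have hAE m n : Commute (A m) (E n) := (hA.comm_left _ (fun k => h.EI n k) m).symm
  have hAF m n : Commute (A m) (F n) := (hA.comm_left _ (fun k => h.FI n k) m).symm
  have hBE m n : Commute (B m) (E n) := (hA.comm_right _ (fun k => h.EI n k) m).symm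
  have hBF m n : Commute (B m) (F n) := (hA.comm_right _ (fun k => h.FI n k) m).symm
  have hE := lsum_tw hA.bdd_left h.bddE hAE
  have hF := lsum_tw hA.bdd_right h.bddF hBF
  refine
    { EE := fun m n => ?_
      FF := fun m n => ?_
      II := h.II
      JJ := h.JJ
      EI := fun m n => (commute_tw hA.bdd_left h.bddE hAE (hAI · n) (fun k => (h.EI k n).symm) m).symm
      FI := fun m n => (commute_tw hA.bdd_right h.bddF hBF (hBI · n) (fun k => (h.FI k n).symm) m).symm
      EF := fun m n => ?_
      JE := fun m n => lie_tw hA.bdd_left h.bddE hAE m (hA.lie_left m) (h.JE m) n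
      JF := fun m n => ?_
      IJ := h.IJ
      bddE := bddModes_tw hA.bdd_left h.bddE hAE
      bddF := bddModes_tw hA.bdd_right h.bddF hBF }
  · refine commute_tw hA.bdd_left h.bddE hAE (fun k => ?_) (fun k => ?_) n
    · exact (commute_tw hA.bdd_left h.bddE hAE (hAA k) (hAE k) m).symm
    · exact (commute_tw hA.bdd_left h.bddE hAE (fun l => (hAE l k).symm) (h.EE k) m).symm
  · refine commute_tw hA.bdd_right h.bddF hBF (fun k => ?_) (fun k => ?_) n
    · exact (commute_tw hA.bdd_right h.bddF hBF (hBB k) (hBF k) m).symm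
    · exact (commute_tw hA.bdd_right h.bddF hBF (fun l => (hBF l k).symm) (h.FF k) m).symm
  · have h1 := ((hE m).mul (hF n)).sub (((hF n).mul (hE m)).equiv (Equiv.prodComm ℤ ℤ))
    -- The new coordinates are the sum s of the two indices and the index k of A.
    let e : ℤ × ℤ ≃ ℤ × ℤ :=
      { toFun p := (p.2, p.1 - p.2)
        invFun p := (p.1 + p.2, p.1)
        left_inv p := by ext <;> simp
        right_inv p := by ext <;> simp }
    have h2 := (h1.equiv e).fiberwise
      (S' := fun s => (if s = 0 then c (m + n) • I (m + n) + (if m + n = 0 then (m : ℂ) + i else 0) • 1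
          else 0) + (if s = -(m + n) then t (-(m + n)) • I (m + n) else 0)) fun s => by
      -- The commutator splits into a part independent of k, summed by `conv`, and the part carrying
      -- the factor k, summed by `deriv`.
      have key : LSum (fun k => A k * B (s - k) *
          (c (m + n + s) • I (m + n + s) + (if m + n + s = 0 then (m : ℂ) + i else 0) • 1) +
          (if m + n + s = 0 then (1 : ℂ) else 0) • ((k : ℂ) • (A k * B (s - k))))
          ((if s = 0 then 1 else 0) * (c (m + n + s) • I (m + n + s) +
            (if m + n + s = 0 then (m : ℂ) + i else 0) • 1) +
            (if m + n + s = 0 then (1 : ℂ) else 0) • (t s • I (-s))) :=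
        ((hA.conv s).mul_right _).add ((hA.deriv s).smul _)
      have hval : (if s = 0 then c (m + n) • I (m + n) +
          (if m + n = 0 then (m : ℂ) + i else 0) • (1 : Module.End ℂ M)
          else 0) + (if s = -(m + n) then t (-(m + n)) • I (m + n) else 0) =
          (if s = 0 then 1 else 0) * (c (m + n + s) • I (m + n + s) +
            (if m + n + s = 0 then (m : ℂ) + i else 0) • 1) +
            (if m + n + s = 0 then (1 : ℂ) else 0) • (t s • I (-s)) := by
        congr 1
        · by_cases hs : s = 0
          · subst hs; simp
          · simp [hs]
        · by_cases hs : s = -(m + n)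
          · subst hs; simp
          · rw [if_neg hs, if_neg (by omega), zero_smul]
      rw [hval]
      refine key.congr fun k => ?_
      have hF' : B (s - k) * F (n + (s - k)) * (A k * E (m + k)) =
          A k * B (s - k) * (F (n + (s - k)) * E (m + k)) := by
        rw [mul_assoc, ← mul_assoc (F _), ← (hAF k _).eq, mul_assoc (A k), ← mul_assoc (B _),
          (hBA _ _).eq, mul_assoc]
      have hE' : A k * E (m + k) * (B (s - k) * F (n + (s - k))) =
          A k * B (s - k) * (E (m + k) * F (n + (s - k))) := by
        rw [mul_assoc, ← mul_assoc (E _), ← (hBE _ _).eq, mul_assoc (B _), ← mul_assoc (A _)]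
      simp only [e, Equiv.coe_fn_mk, Equiv.prodComm_apply, Prod.swap]
      rw [hF', hE', ← mul_sub, h.EF, show m + k + (n + (s - k)) = m + n + s by ring]
      by_cases hs : m + n + s = 0
      · simp only [hs, if_true, one_smul, mul_add, mul_smul_comm, mul_one, add_assoc]
        rw [← add_smul]
        congr 2
        push_cast
        ring
      · simp [hs]
    have h3 := (LSum.single (T := fun s : ℤ => if s = 0 then c (m + n) • I (m + n) +
          (if m + n = 0 then (m : ℂ) + i else 0) • 1 else 0) 0 (fun s hs => by simp [hs])).add
      (LSum.single (T := fun s : ℤ => if s = -(m + n) then t (-(m + n)) • I (m + n) else 0)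
        (-(m + n)) (fun s hs => if_neg hs))
    rw [h2.unique h3]
    simp only [if_true, add_smul]
    abel
  · have := lie_tw (d' := fun m => -d m) (t' := fun m => -t m) hA.bdd_right h.bddF hBF m
      (hA.lie_right m) (h.JF m) n
    rw [this]
    congr 1
    ring

end Twist

/-! ### Polynomials in commuting operators -/

section Poly

variable {M : Type*} [AddCommGroup M] [Module ℂ M] {σ : Type*}

/-- Commuting operators generate a commutative subalgebra, where polynomials can be evaluated.
Exponentials of the modes of I can thus be computed in a polynomial ring. -/
theorem exists_algHom_of_commute (a : σ → Module.End ℂ M) (ha : ∀ s t, Commute (a s) (a t)) :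
    ∃ φ : MvPolynomial σ ℂ →ₐ[ℂ] Module.End ℂ M, ∀ s, φ (MvPolynomial.X s) = a s := by
  have hcomm : ∀ x ∈ Set.range a, ∀ y ∈ Set.range a, x * y = y * x := by
    rintro _ ⟨s, rfl⟩ _ ⟨t, rfl⟩
    exact ha s t
  have := Algebra.isMulCommutative_adjoin ℂ hcomm
  let _ : CommSemiring (Algebra.adjoin ℂ (Set.range a)) :=
    { (Algebra.adjoin ℂ (Set.range a)).toSemiring with
      mul_comm := this.is_comm.comm }
  let b : σ → Algebra.adjoin ℂ (Set.range a) := fun s =>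
    ⟨a s, Algebra.subset_adjoin (Set.mem_range_self s)⟩
  exact ⟨(Algebra.adjoin ℂ (Set.range a)).val.comp (MvPolynomial.aeval b), fun s => by simp [b]⟩

variable (φ : MvPolynomial σ ℂ →ₐ[ℂ] Module.End ℂ M)

theorem commute_polyHom {T : Module.End ℂ M} (h : ∀ s, Commute T (φ (MvPolynomial.X s)))
    (p : MvPolynomial σ ℂ) : Commute T (φ p) := by
  induction p using MvPolynomial.induction_on with
  | C a =>
    rw [← MvPolynomial.algebraMap_eq, AlgHom.commutes]
    exact Algebra.commutes' a T |>.symm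
  | add p q hp hq => rw [map_add]; exact hp.add_right hq
  | mul_X p s hp => rw [map_mul]; exact hp.mul_right (h s)

/-- Both sides obey the Leibniz rule in `p`, so agreement on the variables suffices. -/
theorem lie_polyHom {T : Module.End ℂ M}
    (D : Derivation ℂ (MvPolynomial σ ℂ) (MvPolynomial σ ℂ))
    (h : ∀ s, T * φ (MvPolynomial.X s) - φ (MvPolynomial.X s) * T = φ (D (MvPolynomial.X s)))
    (p : MvPolynomial σ ℂ) : T * φ p - φ p * T = φ (D p) := by
  induction p using MvPolynomial.induction_on with
  | C a =>
    rw [← MvPolynomial.algebraMap_eq, AlgHom.commutes, D.map_algebraMap, map_zero, sub_eq_zero]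
    exact (Algebra.commutes' a T).symm
  | add p q hp hq => rw [map_add, map_add, map_add, ← hp, ← hq]; noncomm_ring
  | mul_X p s hp =>
    rw [map_mul, D.leibniz, smul_eq_mul, smul_eq_mul, map_add, map_mul, mul_comm (MvPolynomial.X s),
      map_mul, ← hp, ← h]
    noncomm_ring

end Poly

/-! ### The two halves of the vertex operator -/

section Half

variable {M : Type*} [AddCommGroup M] [Module ℂ M]
variable (φ : MvPolynomial ℤ ℂ →ₐ[ℂ] Module.End ℂ M)

open MvPolynomial

/-- The exponents of the creation part of the vertex operator. -/
def creationExp (r : ℂ) (n : ℕ) : MvPolynomial ℤ ℂ := r • X (-(n : ℤ))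

/-- The exponents of the annihilation part of the vertex operator. -/
def annihilationExp (r : ℂ) (n : ℕ) : MvPolynomial ℤ ℂ := -r • X (n : ℤ)

/-- The coefficients of the creation part of the vertex operator. -/
def creationCoeff (r : ℂ) (k : ℤ) : Module.End ℂ M := φ (expCoeffZ (creationExp r) k)

/-- The coefficients of the annihilation part of the vertex operator. -/
def annihilationCoeff (r : ℂ) (k : ℤ) : Module.End ℂ M := φ (expCoeffZ (annihilationExp r) (-k))

/-- Local nilpotency of the annihilation modes. -/
def LocNil (r : ℂ) : Prop :=
  ∀ v, ∃ N : ℕ, ∀ b : ℤ, (N : ℤ) ≤ b → φ (expCoeffZ (annihilationExp r) b) v = 0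

theorem creationExp_neg (r : ℂ) : creationExp (-r) = fun n => - creationExp r n := by
  ext1 n; simp [creationExp]

theorem annihilationExp_neg (r : ℂ) : annihilationExp (-r) = fun n => - annihilationExp r n := by
  ext1 n; simp [annihilationExp]

theorem lsum_antidiagonal {T : ℤ → Module.End ℂ M} (l : ℕ) (h : ∀ k, k < 0 ∨ (l : ℤ) < k → T k = 0) :
    LSum T (∑ p ∈ Finset.HasAntidiagonal.antidiagonal l, T p.1) := LSum.of_finset fun v => by
  classical
  refine ⟨(Finset.range (l + 1)).map ⟨((↑) : ℕ → ℤ), Nat.cast_injective⟩, fun k hk => ?_, ?_⟩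
  · rw [h k, LinearMap.zero_apply]
    by_contra hn
    push Not at hn
    refine hk (Finset.mem_map.2 ⟨k.toNat, ?_, ?_⟩)
    · rw [Finset.mem_range]; omega
    · simp; omega
  · rw [Finset.sum_map, Finset.Nat.sum_antidiagonal_eq_sum_range_succ_mk, LinearMap.sum_apply]
    rfl

theorem lsum_expCoeffZ_mul (x : ℕ → MvPolynomial ℤ ℂ) (l : ℤ) :
    LSum (fun k => φ (expCoeffZ x k) * φ (expCoeffZ (fun n => - x n) (l - k)))
      (if l = 0 then 1 else 0) := by
  rcases lt_or_ge l 0 with hl | hl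
  · rw [if_neg hl.ne]
    refine LSum.zero fun k => ?_
    rcases lt_or_ge k 0 with hk | hk
    · rw [expCoeffZ_of_neg x hk, map_zero, zero_mul]
    · rw [expCoeffZ_of_neg _ (show l - k < 0 by omega), map_zero, mul_zero]
  · obtain ⟨l, rfl⟩ := Int.eq_ofNat_of_zero_le hl
    have h := lsum_antidiagonal (T := fun k => φ (expCoeffZ x k) * φ (expCoeffZ (fun n => - x n) (l - k)))
      l (by
        rintro k (hk | hk)
        · rw [expCoeffZ_of_neg x hk, map_zero, zero_mul]
        · rw [expCoeffZ_of_neg _ (show l - k < 0 by omega), map_zero, mul_zero])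
    convert h using 1
    have h2 := congrArg φ (sum_expCoeff_mul x l)
    rw [map_sum] at h2
    have h3 : φ (if l = 0 then 1 else 0) = if (l : ℤ) = 0 then 1 else 0 := by
      split_ifs <;> simp_all
    rw [← h3, ← h2]
    refine Finset.sum_congr rfl fun p hp => ?_
    rw [Finset.HasAntidiagonal.mem_antidiagonal] at hp
    rw [map_mul, expCoeffZ_natCast, show (l : ℤ) - p.1 = p.2 by omega, expCoeffZ_natCast]

theorem lsum_smul_expCoeffZ_mul (x : ℕ → MvPolynomial ℤ ℂ) (l : ℤ) :
    LSum (fun k : ℤ => (k : ℂ) • (φ (expCoeffZ x k) * φ (expCoeffZ (fun n => - x n) (l - k))))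
      (if 0 < l then φ (x l.toNat) else 0) := by
  rcases lt_or_ge l 0 with hl | hl
  · rw [if_neg hl.not_gt]
    refine LSum.zero fun k => ?_
    rcases lt_or_ge k 0 with hk | hk
    · rw [expCoeffZ_of_neg x hk, map_zero, zero_mul, smul_zero]
    · rw [expCoeffZ_of_neg _ (show l - k < 0 by omega), map_zero, mul_zero, smul_zero]
  · obtain ⟨l, rfl⟩ := Int.eq_ofNat_of_zero_le hl
    have h := lsum_antidiagonal
      (T := fun k : ℤ => (k : ℂ) • (φ (expCoeffZ x k) * φ (expCoeffZ (fun n => - x n) (l - k)))) l (by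
        rintro k (hk | hk)
        · rw [expCoeffZ_of_neg x hk, map_zero, zero_mul, smul_zero]
        · rw [expCoeffZ_of_neg _ (show l - k < 0 by omega), map_zero, mul_zero, smul_zero])
    convert h using 1
    have h2 := congrArg φ (sum_smul_expCoeff_mul x l)
    rw [map_sum] at h2
    have h3 : φ (if l = 0 then 0 else x l) = if (0 : ℤ) < l then φ (x (l : ℤ).toNat) else 0 := by
      rcases l with _ | l
      · simp
      · rw [if_neg (by omega), if_pos (by omega)]; simp
    rw [← h3, ← h2]
    refine Finset.sum_congr rfl fun p hp => ?_
    rw [Finset.HasAntidiagonal.mem_antidiagonal] at hp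
    rw [map_smul, map_mul, expCoeffZ_natCast, show (l : ℤ) - p.1 = p.2 by omega, expCoeffZ_natCast]
    simp

variable {φ} {I J : ℤ → Module.End ℂ M} (hφ : ∀ n, φ (X n) = I n)
  (hIJ : ∀ m n, I m * J n - J n * I m = (if m + n = 0 then (m : ℂ) else 0) • 1)

-- By the Heisenberg relation J_m acts on polynomials in the modes of I as m ∂/∂X_{-m}; its
-- commutator with an exponential then follows from `derivation_expCoeffZ`.
include hIJ hφ in
theorem lie_polyHom_pderiv (m : ℤ) (p : MvPolynomial ℤ ℂ) :
    J m * φ p - φ p * J m = φ (((m : ℂ) • pderiv (-m) : Derivation ℂ _ _) p) := by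
  refine lie_polyHom φ _ (fun n => ?_) p
  rw [hφ, ← neg_sub, hIJ, Derivation.smul_apply, pderiv_X, map_smul, ← neg_smul]
  by_cases h : n + m = 0
  · obtain rfl : n = -m := by omega
    simp
  · rw [if_neg h, Pi.single_eq_of_ne (by omega)]
    simp

include hIJ hφ in
theorem lie_creationCoeff (r : ℂ) (m k : ℤ) :
    J m * creationCoeff φ r k - creationCoeff φ r k * J m =
      (if 0 < m then r else 0) • creationCoeff φ r (k - m) := by
  rw [creationCoeff, creationCoeff, lie_polyHom_pderiv hφ hIJ, ← map_smul]
  congr 1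
  split_ifs with hm
  · obtain ⟨m, rfl⟩ := Int.eq_ofNat_of_zero_le hm.le
    refine derivation_expCoeffZ _ _ m (by omega) r (fun n _ => ?_) k
    rw [creationExp, Derivation.map_smul, Derivation.smul_apply, pderiv_X]
    by_cases h : n = m
    · subst h; simp [smul_smul]
    · rw [if_neg h, Pi.single_eq_of_ne (by omega)]; simp
  · rw [zero_smul]
    refine derivation_expCoeffZ_eq_zero _ _ (fun n hn => ?_) k
    rw [creationExp, Derivation.map_smul, Derivation.smul_apply, pderiv_X]
    by_cases h : m = 0
    · simp [h]
    · rw [Pi.single_eq_of_ne (by omega)]; simp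

include hIJ hφ in
theorem lie_annihilationCoeff (r : ℂ) (m k : ℤ) :
    J m * annihilationCoeff φ r k - annihilationCoeff φ r k * J m =
      (if m < 0 then r else 0) • annihilationCoeff φ r (k - m) := by
  rw [annihilationCoeff, annihilationCoeff, lie_polyHom_pderiv hφ hIJ, ← map_smul]
  congr 1
  split_ifs with hm
  · obtain ⟨m, rfl⟩ : ∃ p : ℕ, m = -p := ⟨m.natAbs, by omega⟩
    rw [show -(k - -(m : ℤ)) = -k - m by ring]
    refine derivation_expCoeffZ _ _ m (by omega) r (fun n _ => ?_) _
    rw [annihilationExp, Derivation.map_smul, Derivation.smul_apply, pderiv_X]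
    by_cases h : n = m
    · subst h; simp [smul_smul]
    · rw [if_neg h, Pi.single_eq_of_ne (by omega)]; simp
  · rw [zero_smul]
    refine derivation_expCoeffZ_eq_zero _ _ (fun n hn => ?_) _
    rw [annihilationExp, Derivation.map_smul, Derivation.smul_apply, pderiv_X]
    by_cases h : m = 0
    · simp [h]
    · rw [Pi.single_eq_of_ne (by omega)]; simp

include hφ in
theorem commute_polyHom_modes {T : Module.End ℂ M} (hT : ∀ n, Commute T (I n))
    (p : MvPolynomial ℤ ℂ) : Commute T (φ p) :=
  commute_polyHom φ (fun n => by rw [hφ]; exact hT n) p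

include hIJ hφ in
theorem expData_creation (r : ℂ) :
    ExpData I J (fun m => if 0 < m then r else 0) (creationCoeff φ r) (creationCoeff φ (-r)) where
  comm_left T hT k := commute_polyHom_modes hφ hT _
  comm_right T hT k := commute_polyHom_modes hφ hT _
  bdd_left v := ⟨0, fun k hk => by simp [creationCoeff, expCoeffZ_of_neg _ hk]⟩
  bdd_right v := ⟨0, fun k hk => by simp [creationCoeff, expCoeffZ_of_neg _ hk]⟩
  conv l := by
    simp only [creationCoeff, creationExp_neg]
    exact lsum_expCoeffZ_mul φ _ l
  deriv l := by
    simp only [creationCoeff, creationExp_neg]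
    convert lsum_smul_expCoeffZ_mul φ (creationExp r) l using 1
    split_ifs with h
    · rw [creationExp, map_smul, hφ, Int.toNat_of_nonneg h.le]
    · simp
  lie_left m k := lie_creationCoeff hφ hIJ r m k
  lie_right m k := by
    rw [lie_creationCoeff hφ hIJ (-r) m k]
    congr 1
    split_ifs <;> simp

-- The annihilation half has coefficients of arbitrarily negative index, so its lower boundedness on
-- a vector is precisely the local nilpotency assumed here. The creation half needs no such
-- assumption.
include hIJ hφ in
theorem expData_annihilation (r : ℂ) (hr : LocNil φ r) (hr' : LocNil φ (-r)) :
    ExpData I J (fun m => if m < 0 then r else 0) (annihilationCoeff φ r)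
      (annihilationCoeff φ (-r)) where
  comm_left T hT k := commute_polyHom_modes hφ hT _
  comm_right T hT k := commute_polyHom_modes hφ hT _
  bdd_left v := by
    obtain ⟨N, hN⟩ := hr v
    exact ⟨-N, fun k hk => hN _ (by omega)⟩
  bdd_right v := by
    obtain ⟨N, hN⟩ := hr' v
    exact ⟨-N, fun k hk => hN _ (by omega)⟩
  conv l := by
    simp only [annihilationCoeff, annihilationExp_neg]
    have := (lsum_expCoeffZ_mul φ (annihilationExp r) (-l)).equiv (Equiv.neg ℤ)
    simp only [Equiv.neg_apply, neg_eq_zero] at this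
    exact this.congr fun k => by rw [show -(l - k) = -l - -k by ring]
  deriv l := by
    simp only [annihilationCoeff, annihilationExp_neg]
    -- Coefficients are indexed by -k, so the weight k contributes a sign; the minus sign in
    -- `annihilationExp` compensates it.
    have := ((lsum_smul_expCoeffZ_mul φ (annihilationExp r) (-l)).equiv (Equiv.neg ℤ)).neg
    simp only [Equiv.neg_apply] at this
    convert this.congr (T' := fun k : ℤ => (k : ℂ) • (φ (expCoeffZ (annihilationExp r) (-k)) *
      φ (expCoeffZ (fun n => - annihilationExp r n) (-(l - k))))) _ using 1
    · by_cases h : l < 0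
      · rw [if_pos h, if_pos (by omega), annihilationExp, map_smul, hφ, Int.toNat_of_nonneg (by omega),
          neg_smul, neg_neg]
      · rw [if_neg h, if_neg (by omega), zero_smul, neg_zero]
    · intro k
      rw [show -(l - k) = -l - -k by ring]
      simp
  lie_left m k := lie_annihilationCoeff hφ hIJ r m k
  lie_right m k := by
    rw [lie_annihilationCoeff hφ hIJ (-r) m k]
    congr 1
    split_ifs <;> simp


/-! ### Dressing by both halves and its inverse -/

variable (φ) in
/-- The families of operators which can be multiplied by the vertex operators. -/
structure Dressable (E : ℤ → Module.End ℂ M) : Prop where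
  comm : ∀ p n, Commute (φ p) (E n)
  bdd : BddModes E
  nil : ∀ r, LocNil φ r

variable (φ) in
/-- Multiplication by the vertex operator. -/
def vtw (r : ℂ) (E : ℤ → Module.End ℂ M) : ℤ → Module.End ℂ M :=
  tw (annihilationCoeff φ r) (tw (creationCoeff φ r) E)

variable (φ) in
/-- Multiplication by the vertex operator, its halves being taken in the opposite order. -/
def vtw' (r : ℂ) (E : ℤ → Module.End ℂ M) : ℤ → Module.End ℂ M :=
  tw (creationCoeff φ r) (tw (annihilationCoeff φ r) E)

theorem bddCoeffs_creationCoeff (r : ℂ) : BddCoeffs (creationCoeff φ r) := fun v =>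
  ⟨0, fun k hk => by simp [creationCoeff, expCoeffZ_of_neg _ hk]⟩

theorem bddCoeffs_annihilationCoeff {r : ℂ} (hr : LocNil φ r) :
    BddCoeffs (annihilationCoeff φ r) := fun v => by
  obtain ⟨N, hN⟩ := hr v
  exact ⟨-N, fun k hk => hN _ (by omega)⟩

theorem commute_polyHom_polyHom (p q : MvPolynomial ℤ ℂ) : Commute (φ p) (φ q) := by
  rw [Commute, SemiconjBy, ← map_mul, ← map_mul, mul_comm]

namespace Dressable

variable {E : ℤ → Module.End ℂ M} (h : Dressable φ E)

include h

theorem lsum_creation (r : ℂ) (n : ℤ) :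
    LSum (fun k => creationCoeff φ r k * E (n + k)) (tw (creationCoeff φ r) E n) :=
  lsum_tw (bddCoeffs_creationCoeff r) h.bdd (fun _ _ => h.comm _ _) n

theorem lsum_annihilation (r : ℂ) (n : ℤ) :
    LSum (fun k => annihilationCoeff φ r k * E (n + k)) (tw (annihilationCoeff φ r) E n) :=
  lsum_tw (bddCoeffs_annihilationCoeff (h.nil r)) h.bdd (fun _ _ => h.comm _ _) n

theorem creation (r : ℂ) : Dressable φ (tw (creationCoeff φ r) E) where
  comm p n := (h.lsum_creation r n).commute fun _ =>
    (commute_polyHom_polyHom p _).mul_right (h.comm p _)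
  bdd := bddModes_tw (bddCoeffs_creationCoeff r) h.bdd (fun _ _ => h.comm _ _)
  nil := h.nil

theorem annihilation (r : ℂ) : Dressable φ (tw (annihilationCoeff φ r) E) where
  comm p n := (h.lsum_annihilation r n).commute fun _ =>
    (commute_polyHom_polyHom p _).mul_right (h.comm p _)
  bdd := bddModes_tw (bddCoeffs_annihilationCoeff (h.nil r)) h.bdd (fun _ _ => h.comm _ _)
  nil := h.nil

theorem creation_neg_creation (r : ℂ) :
    tw (creationCoeff φ (-r)) (tw (creationCoeff φ r) E) = E := by
  ext1 n
  refine tw_tw (bddCoeffs_creationCoeff r) (bddCoeffs_creationCoeff (-r)) h.bdd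
    (fun _ _ => h.comm _ _) (fun _ _ => h.comm _ _) (fun _ _ => commute_polyHom_polyHom _ _)
    (fun l => ?_) n
  have := lsum_expCoeffZ_mul φ (creationExp (-r)) l
  simp only [creationExp_neg, neg_neg] at this
  simpa only [creationCoeff, creationExp_neg] using this

theorem annihilation_neg_annihilation (r : ℂ) :
    tw (annihilationCoeff φ (-r)) (tw (annihilationCoeff φ r) E) = E := by
  ext1 n
  refine tw_tw (bddCoeffs_annihilationCoeff (h.nil r)) (bddCoeffs_annihilationCoeff (h.nil (-r)))
    h.bdd (fun _ _ => h.comm _ _) (fun _ _ => h.comm _ _)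
    (fun _ _ => commute_polyHom_polyHom _ _) (fun l => ?_) n
  have := (lsum_expCoeffZ_mul φ (annihilationExp (-r)) (-l)).equiv (Equiv.neg ℤ)
  simp only [annihilationExp_neg, neg_neg, Equiv.neg_apply, neg_eq_zero] at this
  simp only [annihilationCoeff, annihilationExp_neg]
  exact this.congr fun k => by rw [show -(l - k) = -l - -k by ring]

/-- The halves are removed in the order opposite to that in which they were applied. Keeping the two
versions `vtw` and `vtw'` avoids having to interchange the halves. -/
theorem vtw'_vtw (r : ℂ) : vtw' φ (-r) (vtw φ r E) = E := by
  rw [vtw', vtw, (h.creation r).annihilation_neg_annihilation, h.creation_neg_creation]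

theorem vtw_vtw' (r : ℂ) : vtw φ r (vtw' φ (-r) E) = E := by
  have h1 := (h.annihilation (-r)).creation_neg_creation (-r)
  have h2 := h.annihilation_neg_annihilation (-r)
  rw [neg_neg] at h1 h2
  rw [vtw', vtw, h1, h2]

theorem dress' (r : ℂ) : Dressable φ (vtw' φ r E) := (h.annihilation r).creation r

theorem dress (r : ℂ) : Dressable φ (vtw φ r E) := (h.creation r).annihilation r

/-- On each vector a dressed mode is a finite sum of products of modes of I and E, so stable
subspaces remain stable. -/
theorem vtw_apply_mem (r : ℂ) (N : Submodule ℂ M) (hN : ∀ p, ∀ v ∈ N, φ p v ∈ N)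
    (hE : ∀ n, ∀ v ∈ N, E n v ∈ N) (n : ℤ) {v : M} (hv : v ∈ N) : vtw φ r E n v ∈ N :=
  ((h.creation r).lsum_annihilation r n).apply_mem N fun _ => hN _ _
    ((h.lsum_creation r _).apply_mem N fun _ => hN _ _ (hE _ _ hv))

theorem vtw'_apply_mem (r : ℂ) (N : Submodule ℂ M) (hN : ∀ p, ∀ v ∈ N, φ p v ∈ N)
    (hE : ∀ n, ∀ v ∈ N, E n v ∈ N) (n : ℤ) {v : M} (hv : v ∈ N) : vtw' φ r E n v ∈ N :=
  ((h.annihilation r).lsum_creation r n).apply_mem N fun _ => hN _ _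
    ((h.lsum_annihilation r _).apply_mem N fun _ => hN _ _ (hE _ _ hv))

/-- Dressing is natural: an intertwiner of the undressed operators passes through both pointwise
finite sums. -/
theorem map_vtw' {M' : Type*} [AddCommGroup M'] [Module ℂ M']
    {φ' : MvPolynomial ℤ ℂ →ₐ[ℂ] Module.End ℂ M'} {E' : ℤ → Module.End ℂ M'}
    (h' : Dressable φ' E') (r : ℂ) (f : M →ₗ[ℂ] M') (hf : ∀ p v, f (φ p v) = φ' p (f v))
    (hE : ∀ n v, f (E n v) = E' n (f v)) (n : ℤ) (v : M) :
    f (vtw' φ r E n v) = vtw' φ' r E' n (f v) :=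
  ((h.annihilation r).lsum_creation r n).map ((h'.annihilation r).lsum_creation r n) f fun k => by
    rw [Module.End.mul_apply, Module.End.mul_apply, creationCoeff, hf, creationCoeff]
    congr 1
    exact (h.lsum_annihilation r _).map (h'.lsum_annihilation r _) f fun k => by
      rw [Module.End.mul_apply, Module.End.mul_apply, annihilationCoeff, hf, hE, annihilationCoeff]

end Dressable

/-! ### Vacuum vectors, local nilpotency and degree -/

variable (φ) in
/-- Vectors annihilated by the annihilation modes. -/
def IsVac (v : M) : Prop := ∀ n : ℤ, 0 < n → φ (X n) v = 0

theorem creationCoeff_zero (r : ℂ) : creationCoeff φ r 0 = 1 := by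
  rw [creationCoeff, show (0 : ℤ) = (0 : ℕ) from rfl, expCoeffZ_natCast, expCoeff_zero, map_one]

theorem annihilationCoeff_zero (r : ℂ) : annihilationCoeff φ r 0 = 1 := by
  rw [annihilationCoeff, neg_zero, show (0 : ℤ) = (0 : ℕ) from rfl, expCoeffZ_natCast,
    expCoeff_zero, map_one]

theorem IsVac.annihilationExp_apply {v : M} (hv : IsVac φ v) (r : ℂ) {b : ℤ} (hb : 0 < b) :
    φ (expCoeffZ (annihilationExp r) b) v = 0 := by
  have h := congrArg (fun p => φ p v) (expCoeffZ_recursion (annihilationExp r) b b.toNat (by omega))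
  simp only [map_smul, map_sum, LinearMap.sum_apply, LinearMap.smul_apply] at h
  rw [Finset.sum_eq_zero] at h
  · exact (smul_eq_zero.1 h).resolve_left (by exact_mod_cast hb.ne')
  · intro n _
    rw [mul_comm, map_mul, Module.End.mul_apply, annihilationExp, map_smul, LinearMap.smul_apply,
      hv _ (by positivity), smul_zero, map_zero]

theorem IsVac.annihilationCoeff_apply {v : M} (hv : IsVac φ v) (r : ℂ) {k : ℤ} (hk : k ≠ 0) :
    annihilationCoeff φ r k v = 0 := by
  rcases lt_or_gt_of_ne hk with hk | hk
  · exact hv.annihilationExp_apply r (by omega)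
  · rw [annihilationCoeff, expCoeffZ_of_neg _ (by omega), map_zero, LinearMap.zero_apply]

/-- On a vacuum vector the annihilation half reduces to its zeroth coefficient 1. In the creation
half the coefficients with k > 0 accompany E_{n+k} v, which vanishes because n ≥ 0. -/
theorem Dressable.vtw'_apply_vac {E : ℤ → Module.End ℂ M} (h : Dressable φ E) (r : ℂ) {v : M}
    (hv : IsVac φ v) (hE : ∀ n, 0 < n → E n v = 0) {n : ℤ} (hn : 0 ≤ n) :
    vtw' φ r E n v = E n v := by
  have h1 (n : ℤ) : tw (annihilationCoeff φ r) E n v = E n v := by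
    rw [← ((h.lsum_annihilation r n) v).2, finsum_eq_single _ 0]
    · beta_reduce
      rw [annihilationCoeff_zero, add_zero, one_mul]
    intro k hk
    beta_reduce
    rw [annihilationCoeff, (h.comm _ _).eq, Module.End.mul_apply, ← annihilationCoeff,
      hv.annihilationCoeff_apply r hk, map_zero]
  rw [vtw', ← (((h.annihilation r).lsum_creation r n) v).2, finsum_eq_single _ 0]
  · beta_reduce
    rw [creationCoeff_zero, add_zero, one_mul, h1]
  intro k hk
  rw [Module.End.mul_apply, h1]
  rcases lt_or_gt_of_ne hk with hk | hk
  · rw [creationCoeff, expCoeffZ_of_neg _ hk, map_zero, LinearMap.zero_apply]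
  · rw [hE _ (by omega), map_zero]

theorem Dressable.vtw_apply_vac {E : ℤ → Module.End ℂ M} (h : Dressable φ E) (r : ℂ) {v : M}
    (hv : IsVac φ v) (hE : ∀ n, 0 < n → E n v = 0) {n : ℤ} (hn : 0 ≤ n) :
    vtw φ r E n v = E n v := by
  have h1 (n : ℤ) (hn : 0 ≤ n) : tw (creationCoeff φ r) E n v = E n v := by
    rw [← ((h.lsum_creation r n) v).2, finsum_eq_single _ 0]
    · beta_reduce
      rw [creationCoeff_zero, add_zero, one_mul]
    intro k hk
    rw [Module.End.mul_apply]
    rcases lt_or_gt_of_ne hk with hk | hk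
    · rw [creationCoeff, expCoeffZ_of_neg _ hk, map_zero, LinearMap.zero_apply]
    · rw [hE _ (by omega), map_zero]
  rw [vtw, ← (((h.creation r).lsum_annihilation r n) v).2, finsum_eq_single _ 0]
  · beta_reduce
    rw [annihilationCoeff_zero, add_zero, one_mul, h1 n hn]
  intro k hk
  beta_reduce
  rw [annihilationCoeff, ((h.creation r).comm _ _).eq, Module.End.mul_apply, ← annihilationCoeff,
    hv.annihilationCoeff_apply r hk, map_zero]

/-- The space of vectors on which the annihilation part of the vertex operator is a polynomial is
preserved by any operator commuting with it up to a shift. -/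
theorem locNil_apply {T : Module.End ℂ M} {r a : ℂ} {m : ℤ}
    (hT : ∀ b, T * φ (expCoeffZ (annihilationExp r) b) - φ (expCoeffZ (annihilationExp r) b) * T =
      a • φ (expCoeffZ (annihilationExp r) (b + m))) {v : M}
    (hv : ∃ N : ℕ, ∀ b : ℤ, (N : ℤ) ≤ b → φ (expCoeffZ (annihilationExp r) b) v = 0) :
    ∃ N : ℕ, ∀ b : ℤ, (N : ℤ) ≤ b → φ (expCoeffZ (annihilationExp r) b) (T v) = 0 := by
  obtain ⟨N, hN⟩ := hv
  refine ⟨N + m.natAbs, fun b hb => ?_⟩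
  have h := LinearMap.congr_fun (hT b) v
  rw [LinearMap.sub_apply, Module.End.mul_apply, Module.End.mul_apply, hN b (by omega), map_zero,
    zero_sub, LinearMap.smul_apply, hN _ (by omega), smul_zero, neg_eq_zero] at h
  exact h

include hIJ hφ in
theorem locNil_apply_J (r : ℂ) (m : ℤ) {v : M}
    (hv : ∃ N : ℕ, ∀ b : ℤ, (N : ℤ) ≤ b → φ (expCoeffZ (annihilationExp r) b) v = 0) :
    ∃ N : ℕ, ∀ b : ℤ, (N : ℤ) ≤ b → φ (expCoeffZ (annihilationExp r) b) (J m v) = 0 := by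
  refine locNil_apply (a := if m < 0 then r else 0) (m := m) (fun b => ?_) hv
  have := lie_annihilationCoeff hφ hIJ r m (-b)
  rw [annihilationCoeff, annihilationCoeff, neg_neg, show -(-b - m) = b + m by ring] at this
  exact this

theorem locNil_apply_of_commute {T : Module.End ℂ M} (r : ℂ) (hT : ∀ p, Commute T (φ p)) {v : M}
    (hv : ∃ N : ℕ, ∀ b : ℤ, (N : ℤ) ≤ b → φ (expCoeffZ (annihilationExp r) b) v = 0) :
    ∃ N : ℕ, ∀ b : ℤ, (N : ℤ) ≤ b → φ (expCoeffZ (annihilationExp r) b) (T v) = 0 :=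
  locNil_apply (a := 0) (m := 0) (fun b => by rw [zero_smul, (hT _).eq, sub_self]) hv

theorem locNil_add {r : ℂ} {v w : M}
    (hv : ∃ N : ℕ, ∀ b : ℤ, (N : ℤ) ≤ b → φ (expCoeffZ (annihilationExp r) b) v = 0)
    (hw : ∃ N : ℕ, ∀ b : ℤ, (N : ℤ) ≤ b → φ (expCoeffZ (annihilationExp r) b) w = 0) :
    ∃ N : ℕ, ∀ b : ℤ, (N : ℤ) ≤ b → φ (expCoeffZ (annihilationExp r) b) (v + w) = 0 := by
  obtain ⟨N, hN⟩ := hv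
  obtain ⟨N', hN'⟩ := hw
  exact ⟨max N N', fun b hb => by rw [map_add, hN b (by omega), hN' b (by omega), add_zero]⟩

/-- The degrees k of A_k and -(n + k) of E_{n+k} add up to -n for every k, so dressing preserves the
grading. -/
theorem tw_degree {A E : ℤ → Module.End ℂ M} {D : Module.End ℂ M} {n : ℤ}
    (hS : LSum (fun k => A k * E (n + k)) (tw A E n))
    (hA : ∀ k : ℤ, D * A k - A k * D = (k : ℂ) • A k)
    (hE : ∀ n : ℤ, D * E n - E n * D = (-n : ℂ) • E n) :
    D * tw A E n - tw A E n * D = (-n : ℂ) • tw A E n := by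
  refine ((hS.mul_left D).sub (hS.mul_right D)).unique ((hS.smul (-n : ℂ)).congr fun k => ?_)
  have h3 : D * (A k * E (n + k)) - A k * E (n + k) * D =
      (D * A k - A k * D) * E (n + k) + A k * (D * E (n + k) - E (n + k) * D) := by noncomm_ring
  rw [h3, hA, hE, smul_mul_assoc, mul_smul_comm, ← add_smul]
  congr 1
  push_cast
  ring

theorem lie_polyHom_degree {D : Module.End ℂ M}
    (hD : ∀ n : ℤ, D * φ (X n) - φ (X n) * D = (-n : ℂ) • φ (X n)) (p : MvPolynomial ℤ ℂ) :
    D * φ p - φ p * D = φ (mkDerivation ℂ (fun n : ℤ => (-n : ℂ) • (X n : MvPolynomial ℤ ℂ)) p) :=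
  lie_polyHom φ _ (fun n => by rw [hD, mkDerivation_X, map_smul]) p

theorem Dressable.vtw'_degree {E : ℤ → Module.End ℂ M} (h : Dressable φ E) (r : ℂ)
    {D : Module.End ℂ M} (hD : ∀ n : ℤ, D * φ (X n) - φ (X n) * D = (-n : ℂ) • φ (X n))
    (hE : ∀ n : ℤ, D * E n - E n * D = (-n : ℂ) • E n) (n : ℤ) :
    D * vtw' φ r E n - vtw' φ r E n * D = (-n : ℂ) • vtw' φ r E n := by
  refine tw_degree ((h.annihilation r).lsum_creation r n) (fun _ => ?_) fun n =>
    tw_degree (h.lsum_annihilation r n) (fun _ => ?_) hE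
  · rw [creationCoeff, lie_polyHom_degree hD, ← map_smul]
    congr 1
    rw [derivation_expCoeffZ_degree _ _ 1, one_mul]
    intro n _
    rw [creationExp, Derivation.map_smul, mkDerivation_X, smul_comm]
    simp
  · rw [annihilationCoeff, lie_polyHom_degree hD, ← map_smul]
    congr 1
    rw [derivation_expCoeffZ_degree _ _ (-1)]
    · congr 1
      push_cast
      ring
    intro n _
    rw [annihilationExp, Derivation.map_smul, mkDerivation_X, smul_comm]
    simp

variable {i : ℂ} {c d : ℤ → ℂ} {E F : ℤ → Module.End ℂ M}

include hφ in
theorem Sys.dressable_left (h : Sys i c d E F I J) (hr : ∀ r, LocNil φ r) : Dressable φ E where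
  comm p n := (commute_polyHom_modes hφ (h.EI n) p).symm
  bdd := h.bddE
  nil := hr

include hφ in
theorem Sys.dressable_right (h : Sys i c d E F I J) (hr : ∀ r, LocNil φ r) : Dressable φ F where
  comm p n := (commute_polyHom_modes hφ (h.FI n) p).symm
  bdd := h.bddF
  nil := hr

-- The two halves together change c_n and d_n by r at every n ≠ 0 and leave the zero modes alone.
-- Hence r = 1 turns the decoupled constants c = 0, d_n = δ_{n,0} into the affine ones, and r = -1
-- reverses this.
include hφ in
theorem Sys.dress (h : Sys i c d E F I J) (r : ℂ) (hr : ∀ r, LocNil φ r) :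
    Sys i (fun n => c n + if n = 0 then 0 else r) (fun n => d n + if n = 0 then 0 else r)
      (vtw φ r E) (vtw φ (-r) F) I J := by
  have := (h.twist (expData_creation hφ h.IJ r)).twist
    (expData_annihilation hφ h.IJ r (hr r) (hr (-r)))
  have e1 : (fun n => c n + if n = 0 then 0 else r) =
      fun n => (c n + if 0 < -n then r else 0) + if -n < 0 then r else 0 := by
    ext1 n
    rcases lt_trichotomy n 0 with hn | rfl | hn
    · simp [hn, hn.ne, hn.not_gt]
    · simp
    · simp [hn, hn.ne', hn.not_gt]
  have e2 : (fun n => d n + if n = 0 then 0 else r) =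
      fun n => (d n + if 0 < n then r else 0) + if n < 0 then r else 0 := by
    ext1 n
    rcases lt_trichotomy n 0 with hn | rfl | hn
    · simp [hn, hn.ne, hn.not_gt]
    · simp
    · simp [hn, hn.ne', hn.not_gt]
  rw [e1, e2]
  exact this

include hφ in
theorem Sys.dress' (h : Sys i c d E F I J) (r : ℂ) (hr : ∀ r, LocNil φ r) :
    Sys i (fun n => c n + if n = 0 then 0 else r) (fun n => d n + if n = 0 then 0 else r)
      (vtw' φ r E) (vtw' φ (-r) F) I J := by
  have := (h.twist (expData_annihilation hφ h.IJ r (hr r) (hr (-r)))).twist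
    (expData_creation hφ h.IJ r)
  have e1 : (fun n => c n + if n = 0 then 0 else r) =
      fun n => (c n + if -n < 0 then r else 0) + if 0 < -n then r else 0 := by
    ext1 n
    rcases lt_trichotomy n 0 with hn | rfl | hn
    · simp [hn, hn.ne, hn.not_gt]
    · simp
    · simp [hn, hn.ne', hn.not_gt]
  have e2 : (fun n => d n + if n = 0 then 0 else r) =
      fun n => (d n + if n < 0 then r else 0) + if 0 < n then r else 0 := by
    ext1 n
    rcases lt_trichotomy n 0 with hn | rfl | hn
    · simp [hn, hn.ne, hn.not_gt]
    · simp
    · simp [hn, hn.ne', hn.not_gt]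
  rw [e1, e2]
  exact this

end Half

/-! ### The modes as operators; the Virasoro zero mode is a derivation -/

section Sugawara

variable (M : Type*) [AddCommGroup M] [Module ℂ M] [Module UAff M] [IsScalarTower ℂ UAff M]

/-- The operator `x_n` on a module. -/
def modeOp (x : H4) (n : ℤ) : Module.End ℂ M := act M (uMode n x)

variable {M}

theorem act_mul (a b : UAff) : act M (a * b) = act M a * act M b := map_mul _ a b

theorem act_add (a b : UAff) : act M (a + b) = act M a + act M b := map_add _ a b

theorem act_sub (a b : UAff) : act M (a - b) = act M a - act M b := map_sub _ a b

theorem act_smul (c : ℂ) (b : UAff) : act M (c • b) = c • act M b :=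
  map_smul (Algebra.lsmul ℂ ℂ M) c b

theorem modeOp_apply (x : H4) (n : ℤ) (v : M) : modeOp M x n v = uMode n x • v := rfl

theorem uMode_mul_sub (m n : ℤ) (x y : H4) :
    uMode m x * uMode n y - uMode n y * uMode m x = uMode (m + n) ⁅x, y⁆ +
      (if m + n = 0 then (m : ℂ) * H4.form x y else 0) • UniversalEnvelopingAlgebra.ι ℂ K := by
  rw [← LieRing.of_associative_ring_bracket, ← LieHom.map_lie, lie_mode_mode, map_add, map_smul]

theorem modeOp_mul_sub (hK : ∀ v : M, UniversalEnvelopingAlgebra.ι ℂ K • v = v) (m n : ℤ)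
    (x y : H4) : modeOp M x m * modeOp M y n - modeOp M y n * modeOp M x m =
      modeOp M ⁅x, y⁆ (m + n) + (if m + n = 0 then (m : ℂ) * H4.form x y else 0) • 1 := by
  have hK' : act M (UniversalEnvelopingAlgebra.ι ℂ K) = 1 := LinearMap.ext hK
  rw [modeOp, modeOp, modeOp, ← act_mul, ← act_mul, ← act_sub, uMode_mul_sub, act_add, act_smul, hK']

theorem modeOp_smul (c : ℂ) (x : H4) (n : ℤ) : modeOp M (c • x) n = c • modeOp M x n := by
  rw [modeOp, uMode, map_smul, map_smul, act_smul]; rfl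

theorem modeOp_zero (n : ℤ) : modeOp M 0 n = 0 := by
  simpa using modeOp_smul (M := M) 0 0 n

theorem modeOp_neg (x : H4) (n : ℤ) : modeOp M (-x) n = - modeOp M x n := by
  simpa using modeOp_smul (M := M) (-1) x n

theorem H4.form_E_F : H4.form H4.E H4.F = 1 := by
  rw [H4.form_apply]; simp [H4.E, H4.F]
theorem H4.form_I_J : H4.form H4.I H4.J = 1 := by
  rw [H4.form_apply]; simp [H4.I, H4.J]
theorem H4.form_J_E : H4.form H4.J H4.E = 0 := by
  rw [H4.form_apply]; simp [H4.E, H4.J]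
theorem H4.form_J_F : H4.form H4.J H4.F = 0 := by
  rw [H4.form_apply]; simp [H4.F, H4.J]
theorem H4.form_I_E : H4.form H4.I H4.E = 0 := by
  rw [H4.form_apply]; simp [H4.E, H4.I]
theorem H4.form_I_F : H4.form H4.I H4.F = 0 := by
  rw [H4.form_apply]; simp [H4.F, H4.I]
theorem H4.form_I_I : H4.form H4.I H4.I = 0 := by
  rw [H4.form_apply]; simp [H4.I]
theorem H4.form_E_E : H4.form H4.E H4.E = 0 := by
  rw [H4.form_apply]; simp [H4.E]
theorem H4.form_F_F : H4.form H4.F H4.F = 0 := by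
  rw [H4.form_apply]; simp [H4.F]
theorem H4.form_J_J : H4.form H4.J H4.J = 0 := by
  rw [H4.form_apply]; simp [H4.J]

/-! ### Commutation relations of the modes at level one -/

section Relations

variable (hK : ∀ v : M, UniversalEnvelopingAlgebra.ι ℂ K • v = v)
include hK

open H4

theorem modeOp_E_F (m n : ℤ) : modeOp M E m * modeOp M F n - modeOp M F n * modeOp M E m =
    modeOp M I (m + n) + (if m + n = 0 then (m : ℂ) else 0) • 1 := by
  rw [modeOp_mul_sub hK, lie_E_F, form_E_F, mul_one]

theorem modeOp_J_E (m n : ℤ) : modeOp M J m * modeOp M E n - modeOp M E n * modeOp M J m =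
    modeOp M E (m + n) := by
  rw [modeOp_mul_sub hK, lie_J_E, form_J_E]; simp

theorem modeOp_J_F (m n : ℤ) : modeOp M J m * modeOp M F n - modeOp M F n * modeOp M J m =
    - modeOp M F (m + n) := by
  rw [modeOp_mul_sub hK, lie_J_F, form_J_F, modeOp_neg]; simp

theorem modeOp_I_J (m n : ℤ) : modeOp M I m * modeOp M J n - modeOp M J n * modeOp M I m =
    (if m + n = 0 then (m : ℂ) else 0) • 1 := by
  rw [modeOp_mul_sub hK, lie_I, form_I_J, modeOp_zero, mul_one, zero_add]

theorem modeOp_commute {x y : H4} (h : ⁅x, y⁆ = 0) (h' : H4.form x y = 0) (m n : ℤ) :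
    Commute (modeOp M x m) (modeOp M y n) := by
  rw [commute_iff_eq, ← sub_eq_zero, modeOp_mul_sub hK, h, h', modeOp_zero]; simp

theorem modeOp_I_E (m n : ℤ) : Commute (modeOp M I m) (modeOp M E n) :=
  modeOp_commute hK (lie_I _) form_I_E m n

theorem modeOp_I_F (m n : ℤ) : Commute (modeOp M I m) (modeOp M F n) :=
  modeOp_commute hK (lie_I _) form_I_F m n

theorem modeOp_I_I (m n : ℤ) : Commute (modeOp M I m) (modeOp M I n) :=
  modeOp_commute hK (lie_I _) form_I_I m n

theorem modeOp_E_E (m n : ℤ) : Commute (modeOp M E m) (modeOp M E n) :=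
  modeOp_commute hK (lie_self _) form_E_E m n

theorem modeOp_F_F (m n : ℤ) : Commute (modeOp M F m) (modeOp M F n) :=
  modeOp_commute hK (lie_self _) form_F_F m n

theorem modeOp_J_J (m n : ℤ) : Commute (modeOp M J m) (modeOp M J n) :=
  modeOp_commute hK (lie_self _) form_J_J m n

end Relations

theorem act_sugawaraTerm (m : ℤ) : act M (sugawaraTerm m) =
    modeOp M H4.E (-m) * modeOp M H4.F m + modeOp M H4.F (-m) * modeOp M H4.E m +
    modeOp M H4.I (-m) * modeOp M H4.J m + modeOp M H4.J (-m) * modeOp M H4.I m -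
    modeOp M H4.I (-m) * modeOp M H4.I m := by
  simp only [sugawaraTerm, act_sub, act_add, act_mul, modeOp]

theorem act_sugawaraZero : act M sugawaraZero =
    modeOp M H4.F 0 * modeOp M H4.E 0 + modeOp M H4.I 0 * modeOp M H4.J 0 +
    (1 / 2 : ℂ) • modeOp M H4.I 0 - (1 / 2 : ℂ) • (modeOp M H4.I 0 * modeOp M H4.I 0) := by
  simp only [sugawaraZero, act_sub, act_add, act_mul, act_smul, modeOp]

theorem bddModes_modeOp [IsSmooth M] (x : H4) : BddModes (modeOp M x) := fun v => by
  obtain ⟨N, hN⟩ := IsSmooth.exists_bound v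
  exact ⟨N, fun n hn => hN n hn x⟩

theorem lsum_L0 [IsSmooth M] :
    LSum (fun m : ℕ => act M (sugawaraTerm (m + 1))) (L0 M - act M sugawaraZero) := fun v =>
  ⟨finite_support_sugawara v, by simp [L0]⟩

-- Since E_n = [J_n, E_0], F_n = -[J_n, F_0] and I_n = [E_n, F_0] up to a vanishing central term,
-- this reduces the degree of every mode to that of J_n, E_0 and F_0.
omit [Module UAff M] [IsScalarTower ℂ UAff M] in
theorem lie_degree {D X Y : Module.End ℂ M} {a b : ℂ} (hX : D * X - X * D = a • X)
    (hY : D * Y - Y * D = b • Y) :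
    D * (X * Y - Y * X) - (X * Y - Y * X) * D = (a + b) • (X * Y - Y * X) := by
  have e : D * (X * Y - Y * X) - (X * Y - Y * X) * D =
      (D * X - X * D) * Y + X * (D * Y - Y * D) - (D * Y - Y * D) * X - Y * (D * X - X * D) := by
    noncomm_ring
  rw [e, hX, hY]
  simp only [smul_mul_assoc, mul_smul_comm, smul_sub, add_smul]
  abel

omit [Module UAff M] [IsScalarTower ℂ UAff M] in
/-- The partial sums `∑_{m ≥ a} G_m`. -/
theorem exists_tails {G : ℤ → Module.End ℂ M} (hG : BddModes G) :
    ∃ S : ℤ → Module.End ℂ M, ∀ a, LSum (fun k : ℕ => G (a + k)) (S a) ∧ S a = G a + S (a + 1) := by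
  have h a : ∃ S, LSum (fun k : ℕ => G (a + k)) S := LSum.exists_of_finite fun v => by
    obtain ⟨N, hN⟩ := hG v
    refine (Set.finite_lt_nat (N - a).toNat).subset fun k hk => ?_
    by_contra hn
    simp only [Set.mem_ofPred_eq, not_lt] at hn
    exact hk (hN _ (by omega))
  choose S hS using h
  refine ⟨S, fun a => ⟨hS a, ?_⟩⟩
  have h1 : LSum (fun k : ℕ => G (a + (k + 1 : ℕ))) (S (a + 1)) :=
    (hS (a + 1)).congr fun k => by congr 1; push_cast; ring
  have h2 := LSum.succ (T := fun k : ℕ => G (a + k)) h1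
  have h3 := (hS a).unique h2
  rw [h3]
  simp

end Sugawara

/-! ### Commutators of the Virasoro zero mode with the modes -/

section SugawaraLie

variable {M : Type*} [AddCommGroup M] [Module ℂ M] [Module UAff M] [IsScalarTower ℂ UAff M]
  [IsSmooth M] (hK : ∀ v : M, UniversalEnvelopingAlgebra.ι ℂ K • v = v)
include hK

open H4

omit hK in
theorem commute_L0_of_termwise {X : Module.End ℂ M} (h : ∀ m : ℤ, Commute X (act M (sugawaraTerm m)))
    (h0 : Commute X (act M sugawaraZero)) : Commute X (L0 M) := by
  have := (lsum_L0 (M := M)).commute fun m => h (m + 1)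
  simpa using this.add_right h0

/-- The terms of L_0 with indices ±m are invariant under the zero modes for each m separately,
because the form is invariant; no infinite sum has to be rearranged. -/
theorem commute_E_L0 : Commute (modeOp M E 0) (L0 M) := by
  refine commute_L0_of_termwise (fun m => ?_) ?_
  · have h1 := modeOp_E_F hK 0 m
    have h2 := modeOp_E_F hK 0 (-m)
    have h3 := modeOp_J_E hK m 0
    have h4 := modeOp_J_E hK (-m) 0
    have h5 := (modeOp_I_E hK m 0).eq
    have h6 := (modeOp_I_E hK (-m) 0).eq
    have h7 := (modeOp_E_E hK m 0).eq
    have h8 := (modeOp_E_E hK (-m) 0).eq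
    simp only [zero_add, add_zero, Int.cast_zero, ite_self, zero_smul] at h1 h2 h3 h4
    rw [act_sugawaraTerm, commute_iff_eq]
    generalize modeOp M E 0 = e0 at *
    generalize modeOp M E m = e at *
    generalize modeOp M F m = f at *
    generalize modeOp M I m = i at *
    generalize modeOp M J m = j at *
    generalize modeOp M E (-m) = e' at *
    generalize modeOp M F (-m) = f' at *
    generalize modeOp M I (-m) = i' at *
    generalize modeOp M J (-m) = j' at *
    linear_combination (norm := noncomm_ring) e' * h1 - h8 * f + h2 * e - f' * h7 - h6 * j - i' * h3 -
      h4 * i - j' * h5 + h6 * i + i' * h5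
  · have h1 := modeOp_E_F hK 0 0
    have h3 := modeOp_J_E hK 0 0
    have h5 := (modeOp_I_E hK 0 0).eq
    simp only [add_zero, Int.cast_zero, ite_self, zero_smul] at h1 h3
    rw [act_sugawaraZero, commute_iff_eq, mul_sub, mul_add, sub_mul, add_mul, mul_smul_comm,
      mul_smul_comm, smul_mul_assoc, smul_mul_assoc, ← h5, ← mul_assoc (modeOp M E 0) (modeOp M I 0), ← h5, mul_assoc (modeOp M I 0) (modeOp M E 0), ← h5, mul_assoc (modeOp M I 0) (modeOp M I 0)]
    congr 2
    generalize modeOp M E 0 = e0 at *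
    generalize modeOp M F 0 = f at *
    generalize modeOp M I 0 = i at *
    generalize modeOp M J 0 = j at *
    linear_combination (norm := noncomm_ring) h1 * e0 - i * h3 - h5 * j

theorem commute_F_L0 : Commute (modeOp M F 0) (L0 M) := by
  refine commute_L0_of_termwise (fun m => ?_) ?_
  · have h1 := modeOp_E_F hK m 0
    have h2 := modeOp_E_F hK (-m) 0
    have h3 := modeOp_J_F hK m 0
    have h4 := modeOp_J_F hK (-m) 0
    have h5 := (modeOp_I_F hK m 0).eq
    have h6 := (modeOp_I_F hK (-m) 0).eq
    have h7 := (modeOp_F_F hK m 0).eq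
    have h8 := (modeOp_F_F hK (-m) 0).eq
    have hz (m : ℤ) : (if m = 0 then (m : ℂ) else 0) = 0 := by split_ifs with h <;> simp [h]
    simp only [add_zero, hz, zero_smul] at h1 h2 h3 h4
    rw [act_sugawaraTerm, commute_iff_eq]
    generalize modeOp M F 0 = f0 at *
    generalize modeOp M E m = e at *
    generalize modeOp M F m = f at *
    generalize modeOp M I m = i at *
    generalize modeOp M J m = j at *
    generalize modeOp M E (-m) = e' at *
    generalize modeOp M F (-m) = f' at *
    generalize modeOp M I (-m) = i' at *
    generalize modeOp M J (-m) = j' at *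
    linear_combination (norm := noncomm_ring) - h2 * f - e' * h7 - h8 * e - f' * h1 - h6 * j - i' * h3 -
      h4 * i - j' * h5 + h6 * i + i' * h5
  · have h1 := modeOp_E_F hK 0 0
    have h3 := modeOp_J_F hK 0 0
    have h5 := (modeOp_I_F hK 0 0).eq
    simp only [add_zero, Int.cast_zero, ite_self, zero_smul] at h1 h3
    rw [act_sugawaraZero, commute_iff_eq, mul_sub, mul_add, sub_mul, add_mul, mul_smul_comm,
      mul_smul_comm, smul_mul_assoc, smul_mul_assoc, ← h5, ← mul_assoc (modeOp M F 0) (modeOp M I 0), ← h5, mul_assoc (modeOp M I 0) (modeOp M F 0), ← h5, mul_assoc (modeOp M I 0) (modeOp M I 0)]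
    congr 2
    generalize modeOp M E 0 = e at *
    generalize modeOp M F 0 = f0 at *
    generalize modeOp M I 0 = i at *
    generalize modeOp M J 0 = j at *
    linear_combination (norm := noncomm_ring) -(f0 * h1) - i * h3 - h5 * j + h5

omit [IsSmooth M] in
theorem lie_sugawaraTerm_J (m n : ℤ) :
    act M (sugawaraTerm m) * modeOp M J n - modeOp M J n * act M (sugawaraTerm m) =
      modeOp M E (-m) * modeOp M F (m + n) - modeOp M E (n - m) * modeOp M F m -
      modeOp M F (-m) * modeOp M E (m + n) + modeOp M F (n - m) * modeOp M E m -
      (if m = n then (m : ℂ) else 0) • (modeOp M J m - modeOp M I m) +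
      (if m = -n then (m : ℂ) else 0) • (modeOp M J (-m) - modeOp M I (-m)) := by
  have h1 := modeOp_J_E hK n m
  have h2 := modeOp_J_E hK n (-m)
  have h3 := modeOp_J_F hK n m
  have h4 := modeOp_J_F hK n (-m)
  have h5 := modeOp_I_J hK m n
  have h6 := modeOp_I_J hK (-m) n
  have h7 := (modeOp_J_J hK m n).eq
  have h8 := (modeOp_J_J hK (-m) n).eq
  have e5 : (if m + n = 0 then (m : ℂ) else 0) = if m = -n then (m : ℂ) else 0 :=
    if_congr (by omega) rfl rfl
  have e6 : (if -m + n = 0 then ((-m : ℤ) : ℂ) else 0) = - if m = n then (m : ℂ) else 0 := by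
    rw [if_congr (show -m + n = 0 ↔ m = n by omega) rfl rfl]
    split_ifs <;> simp
  rw [e5] at h5
  rw [e6] at h6
  rw [add_comm n m] at h1 h3
  rw [← sub_eq_add_neg] at h2 h4
  rw [act_sugawaraTerm]
  generalize (if m = n then (m : ℂ) else 0) = a at *
  generalize (if m = -n then (m : ℂ) else 0) = b at *
  generalize modeOp M E m = e at *
  generalize modeOp M F m = f at *
  generalize modeOp M I m = i at *
  generalize modeOp M J m = j at *
  generalize modeOp M E (-m) = e' at *
  generalize modeOp M F (-m) = f' at *
  generalize modeOp M I (-m) = i' at *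
  generalize modeOp M J (-m) = j' at *
  generalize modeOp M J n = x at *
  rw [← h1, ← h2, ← neg_eq_iff_eq_neg.2 h3, ← neg_eq_iff_eq_neg.2 h4]
  have h5' : b • (j' - i') = j' * (i * x - x * i) - i' * (i * x - x * i) := by
    rw [h5]; simp [smul_sub]
  have h6' : -(a • (j - i)) = (i' * x - x * i') * j - (i' * x - x * i') * i := by
    rw [h6]; simp only [smul_mul_assoc, one_mul]; module
  rw [sub_eq_add_neg _ (a • (j - i)), h5', h6']
  linear_combination (norm := noncomm_ring) i' * h7 + h8 * i

omit [IsSmooth M] in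
theorem lie_sugawaraZero_J (n : ℤ) :
    act M sugawaraZero * modeOp M J n - modeOp M J n * act M sugawaraZero =
      modeOp M F n * modeOp M E 0 - modeOp M F 0 * modeOp M E n := by
  have h1 := modeOp_J_E hK n 0
  have h3 := modeOp_J_F hK n 0
  have h5 := modeOp_I_J hK 0 n
  have h7 := (modeOp_J_J hK 0 n).eq
  simp only [add_zero, Int.cast_zero, ite_self, zero_smul, sub_eq_zero] at h1 h3 h5
  rw [← h1, ← neg_eq_iff_eq_neg.2 h3, act_sugawaraZero]
  have h8 : (1 / 2 : ℂ) • modeOp M I 0 * modeOp M J n = modeOp M J n * (1 / 2 : ℂ) • modeOp M I 0 := by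
    rw [smul_mul_assoc, mul_smul_comm, h5]
  have h9 : (1 / 2 : ℂ) • (modeOp M I 0 * modeOp M I 0) * modeOp M J n =
      modeOp M J n * (1 / 2 : ℂ) • (modeOp M I 0 * modeOp M I 0) := by
    rw [smul_mul_assoc, mul_smul_comm, mul_assoc, h5, ← mul_assoc, h5, mul_assoc]
  generalize (1 / 2 : ℂ) • modeOp M I 0 = p at *
  generalize (1 / 2 : ℂ) • (modeOp M I 0 * modeOp M I 0) = q at *
  generalize modeOp M E 0 = e at *
  generalize modeOp M F 0 = f at *
  generalize modeOp M I 0 = i at *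
  generalize modeOp M J 0 = j at *
  generalize modeOp M J n = x at *
  linear_combination (norm := noncomm_ring) h5 * j + i * h7 + h8 - h9

/-- For n ≠ 0 the charged part does not cancel term by term: the commutator is a difference of
shifted tails and telescopes to finitely many terms, cancelled by the zero-mode part up to -n I_n
from reordering E and F. The Heisenberg terms give -n (J_n - I_n), whose I-part comes from the
-I_{-m} I_m summands. The total is -n J_n. -/
theorem lie_L0_J (n : ℤ) : L0 M * modeOp M J n - modeOp M J n * L0 M = (-n : ℂ) • modeOp M J n := by
  by_cases hn : n = 0
  · subst hn
    rw [Int.cast_zero, neg_zero, zero_smul, sub_eq_zero]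
    refine ((commute_L0_of_termwise (X := modeOp M J 0) (fun m => ?_) ?_).eq).symm
    · have := lie_sugawaraTerm_J hK m 0
      rw [commute_iff_eq, eq_comm, ← sub_eq_zero, this]
      by_cases hm : m = 0
      · subst hm; simp
      · simp [hm]
    · have := lie_sugawaraZero_J hK 0
      rw [commute_iff_eq, eq_comm, ← sub_eq_zero, this, sub_self]
  · set G : ℤ → Module.End ℂ M := fun m => modeOp M E (-m) * modeOp M F (m + n) with hGdef
    set G' : ℤ → Module.End ℂ M := fun m => modeOp M F (n - m) * modeOp M E m with hGdef'
    have hG : BddModes G := fun v => by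
      obtain ⟨N, hN⟩ := bddModes_modeOp F v
      exact ⟨N - n, fun m hm => by simp only [hGdef]; rw [Module.End.mul_apply, hN _ (by omega), map_zero]⟩
    have hG' : BddModes G' := fun v => by
      obtain ⟨N, hN⟩ := bddModes_modeOp E v
      exact ⟨N, fun m hm => by simp only [hGdef']; rw [Module.End.mul_apply, hN _ (by omega), map_zero]⟩
    obtain ⟨S, hS⟩ := exists_tails hG
    obtain ⟨S', hS'⟩ := exists_tails hG'
    have hGG (m : ℤ) : G m = G' (-m) + modeOp M I n := by
      have := modeOp_E_F hK (-m) (m + n)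
      rw [neg_add_cancel_left, if_neg hn, zero_smul, add_zero, sub_eq_iff_eq_add, add_comm] at this
      simp only [hGdef, hGdef', this, sub_neg_eq_add, add_comm m n]
      exact add_comm _ _
    -- Only p = n is needed, but a free integer p permits induction in both directions: each step
    -- moves one term between the tails at the cost of one I_n.
    have hΦ (p : ℤ) : S 1 - S (1 - p) + S' 1 - S' (1 + p) = G' p - G' 0 - (p : ℂ) • modeOp M I n := by
      induction p using Int.induction_on with
      | zero => simp
      | succ p ih =>
        have h1 := (hS (-p)).2
        have h2 := (hS' (1 + p)).2
        rw [hGG, neg_neg] at h1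
        rw [show -(p : ℤ) + 1 = 1 - p by ring] at h1
        rw [show (1 : ℤ) - (p + 1) = -p by ring, show (1 : ℤ) + (p + 1) = 1 + p + 1 by ring, h1]
        rw [h2, show (1 + p : ℤ) = p + 1 by ring] at ih
        rw [show (1 + p + 1 : ℤ) = p + 1 + 1 by ring]
        push_cast at ih ⊢
        rw [add_smul, one_smul]
        linear_combination (norm := module) ih
      | pred p ih =>
        have h1 := (hS (1 + p)).2
        have h2 := (hS' (-p)).2
        rw [hGG, show -(1 + p : ℤ) = -p - 1 by ring] at h1
        rw [show (1 : ℤ) - (-p - 1) = 1 + p + 1 by ring, show (1 : ℤ) + (-p - 1) = -p by ring, h2]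
        rw [show (1 : ℤ) - -p = 1 + p by ring, h1, show (1 : ℤ) + -p = -p + 1 by ring] at ih
        push_cast at ih ⊢
        rw [sub_smul, one_smul]
        linear_combination (norm := module) ih
    have h1 := ((lsum_L0 (M := M)).mul_right (modeOp M J n)).sub ((lsum_L0 (M := M)).mul_left (modeOp M J n))
    -- These Kronecker terms survive only at k + 1 = |n|.
    let R : ℕ → Module.End ℂ M := fun k => -(if (k : ℤ) + 1 = n then ((k + 1 : ℤ) : ℂ) else 0) •
        (modeOp M J (k + 1) - modeOp M I (k + 1)) +
      (if (k : ℤ) + 1 = -n then ((k + 1 : ℤ) : ℂ) else 0) • (modeOp M J (-(k + 1)) - modeOp M I (-(k + 1)))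
    have hR : LSum R ((-n : ℂ) • (modeOp M J n - modeOp M I n)) := by
      have := LSum.single (T := R) (n.natAbs - 1) (fun k hk => by
        simp only [R]
        rw [if_neg (by omega), if_neg (by omega), neg_zero, zero_smul, zero_smul, add_zero])
      convert this using 1
      rcases lt_or_gt_of_ne hn with h | h
      · obtain ⟨k, rfl⟩ : ∃ k : ℕ, n = -(k + 1) := ⟨n.natAbs - 1, by omega⟩
        have e : (-((k : ℤ) + 1)).natAbs - 1 = k := by omega
        rw [e]
        simp only [R]
        rw [if_neg (by omega), if_pos (by omega)]
        push_cast
        simp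
      · obtain ⟨k, rfl⟩ : ∃ k : ℕ, n = k + 1 := ⟨n.natAbs - 1, by omega⟩
        have e : ((k : ℤ) + 1).natAbs - 1 = k := by omega
        rw [e]
        simp only [R]
        rw [if_neg (show ¬ (k : ℤ) + 1 = -(k + 1) by omega)]
        simp
    -- The four tails start at 1, 1 - n, 1 and 1 + n so that their k-th terms are the four charged
    -- products in the k-th commutator.
    have h2 := ((((hS 1).1.sub (hS (1 - n)).1).add (hS' 1).1).sub (hS' (1 + n)).1).add hR
    have h3 := h1.unique (h2.congr fun k => by
      rw [lie_sugawaraTerm_J hK]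
      simp only [hGdef, hGdef', R]
      rw [show (1 : ℤ) + k = k + 1 by ring, show -((1 : ℤ) - n + k) = n - (k + 1) by ring,
        show (1 : ℤ) - n + k + n = k + 1 by ring, show n - (1 + n + (k : ℤ)) = -(k + 1) by ring,
        show (1 : ℤ) + n + k = k + 1 + n by ring]
      module)
    rw [hΦ] at h3
    have h4 := lie_sugawaraZero_J hK n
    simp only [hGdef', sub_self, sub_zero] at h3
    have h5 : L0 M * modeOp M J n - modeOp M J n * L0 M =
      ((L0 M - act M sugawaraZero) * modeOp M J n - modeOp M J n * (L0 M - act M sugawaraZero)) +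
      (act M sugawaraZero * modeOp M J n - modeOp M J n * act M sugawaraZero) := by noncomm_ring
    rw [h5, h3, h4]
    module

theorem lie_L0_E (n : ℤ) : L0 M * modeOp M E n - modeOp M E n * L0 M = (-n : ℂ) • modeOp M E n := by
  have h0 : L0 M * modeOp M E 0 - modeOp M E 0 * L0 M = (0 : ℂ) • modeOp M E 0 := by
    rw [zero_smul, sub_eq_zero, (commute_E_L0 hK).eq]
  have := lie_degree (lie_L0_J hK n) h0
  rwa [modeOp_J_E hK, add_zero, add_zero] at this

theorem lie_L0_F (n : ℤ) : L0 M * modeOp M F n - modeOp M F n * L0 M = (-n : ℂ) • modeOp M F n := by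
  have h0 : L0 M * modeOp M F 0 - modeOp M F 0 * L0 M = (0 : ℂ) • modeOp M F 0 := by
    rw [zero_smul, sub_eq_zero, (commute_F_L0 hK).eq]
  have := lie_degree (lie_L0_J hK n) h0
  rw [modeOp_J_F hK, add_zero, add_zero] at this
  simpa [sub_eq_add_neg, add_comm] using congrArg Neg.neg this

theorem lie_L0_I (n : ℤ) : L0 M * modeOp M I n - modeOp M I n * L0 M = (-n : ℂ) • modeOp M I n := by
  have h0 : L0 M * modeOp M F 0 - modeOp M F 0 * L0 M = (0 : ℂ) • modeOp M F 0 := by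
    rw [zero_smul, sub_eq_zero, (commute_F_L0 hK).eq]
  have := lie_degree (lie_L0_E hK n) h0
  rw [modeOp_E_F hK, add_zero, add_zero] at this
  have hz : (if n = 0 then (n : ℂ) else 0) = 0 := by split_ifs with h <;> simp [h]
  rwa [hz, zero_smul, add_zero] at this

end SugawaraLie

/-! ### Representations from operators -/

section Generators

theorem H4.eq_sum (x : H4) : x = x 0 • H4.E + x 1 • H4.F + x 2 • H4.I + x 3 • H4.J := by
  apply H4.ext4 <;> simp <;> simp [H4.E, H4.F, H4.I, H4.J]

variable {M : Type*} [AddCommGroup M] [Module ℂ M]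

/-- The action of the finite Lie algebra given by the action of its basis. -/
def h4Op (E F I J : Module.End ℂ M) : H4 →ₗ[ℂ] Module.End ℂ M where
  toFun x := x 0 • E + x 1 • F + x 2 • I + x 3 • J
  map_add' x y := by simp only [H4.add_apply]; module
  map_smul' c x := by simp only [H4.smul_apply, RingHom.id_apply]; module

theorem h4Op_apply (E F I J : Module.End ℂ M) (x : H4) :
    h4Op E F I J x = x 0 • E + x 1 • F + x 2 • I + x 3 • J := rfl

theorem h4Op_E (E F I J : Module.End ℂ M) : h4Op E F I J H4.E = E := by
  rw [h4Op_apply]; simp [H4.E]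

theorem h4Op_F (E F I J : Module.End ℂ M) : h4Op E F I J H4.F = F := by
  rw [h4Op_apply]; simp [H4.F]

theorem h4Op_I (E F I J : Module.End ℂ M) : h4Op E F I J H4.I = I := by
  rw [h4Op_apply]; simp [H4.I]

theorem h4Op_J (E F I J : Module.End ℂ M) : h4Op E F I J H4.J = J := by
  rw [h4Op_apply]; simp [H4.J]

/-- The representation of the finite Lie algebra given by four operators. -/
def h4Rep (E F I J : Module.End ℂ M) (hEF : E * F - F * E = I) (hJE : J * E - E * J = E)
    (hJF : J * F - F * J = -F) (hIE : Commute I E) (hIF : Commute I F) (hIJ : Commute I J) :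
    H4 →ₗ⁅ℂ⁆ Module.End ℂ M where
  toLinearMap := h4Op E F I J
  map_lie' {x y} := by
    change h4Op E F I J ⁅x, y⁆ = ⁅h4Op E F I J x, h4Op E F I J y⁆
    rw [LieRing.of_associative_ring_bracket, h4Op_apply, h4Op_apply, h4Op_apply]
    simp only [H4.lie_apply_zero, H4.lie_apply_one, H4.lie_apply_two, H4.lie_apply_three, mul_add,
      add_mul, smul_mul_assoc, mul_smul_comm]
    rw [hIE.eq, hIF.eq, hIJ.eq, sub_eq_iff_eq_add.1 hEF, sub_eq_iff_eq_add.1 hJE,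
      sub_eq_iff_eq_add.1 hJF]
    module

variable {E F I J : ℤ → Module.End ℂ M} {i : ℂ} {c d : ℤ → ℂ}

/-- The term I_0 of [E_m, F_{-m}] is hidden in the constant i of `Sys`, which is why c_0 = 0 and I_0
= i must both be assumed. -/
theorem Sys.h4Op_mul_sub (h : Sys i c d E F I J) (hc : ∀ n, c n = if n = 0 then 0 else 1)
    (hd : ∀ n, d n = 1) (hI : I 0 = i • 1) (m n : ℤ) (x y : H4) :
    h4Op (E m) (F m) (I m) (J m) x * h4Op (E n) (F n) (I n) (J n) y -
      h4Op (E n) (F n) (I n) (J n) y * h4Op (E m) (F m) (I m) (J m) x =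
    h4Op (E (m + n)) (F (m + n)) (I (m + n)) (J (m + n)) ⁅x, y⁆ +
      (if m + n = 0 then (m : ℂ) * H4.form x y else 0) • 1 := by
  have hEF (m n : ℤ) : E m * F n = F n * E m + I (m + n) + (if m + n = 0 then (m : ℂ) else 0) • 1 := by
    have h1 := h.EF m n
    rw [sub_eq_iff_eq_add] at h1
    rw [h1, hc]
    by_cases hmn : m + n = 0
    · rw [if_pos hmn, if_pos hmn, if_pos hmn, hmn, hI]; module
    · rw [if_neg hmn, if_neg hmn, if_neg hmn]; module
  have hJE (m n : ℤ) : J m * E n = E n * J m + E (m + n) := by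
    have h1 := h.JE m n
    rw [hd, one_smul, sub_eq_iff_eq_add] at h1
    rw [h1, add_comm]
  have hJF (m n : ℤ) : J m * F n = F n * J m - F (m + n) := by
    have h1 := h.JF m n
    rw [hd, neg_smul, one_smul, sub_eq_iff_eq_add] at h1
    rw [h1]; abel
  have hIJ (m n : ℤ) : I m * J n = J n * I m + (if m + n = 0 then (m : ℂ) else 0) • 1 := by
    have h1 := h.IJ m n
    rw [sub_eq_iff_eq_add] at h1
    rw [h1, add_comm]
  have hn : (if n + m = 0 then (n : ℂ) else 0) = - (if m + n = 0 then (m : ℂ) else 0) := by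
    by_cases hmn : m + n = 0
    · rw [if_pos hmn, if_pos (by omega), show n = -m by omega]; simp
    · rw [if_neg hmn, if_neg (by omega), neg_zero]
  have hf : (if m + n = 0 then (m : ℂ) * H4.form x y else 0) =
      (if m + n = 0 then (m : ℂ) else 0) * H4.form x y := by split_ifs <;> simp
  rw [h4Op_apply, h4Op_apply, h4Op_apply, hf, H4.form_apply]
  simp only [H4.lie_apply_zero, H4.lie_apply_one, H4.lie_apply_two, H4.lie_apply_three, mul_add,
      add_mul, smul_mul_assoc, mul_smul_comm]
  rw [(h.EE m n).eq, (h.FF m n).eq, (h.II m n).eq, (h.JJ m n).eq, (h.EI m n).eq, (h.EI n m).eq,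
    (h.FI m n).eq, (h.FI n m).eq, hEF, hEF, hJE, hJE, hJF, hJF, hIJ, hIJ, hn, add_comm n m]
  module

/-- The linear action of the affine Lie algebra given by the action of its modes. -/
def affOp (X : ℤ → H4 →ₗ[ℂ] Module.End ℂ M) : AffH4 →ₗ[ℂ] Module.End ℂ M where
  toFun y := Finsupp.lsum ℂ X (LoopAlgebra.toFinsupp ℂ ℤ H4 ((ofProd cocycle).symm y).1) -
    (TrivialLieModule.equiv ℂ (loopAlgebra ℂ ℤ H4) ℂ ((ofProd cocycle).symm y).2) • 1
  map_add' y z := by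
    simp only [of_symm_add, Prod.fst_add, Prod.snd_add, map_add, add_smul]
    abel
  map_smul' r y := by
    simp only [of_symm_smul, Prod.smul_fst, Prod.smul_snd, map_smul,
      RingHom.id_apply, smul_sub, smul_eq_mul, mul_smul]

theorem affOp_mode (X : ℤ → H4 →ₗ[ℂ] Module.End ℂ M) (n : ℤ) (x : H4) :
    affOp X (mode n x) = X n x := by
  change Finsupp.lsum ℂ X (LoopAlgebra.toFinsupp ℂ ℤ H4 (AddMonoidAlgebra.single n 1 ⊗ₜ[ℂ] x)) -
    (TrivialLieModule.equiv ℂ (loopAlgebra ℂ ℤ H4) ℂ 0) • 1 = X n x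
  rw [LoopAlgebra.toFinsupp_single_tmul, map_zero, zero_smul, sub_zero]
  simp

theorem affOp_K (X : ℤ → H4 →ₗ[ℂ] Module.End ℂ M) : affOp X K = 1 := by
  change Finsupp.lsum ℂ X (LoopAlgebra.toFinsupp ℂ ℤ H4 0) -
    (TrivialLieModule.equiv ℂ (loopAlgebra ℂ ℤ H4) ℂ
      (-(TrivialLieModule.equiv ℂ (loopAlgebra ℂ ℤ H4) ℂ).symm 1)) • 1 = 1
  simp

/-- The representation of the affine Lie algebra given by the action of its modes. -/
def affRep (X : ℤ → H4 →ₗ[ℂ] Module.End ℂ M) (hX : ∀ (m n : ℤ) (x y : H4),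
    X m x * X n y - X n y * X m x =
      X (m + n) ⁅x, y⁆ + (if m + n = 0 then (m : ℂ) * H4.form x y else 0) • 1) :
    AffH4 →ₗ⁅ℂ⁆ Module.End ℂ M where
  toLinearMap := affOp X
  map_lie' {y z} := by
    change affOp X ⁅y, z⁆ = ⁅affOp X y, affOp X z⁆
    have hKr (y : AffH4) : affOp X ⁅y, K⁆ = ⁅affOp X y, affOp X K⁆ := by
      rw [lie_K, map_zero, affOp_K, LieRing.of_associative_ring_bracket]; simp
    induction y using aff_induction with
    | K =>
      rw [← lie_skew, map_neg, hKr, lie_skew]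
    | add y z' hy hz => rw [add_lie, map_add, map_add, add_lie, hy, hz]
    | smul c y hy => rw [smul_lie, map_smul, map_smul, smul_lie, hy]
    | mode m x =>
      induction z using aff_induction with
      | K => exact hKr _
      | add y z' hy hz => rw [lie_add, map_add, map_add, lie_add, hy, hz]
      | smul c y hy => rw [lie_smul, map_smul, map_smul, lie_smul, hy]
      | mode n y =>
        rw [lie_mode_mode, map_add, map_smul, affOp_mode, affOp_mode, affOp_mode, affOp_K,
          LieRing.of_associative_ring_bracket, hX]

theorem affRep_mode (X : ℤ → H4 →ₗ[ℂ] Module.End ℂ M) (hX) (n : ℤ) (x : H4) :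
    affRep X hX (mode n x) = X n x := affOp_mode X n x

theorem affRep_K (X : ℤ → H4 →ₗ[ℂ] Module.End ℂ M) (hX) : affRep X hX K = 1 := affOp_K X

theorem uH4_mem (T : Subalgebra ℂ UH4) (hT : ∀ y : H4, u y ∈ T) (a : UH4) : a ∈ T := by
  let g : H4 →ₗ⁅ℂ⁆ T :=
    { toFun y := ⟨u y, hT y⟩
      map_add' y z := by ext; simp
      map_smul' c y := by ext; simp
      map_lie' {y z} := by
        ext
        simp [LieRing.of_associative_ring_bracket] }
  have h : T.val.comp (UniversalEnvelopingAlgebra.lift ℂ g) = AlgHom.id ℂ UH4 := by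
    apply UniversalEnvelopingAlgebra.hom_ext
    ext y
    simp only [LieHom.comp_apply, AlgHom.coe_toLieHom, AlgHom.comp_apply,
      UniversalEnvelopingAlgebra.lift_ι_apply]
    rfl
  have ha := DFunLike.congr_fun h a
  rw [AlgHom.id_apply] at ha
  rw [← ha]
  exact (UniversalEnvelopingAlgebra.lift ℂ g a).2

/-- The subalgebra of elements whose image under a representation preserves a subspace. -/
def stabilizer {A : Type*} [Semiring A] [Algebra ℂ A] (ρ : A →ₐ[ℂ] Module.End ℂ M)
    (N : Submodule ℂ M) : Subalgebra ℂ A where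
  carrier := {a | ∀ v ∈ N, ρ a v ∈ N}
  mul_mem' {a b} ha hb v hv := by rw [map_mul]; exact ha _ (hb _ hv)
  add_mem' {a b} ha hb v hv := by rw [map_add]; exact N.add_mem (ha _ hv) (hb _ hv)
  algebraMap_mem' c v hv := by rw [AlgHom.commutes]; exact N.smul_mem c hv

theorem uH4_stable (ρ : UH4 →ₐ[ℂ] Module.End ℂ M) (N : Submodule ℂ M)
    (hE : ∀ v ∈ N, ρ (u H4.E) v ∈ N) (hF : ∀ v ∈ N, ρ (u H4.F) v ∈ N)
    (hI : ∀ v ∈ N, ρ (u H4.I) v ∈ N) (hJ : ∀ v ∈ N, ρ (u H4.J) v ∈ N) (a : UH4) :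
    ∀ v ∈ N, ρ a v ∈ N := by
  refine uH4_mem (stabilizer ρ N) (fun y v hv => ?_) a
  rw [H4.eq_sum y]
  simp only [u, map_add, map_smul, LinearMap.add_apply, LinearMap.smul_apply]
  exact N.add_mem (N.add_mem (N.add_mem (N.smul_mem _ (hE v hv)) (N.smul_mem _ (hF v hv)))
    (N.smul_mem _ (hI v hv))) (N.smul_mem _ (hJ v hv))

theorem uAff_stable (ρ : UAff →ₐ[ℂ] Module.End ℂ M) (N : Submodule ℂ M)
    (hE : ∀ n, ∀ v ∈ N, ρ (uMode n H4.E) v ∈ N) (hF : ∀ n, ∀ v ∈ N, ρ (uMode n H4.F) v ∈ N)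
    (hI : ∀ n, ∀ v ∈ N, ρ (uMode n H4.I) v ∈ N) (hJ : ∀ n, ∀ v ∈ N, ρ (uMode n H4.J) v ∈ N)
    (hK : ∀ v ∈ N, ρ (UniversalEnvelopingAlgebra.ι ℂ K) v ∈ N) (a : UAff) :
    ∀ v ∈ N, ρ a v ∈ N := by
  refine uAff_mem (stabilizer ρ N) (fun y => ?_) a
  induction y using aff_induction with
  | mode n x =>
    intro v hv
    rw [H4.eq_sum x]
    simp only [map_add, map_smul, LinearMap.add_apply, LinearMap.smul_apply]
    exact N.add_mem (N.add_mem (N.add_mem (N.smul_mem _ (hE n v hv)) (N.smul_mem _ (hF n v hv)))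
      (N.smul_mem _ (hI n v hv))) (N.smul_mem _ (hJ n v hv))
  | K => exact hK
  | add y z hy hz => rw [map_add]; exact add_mem hy hz
  | smul c y hy => rw [map_smul]; exact Subalgebra.smul_mem _ hy c

end Generators

/-! ### The Fock module -/

section Fock

open MvPolynomial

/-- The duality of the four families of oscillators. -/
def dual : Fin 4 → Fin 4 := ![1, 0, 3, 2]

/-- The charges of the four families of oscillators. -/
def charge : Fin 4 → ℂ := ![1, -1, 0, 0]

/-- The commutator of dual oscillators. -/
def kappa (i : ℂ) (τ : Fin 4) (n : ℤ) : ℂ := n + i * charge τ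

theorem dual_dual (τ : Fin 4) : dual (dual τ) = τ := by fin_cases τ <;> rfl

theorem charge_dual (τ : Fin 4) : charge (dual τ) = - charge τ := by
  fin_cases τ <;> simp [charge, dual]

theorem kappa_dual (i : ℂ) (τ : Fin 4) (n : ℤ) : kappa i (dual τ) n = - kappa i τ (-n) := by
  simp [kappa, charge_dual, add_comm]

/-- The index set of the creation operators. -/
abbrev Osc : Type := Fin 4 × ℕ

/-- The Fock space with multiplicity space `W`. -/
def FockSpace (W : Type*) [AddCommGroup W] [Module ℂ W] : Type _ := MvPolynomial Osc ℂ ⊗[ℂ] W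

namespace FockSpace

variable {W : Type*} [AddCommGroup W] [Module ℂ W]

instance : AddCommGroup (FockSpace W) := inferInstanceAs (AddCommGroup (MvPolynomial Osc ℂ ⊗[ℂ] W))
instance : Module ℂ (FockSpace W) := inferInstanceAs (Module ℂ (MvPolynomial Osc ℂ ⊗[ℂ] W))

/-- Pure tensors. -/
def tm : MvPolynomial Osc ℂ →ₗ[ℂ] W →ₗ[ℂ] FockSpace W :=
  TensorProduct.mk ℂ (MvPolynomial Osc ℂ) W

/-- The tensor product of two operators. -/
def map (g : Module.End ℂ (MvPolynomial Osc ℂ)) (h : Module.End ℂ W) : Module.End ℂ (FockSpace W) :=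
  TensorProduct.map g h

/-- The linear map given by a bilinear one. -/
def lift {M : Type*} [AddCommGroup M] [Module ℂ M] (g : MvPolynomial Osc ℂ →ₗ[ℂ] W →ₗ[ℂ] M) :
    FockSpace W →ₗ[ℂ] M := TensorProduct.lift g

theorem lift_tm {M : Type*} [AddCommGroup M] [Module ℂ M]
    (g : MvPolynomial Osc ℂ →ₗ[ℂ] W →ₗ[ℂ] M) (p w) : lift g (tm p w) = g p w :=
  TensorProduct.lift.tmul _ _

theorem hom_ext {M : Type*} [AddCommGroup M] [Module ℂ M] {g h : FockSpace W →ₗ[ℂ] M}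
    (H : ∀ p w, g (tm p w) = h (tm p w)) : g = h := TensorProduct.ext' H

theorem induction_on {q : FockSpace W → Prop} (v : FockSpace W) (htm : ∀ p w, q (tm p w))
    (hadd : ∀ v w, q v → q w → q (v + w)) : q v := by
  refine TensorProduct.induction_on (motive := q) v ?_ htm hadd
  have h := htm 0 0
  rw [map_zero] at h
  exact h

end FockSpace

open FockSpace

variable (W : Type*) [AddCommGroup W] [Module ℂ W]

/-- A creation operator. -/
def create (s : Osc) : Module.End ℂ (FockSpace W) := FockSpace.map (LinearMap.mulLeft ℂ (X s)) 1

/-- An annihilation operator. -/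
def annihilate (s : Osc) : Module.End ℂ (FockSpace W) := FockSpace.map (pderiv (R := ℂ) s).toLinearMap 1

variable {W}

/-- An operator on the multiplicity space. -/
def onMult (a : Module.End ℂ W) : Module.End ℂ (FockSpace W) := FockSpace.map 1 a

theorem onMult_tm (a : Module.End ℂ W) (p : MvPolynomial Osc ℂ) (w : W) :
    onMult a (tm p w) = tm p (a w) := rfl

theorem create_tm (s : Osc) (p : MvPolynomial Osc ℂ) (w : W) :
    create W s (tm p w) = tm (X s * p) w := rfl

theorem annihilate_tm (s : Osc) (p : MvPolynomial Osc ℂ) (w : W) :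
    annihilate W s (tm p w) = tm (pderiv s p) w := rfl

theorem create_comm (s t : Osc) : Commute (create W s) (create W t) := by
  rw [commute_iff_eq]
  refine FockSpace.hom_ext fun p w => ?_
  simp only [Module.End.mul_apply, create_tm, mul_left_comm]

theorem pderiv_comm (s t : Osc) (p : MvPolynomial Osc ℂ) :
    pderiv s (pderiv t p) = pderiv t (pderiv s p) := by
  induction p using MvPolynomial.induction_on with
  | C a => simp
  | add p q hp hq => simp [hp, hq]
  | mul_X p r hp =>
    simp only [Derivation.leibniz, smul_eq_mul, map_add, pderiv_X, hp]
    have hc (a b : Osc) : (pderiv a) ((Pi.single b 1 : Osc → MvPolynomial Osc ℂ) r) = 0 := by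
      by_cases h : r = b
      · subst h; simp
      · simp [h]
    rw [hc, hc]
    ring

theorem annihilate_comm (s t : Osc) : Commute (annihilate W s) (annihilate W t) := by
  rw [commute_iff_eq]
  refine FockSpace.hom_ext fun p w => ?_
  simp only [Module.End.mul_apply, annihilate_tm, pderiv_comm s t]

theorem annihilate_create (s t : Osc) :
    annihilate W s * create W t - create W t * annihilate W s = (if s = t then (1 : ℂ) else 0) • 1 := by
  refine FockSpace.hom_ext fun p w => ?_
  simp only [LinearMap.sub_apply, Module.End.mul_apply, create_tm, annihilate_tm,
    Derivation.leibniz, smul_eq_mul, pderiv_X, map_add, LinearMap.add_apply, LinearMap.smul_apply,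
    Module.End.one_apply]
  by_cases h : s = t
  · subst h; simp
  · simp [h]

/-- The modes of the four families of oscillators. -/
def osc (W : Type*) [AddCommGroup W] [Module ℂ W] (i : ℂ) (τ : Fin 4) (n : ℤ) :
    Module.End ℂ (FockSpace W) :=
  if n < 0 then create W (τ, (-n - 1).toNat)
  else if 0 < n then kappa i τ n • annihilate W (dual τ, (n - 1).toNat) else 0

theorem osc_neg (i : ℂ) (τ : Fin 4) (k : ℕ) : osc W i τ (-(k + 1)) = create W (τ, k) := by
  rw [osc, if_pos (by omega), show (-(-((k : ℤ) + 1)) - 1).toNat = k by omega]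

theorem osc_pos (i : ℂ) (τ : Fin 4) (k : ℕ) :
    osc W i τ (k + 1) = kappa i τ (k + 1) • annihilate W (dual τ, k) := by
  rw [osc, if_neg (by omega), if_pos (by omega), show ((k : ℤ) + 1 - 1).toNat = k by omega]

theorem osc_zero (i : ℂ) (τ : Fin 4) : osc W i τ 0 = 0 := by simp [osc]

theorem int_cases {p : ℤ → Prop} (h0 : p 0) (hpos : ∀ k : ℕ, p (k + 1)) (hneg : ∀ k : ℕ, p (-(k + 1)))
    (n : ℤ) : p n := by
  rcases lt_trichotomy n 0 with h | rfl | h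
  · obtain ⟨k, rfl⟩ : ∃ k : ℕ, n = -(k + 1) := ⟨(-n - 1).toNat, by omega⟩
    exact hneg k
  · exact h0
  · obtain ⟨k, rfl⟩ : ∃ k : ℕ, n = k + 1 := ⟨(n - 1).toNat, by omega⟩
    exact hpos k

theorem osc_mul_sub (i : ℂ) (τ τ' : Fin 4) (m n : ℤ) :
    osc W i τ m * osc W i τ' n - osc W i τ' n * osc W i τ m =
      (if τ' = dual τ ∧ m + n = 0 ∧ m ≠ 0 then kappa i τ m else 0) • 1 := by
  induction m using int_cases with
  | h0 => simp [osc_zero]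
  | hpos k =>
    induction n using int_cases with
    | h0 =>
      rw [osc_zero, mul_zero, zero_mul, sub_zero, if_neg (fun h => by omega), zero_smul]
    | hpos l =>
      rw [osc_pos, osc_pos, smul_mul_smul_comm, smul_mul_smul_comm, (annihilate_comm _ _).eq,
        mul_comm (kappa _ _ _), sub_self, if_neg (by omega), zero_smul]
    | hneg l =>
      rw [osc_pos, osc_neg, smul_mul_assoc, mul_smul_comm, ← smul_sub, annihilate_create, smul_smul]
      congr 1
      by_cases h : τ' = dual τ ∧ k = l
      · rw [if_pos (by rw [h.1, h.2]), if_pos ⟨h.1, by omega, by omega⟩, mul_one]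
      · rw [if_neg, if_neg, mul_zero]
        · rintro ⟨h1, h2, -⟩
          exact h ⟨h1, by omega⟩
        · rintro h1
          rw [Prod.mk.injEq] at h1
          exact h ⟨h1.1.symm, h1.2⟩
  | hneg k =>
    induction n using int_cases with
    | h0 =>
      rw [osc_zero, mul_zero, zero_mul, sub_zero, if_neg (fun h => by omega), zero_smul]
    | hneg l =>
      rw [osc_neg, osc_neg, (create_comm _ _).eq, sub_self, if_neg (by omega), zero_smul]
    | hpos l =>
      rw [osc_pos, osc_neg, smul_mul_assoc, mul_smul_comm, ← smul_sub, ← neg_sub (annihilate W _ * _),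
        annihilate_create, ← neg_smul, smul_smul]
      congr 1
      by_cases h : τ' = dual τ ∧ k = l
      · obtain ⟨rfl, rfl⟩ := h
        rw [if_pos (by rw [dual_dual]), if_pos ⟨rfl, by omega, by omega⟩, kappa_dual]
        simp
      · rw [if_neg, if_neg, neg_zero, mul_zero]
        · rintro ⟨h1, h2, -⟩
          exact h ⟨h1, by omega⟩
        · rintro h1
          rw [Prod.mk.injEq] at h1
          exact h ⟨by rw [← h1.1, dual_dual], h1.2.symm⟩

variable (W) in
/-- The operator measuring the charge of the oscillators. -/
def oscCharge : Module.End ℂ (FockSpace W) :=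
  FockSpace.map (mkDerivation ℂ (fun s : Osc => charge s.1 • (X s : MvPolynomial Osc ℂ))).toLinearMap 1

theorem oscCharge_tm (p : MvPolynomial Osc ℂ) (w : W) : oscCharge W (tm p w) =
    tm (mkDerivation ℂ (fun s : Osc => charge s.1 • (X s : MvPolynomial Osc ℂ)) p) w := rfl

theorem lie_oscCharge_create (s : Osc) :
    oscCharge W * create W s - create W s * oscCharge W = charge s.1 • create W s := by
  refine FockSpace.hom_ext fun p w => ?_
  simp only [LinearMap.sub_apply, Module.End.mul_apply, create_tm, oscCharge_tm,
    Derivation.leibniz, mkDerivation_X, smul_eq_mul, LinearMap.smul_apply, map_add,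
    LinearMap.add_apply, map_smul, mul_comm p, smul_mul_assoc]
  abel

theorem lie_oscCharge_annihilate (s : Osc) :
    oscCharge W * annihilate W s - annihilate W s * oscCharge W = -charge s.1 • annihilate W s := by
  refine FockSpace.hom_ext fun p w => ?_
  simp only [LinearMap.sub_apply, Module.End.mul_apply, annihilate_tm, oscCharge_tm,
    LinearMap.smul_apply]
  rw [← LinearMap.sub_apply, ← map_sub, ← LinearMap.smul_apply, ← map_smul]
  congr 2
  induction p using MvPolynomial.induction_on with
  | C a => simp
  | add p q hp hq => simp only [map_add, smul_add, ← hp, ← hq]; abel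
  | mul_X p r hp =>
    rw [sub_eq_iff_eq_add] at hp
    simp only [Derivation.leibniz, smul_eq_mul, map_add, mkDerivation_X, Derivation.map_smul,
      pderiv_X, hp, mul_smul_comm, smul_add, mul_add]
    by_cases h : r = s
    · subst h
      simp only [Pi.single_eq_same, Derivation.map_one_eq_zero, mul_zero, mul_one,
        MvPolynomial.smul_eq_C_mul, map_neg]
      ring
    · simp only [Pi.single_eq_of_ne h, map_zero, mul_zero, smul_zero,
        MvPolynomial.smul_eq_C_mul, map_neg]
      ring

theorem lie_oscCharge (i : ℂ) (τ : Fin 4) (n : ℤ) :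
    oscCharge W * osc W i τ n - osc W i τ n * oscCharge W = charge τ • osc W i τ n := by
  induction n using int_cases with
  | h0 => simp [osc_zero]
  | hpos k =>
    rw [osc_pos, mul_smul_comm, smul_mul_assoc, ← smul_sub, lie_oscCharge_annihilate, charge_dual,
      neg_neg, smul_comm]
  | hneg k => rw [osc_neg, lie_oscCharge_create]

theorem commute_osc_onMult (i : ℂ) (τ : Fin 4) (n : ℤ) (f : Module.End ℂ W) :
    Commute (osc W i τ n) (onMult f) := by
  have h (g : Module.End ℂ (MvPolynomial Osc ℂ)) :
      Commute (FockSpace.map g (1 : Module.End ℂ W)) (onMult f) := by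
    rw [commute_iff_eq]
    exact FockSpace.hom_ext fun p w => rfl
  rw [osc]
  split_ifs
  · exact h _
  · exact (h _).smul_left _
  · exact Commute.zero_left _

theorem commute_oscCharge_onMult (f : Module.End ℂ W) :
    Commute (oscCharge W) (onMult f) := by
  rw [commute_iff_eq]
  exact FockSpace.hom_ext fun p w => rfl

theorem bddModes_osc (i : ℂ) (τ : Fin 4) : BddModes (osc W i τ) := fun v => by
  induction v using FockSpace.induction_on with
  | hadd v w hv hw =>
    obtain ⟨N, hN⟩ := hv
    obtain ⟨N', hN'⟩ := hw
    exact ⟨max N N', fun n hn => by rw [map_add, hN n (by omega), hN' n (by omega), add_zero]⟩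
  | htm p w =>
    classical
    refine ⟨(p.vars.sup Prod.snd : ℕ) + 2, fun n hn => ?_⟩
    obtain ⟨k, rfl⟩ : ∃ k : ℕ, n = k + 1 := ⟨(n - 1).toNat, by omega⟩
    rw [osc_pos, LinearMap.smul_apply, annihilate_tm, pderiv_eq_zero_of_notMem_vars,
      map_zero, LinearMap.zero_apply, smul_zero]
    intro hm
    have := Finset.le_sup (f := Prod.snd) hm
    simp only at this
    omega

/-- A vector space with the action of the zero modes. -/
structure ZeroModes (i : ℂ) (e f j : Module.End ℂ W) : Prop where
  ef : e * f - f * e = i • 1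
  je : j * e - e * j = e
  jf : j * f - f * j = -f

variable (i : ℂ) (e f j : Module.End ℂ W)

/-- The modes of the first charged field on the Fock module. -/
def fockE (n : ℤ) : Module.End ℂ (FockSpace W) :=
  osc W i 0 n + if n = 0 then onMult e else 0

/-- The modes of the second charged field on the Fock module. -/
def fockF (n : ℤ) : Module.End ℂ (FockSpace W) :=
  osc W i 1 n + if n = 0 then onMult f else 0

variable (W) in
/-- The modes of the first neutral field on the Fock module. -/
def fockI (n : ℤ) : Module.End ℂ (FockSpace W) :=
  osc W i 2 n + if n = 0 then i • 1 else 0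

/-- The modes of the second neutral field on the Fock module. -/
def fockJ (n : ℤ) : Module.End ℂ (FockSpace W) :=
  osc W i 3 n + if n = 0 then onMult j + oscCharge W else 0

variable {i e f j}

theorem commute_of_parts {A B A' B' : Module.End ℂ (FockSpace W)} (h1 : Commute A A')
    (h2 : Commute A B') (h3 : Commute B A') (h4 : Commute B B') : Commute (A + B) (A' + B') :=
  (h1.add_right h2).add_left (h3.add_right h4)

theorem lie_onMult (a b : Module.End ℂ W) :
    onMult a * onMult b - onMult b * onMult a =
      onMult (a * b - b * a) := by
  refine FockSpace.hom_ext fun p w => ?_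
  simp only [LinearMap.sub_apply, Module.End.mul_apply, onMult_tm, map_sub]

theorem onMult_neg (a : Module.End ℂ W) : onMult (-a) = - onMult a :=
  FockSpace.hom_ext fun p w => by simp [onMult_tm]

theorem commute_osc (i : ℂ) {τ τ' : Fin 4} (h : τ' ≠ dual τ) (m n : ℤ) :
    Commute (osc W i τ m) (osc W i τ' n) := by
  rw [commute_iff_eq, ← sub_eq_zero, osc_mul_sub, if_neg (fun h' => h h'.1), zero_smul]

theorem commute_ite {A B : Module.End ℂ (FockSpace W)} (h : Commute A B) (p : Prop) [Decidable p] :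
    Commute A (if p then B else 0) := by
  split_ifs
  · exact h
  · exact Commute.zero_right _

/-- Zero modes act on `W` and the other modes on polynomials, so mixed commutators vanish, except
that J_0 also measures the charge of the oscillators. The summand i of [E_m, F_{-m}] comes from
`kappa` when m ≠ 0 and from `W` when m = 0. -/
theorem fock_sys (h : ZeroModes i e f j) : Sys i (fun _ => 0) (fun n => if n = 0 then 1 else 0)
    (fockE i e) (fockF i f) (fockI W i) (fockJ i j) := by
  have hs (A : Module.End ℂ (FockSpace W)) : Commute A (i • 1) := (Commute.one_right A).smul_right i
  refine
    { EE := fun m n => ?_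
      FF := fun m n => ?_
      II := fun m n => ?_
      JJ := fun m n => ?_
      EI := fun m n => ?_
      FI := fun m n => ?_
      EF := fun m n => ?_
      JE := fun m n => ?_
      JF := fun m n => ?_
      IJ := fun m n => ?_
      bddE := fun v => ?_
      bddF := fun v => ?_ }
  · refine commute_of_parts (commute_osc i (by decide) m n)
      (commute_ite (commute_osc_onMult _ _ _ _) _) (commute_ite (commute_osc_onMult _ _ _ _) _).symm ?_
    exact commute_ite (commute_ite (Commute.refl _) _).symm _
  · refine commute_of_parts (commute_osc i (by decide) m n)
      (commute_ite (commute_osc_onMult _ _ _ _) _) (commute_ite (commute_osc_onMult _ _ _ _) _).symm ?_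
    exact commute_ite (commute_ite (Commute.refl _) _).symm _
  · exact commute_of_parts (commute_osc i (by decide) m n) (commute_ite (hs _) _)
      (commute_ite (hs _) _).symm (commute_ite (hs _) _)
  · by_cases hm : m = 0
    · subst hm
      by_cases hn : n = 0
      · subst hn; exact Commute.refl _
      · simp only [fockJ, osc_zero, zero_add, if_true, if_neg hn, add_zero]
        refine ((commute_osc_onMult _ _ _ _).symm.add_left ?_)
        rw [commute_iff_eq, ← sub_eq_zero, lie_oscCharge]
        simp [charge]
    · by_cases hn : n = 0
      · subst hn
        simp only [fockJ, osc_zero, zero_add, if_true, if_neg hm, add_zero]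
        refine ((commute_osc_onMult _ _ _ _).add_right ?_)
        rw [commute_iff_eq, eq_comm, ← sub_eq_zero, lie_oscCharge]
        simp [charge]
      · simp only [fockJ, if_neg hm, if_neg hn, add_zero]
        exact commute_osc i (by decide) m n
  · exact commute_of_parts (commute_osc i (by decide) m n) (commute_ite (hs _) _)
      (commute_ite (commute_osc_onMult _ _ _ _) _).symm (commute_ite (hs _) _)
  · exact commute_of_parts (commute_osc i (by decide) m n) (commute_ite (hs _) _)
      (commute_ite (commute_osc_onMult _ _ _ _) _).symm (commute_ite (hs _) _)
  · have h1 := osc_mul_sub (W := W) i 0 1 m n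
    have h2 := (commute_osc_onMult (W := W) i 0 m f).eq
    have h3 := (commute_osc_onMult (W := W) i 1 n e).eq
    have h4 := lie_onMult e f
    rw [h.ef] at h4
    have h5 : onMult (i • (1 : Module.End ℂ W)) = i • 1 :=
      FockSpace.hom_ext fun p w => by simp [onMult_tm]
    rw [h5] at h4
    rw [zero_smul, zero_add, fockE, fockF]
    have key : (osc W i 0 m + if m = 0 then onMult e else 0) * (osc W i 1 n + if n = 0 then onMult f else 0) -
        (osc W i 1 n + if n = 0 then onMult f else 0) * (osc W i 0 m + if m = 0 then onMult e else 0) =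
        (osc W i 0 m * osc W i 1 n - osc W i 1 n * osc W i 0 m) +
        if m = 0 ∧ n = 0 then i • 1 else 0 := by
      by_cases hm : m = 0 <;> by_cases hn : n = 0
      · rw [if_pos hm, if_pos hn, if_pos ⟨hm, hn⟩, ← h4]
        linear_combination (norm := noncomm_ring) h2 - h3
      · rw [if_pos hm, if_neg hn, if_neg (fun h => hn h.2)]
        linear_combination (norm := noncomm_ring) -h3
      · rw [if_neg hm, if_pos hn, if_neg (fun h => hm h.1)]
        linear_combination (norm := noncomm_ring) h2
      · rw [if_neg hm, if_neg hn, if_neg (fun h => hm h.1)]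
        noncomm_ring
    rw [key, h1]
    by_cases hm : m = 0
    · subst hm
      by_cases hn : n = 0
      · subst hn; simp
      · simp [hn]
    · by_cases hmn : m + n = 0
      · rw [if_pos ⟨rfl, hmn, hm⟩, if_neg (fun h => hm h.1), if_pos hmn]; simp [kappa, charge]
      · rw [if_neg (fun h => hmn h.2.1), if_neg (fun h => hm h.1), if_neg hmn]; simp
  · by_cases hm : m = 0
    · subst hm
      rw [if_pos rfl, one_smul, zero_add, fockJ, osc_zero, zero_add, if_pos rfl, fockE]
      have h1 := lie_oscCharge (W := W) i 0 n
      have h2 := (commute_osc_onMult (W := W) i 0 n j).eq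
      have h3 := (commute_oscCharge_onMult (W := W) e).eq
      have h4 := lie_onMult j e
      rw [h.je] at h4
      simp only [charge, Matrix.cons_val_zero, one_smul] at h1
      by_cases hn : n = 0
      · rw [if_pos hn]
        linear_combination (norm := noncomm_ring) h1 - h2 + h3 + h4
      · rw [if_neg hn]
        linear_combination (norm := noncomm_ring) h1 - h2
    · rw [if_neg hm, zero_smul, sub_eq_zero, fockJ, if_neg hm, add_zero]
      exact (commute_osc i (by decide) m n).add_right (commute_ite (commute_osc_onMult _ _ _ _) _)
  · by_cases hm : m = 0
    · subst hm
      rw [if_pos rfl, neg_smul, one_smul, zero_add, fockJ, osc_zero, zero_add, if_pos rfl, fockF]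
      have h1 := lie_oscCharge (W := W) i 1 n
      have h2 := (commute_osc_onMult (W := W) i 1 n j).eq
      have h3 := (commute_oscCharge_onMult (W := W) f).eq
      have h4 := lie_onMult j f
      rw [h.jf, onMult_neg] at h4
      simp only [charge, Matrix.cons_val_one, Matrix.cons_val_zero, neg_smul, one_smul] at h1
      by_cases hn : n = 0
      · rw [if_pos hn]
        linear_combination (norm := noncomm_ring) h1 - h2 + h3 + h4
      · rw [if_neg hn]
        linear_combination (norm := noncomm_ring) h1 - h2
    · rw [if_neg hm, neg_zero, zero_smul, sub_eq_zero, fockJ, if_neg hm, add_zero]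
      exact (commute_osc i (by decide) m n).add_right (commute_ite (commute_osc_onMult _ _ _ _) _)
  · have h1 := osc_mul_sub (W := W) i 2 3 m n
    have hI : Commute (osc W i 3 n + if n = 0 then onMult j + oscCharge W else 0)
      (if m = 0 then i • 1 else 0) := commute_ite (hs _) _
    have hJ : Commute (osc W i 2 m) (if n = 0 then onMult j + oscCharge W else 0) := by
      refine commute_ite ((commute_osc_onMult _ _ _ _).add_right ?_) _
      rw [commute_iff_eq, eq_comm, ← sub_eq_zero, lie_oscCharge]
      simp [charge]
    rw [fockI, fockJ]
    have h2 := hI.eq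
    have h3 := hJ.eq
    have h4 : (if (3 : Fin 4) = dual 2 ∧ m + n = 0 ∧ m ≠ 0 then kappa i 2 m else 0) =
        if m + n = 0 then (m : ℂ) else 0 := by
      by_cases hm : m = 0
      · subst hm; simp
      · by_cases hmn : m + n = 0
        · rw [if_pos ⟨rfl, hmn, hm⟩, if_pos hmn]; simp [kappa, charge]
        · rw [if_neg (fun h => hmn h.2.1), if_neg hmn]
    rw [← h4, ← h1]
    linear_combination (norm := noncomm_ring) h3 - h2
  · obtain ⟨N, hN⟩ := bddModes_osc i 0 v
    refine ⟨max N 1, fun n hn => ?_⟩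
    rw [fockE, if_neg (by omega), add_zero, hN n (by omega)]
  · obtain ⟨N, hN⟩ := bddModes_osc i 1 v
    refine ⟨max N 1, fun n hn => ?_⟩
    rw [fockF, if_neg (by omega), add_zero, hN n (by omega)]

end Fock

/-! ### The action of the affine algebra on the Fock module -/

section FockRep

open MvPolynomial FockSpace

variable {W : Type*} [AddCommGroup W] [Module ℂ W] {i : ℂ} {e f j : Module.End ℂ W}

/-- The four families of operators collected in one. -/
def family {M : Type*} [AddCommGroup M] [Module ℂ M] (E F I J : ℤ → Module.End ℂ M) :
    Fin 4 → ℤ → Module.End ℂ M := ![E, F, I, J]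

theorem fockE_of_ne {n : ℤ} (hn : n ≠ 0) : fockE i e n = osc W i 0 n := by
  rw [fockE, if_neg hn, add_zero]

theorem fockF_of_ne {n : ℤ} (hn : n ≠ 0) : fockF i f n = osc W i 1 n := by
  rw [fockF, if_neg hn, add_zero]

theorem fockI_of_ne {n : ℤ} (hn : n ≠ 0) : fockI W i n = osc W i 2 n := by
  rw [fockI, if_neg hn, add_zero]

theorem fockJ_of_ne {n : ℤ} (hn : n ≠ 0) : fockJ i j n = osc W i 3 n := by
  rw [fockJ, if_neg hn, add_zero]

theorem fockE_zero : fockE i e 0 = onMult e := by rw [fockE, osc_zero, zero_add, if_pos rfl]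

theorem fockF_zero : fockF i f 0 = onMult f := by rw [fockF, osc_zero, zero_add, if_pos rfl]

theorem fockI_zero : fockI W i 0 = i • 1 := by rw [fockI, osc_zero, zero_add, if_pos rfl]

theorem fockJ_zero : fockJ i j 0 = onMult j + oscCharge W := by
  rw [fockJ, osc_zero, zero_add, if_pos rfl]

theorem fockFamily_of_ne (τ : Fin 4) {n : ℤ} (hn : n ≠ 0) :
    family (fockE i e) (fockF i f) (fockI W i) (fockJ i j) τ n = osc W i τ n := by
  fin_cases τ
  · exact fockE_of_ne hn
  · exact fockF_of_ne hn
  · exact fockI_of_ne hn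
  · exact fockJ_of_ne hn

theorem commute_fockI (m n : ℤ) : Commute (fockI W i m) (fockI W i n) := by
  have hs (A : Module.End ℂ (FockSpace W)) : Commute A (i • 1) := (Commute.one_right A).smul_right i
  exact commute_of_parts (commute_osc i (by decide) m n) (commute_ite (hs _) _)
      (commute_ite (hs _) _).symm (commute_ite (hs _) _)

variable (W i) in
/-- Polynomials in the modes of the first neutral field. -/
def fockPoly : MvPolynomial ℤ ℂ →ₐ[ℂ] Module.End ℂ (FockSpace W) :=
  (exists_algHom_of_commute (fockI W i) commute_fockI).choose

variable (W i) in
theorem fockPoly_X (n : ℤ) : fockPoly W i (X n) = fockI W i n :=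
  (exists_algHom_of_commute (fockI W i) commute_fockI).choose_spec n

theorem osc_tm_one (τ : Fin 4) {n : ℤ} (hn : 0 < n) (w : W) : osc W i τ n (tm 1 w) = 0 := by
  obtain ⟨k, rfl⟩ : ∃ k : ℕ, n = k + 1 := ⟨(n - 1).toNat, by omega⟩
  rw [osc_pos, LinearMap.smul_apply, annihilate_tm, Derivation.map_one_eq_zero, map_zero,
    LinearMap.zero_apply, smul_zero]

theorem isVac_tm_one (w : W) : IsVac (fockPoly W i) (tm 1 w) := fun n hn => by
  rw [fockPoly_X, fockI_of_ne hn.ne', osc_tm_one _ hn]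

theorem commute_create_fockI {s : Osc} (hs : s.1 ≠ 3) (n : ℤ) :
    Commute (create W s) (fockI W i n) := by
  rw [← Prod.mk.eta (p := s), ← osc_neg i]
  refine (commute_osc i ?_ _ _).add_right (commute_ite ((Commute.one_right _).smul_right i) _)
  generalize s.1 = τ at hs
  revert hs; revert τ; decide

/-- The annihilation exponential acts trivially on the vacuum, and creation operators preserve
nilpotency: those of E, F, I commute with the modes of I, and those of J change the exponential only
by a shift of index. -/
theorem fock_locNil (h : ZeroModes i e f j) (r : ℂ) : LocNil (fockPoly W i) r := fun v => by
  induction v using FockSpace.induction_on with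
  | hadd v w hv hw => exact locNil_add hv hw
  | htm p w =>
    induction p using MvPolynomial.induction_on with
    | C a =>
      refine ⟨1, fun b hb => ?_⟩
      rw [show (C a : MvPolynomial Osc ℂ) = a • 1 by rw [smul_eq_C_mul, mul_one], map_smul,
        LinearMap.smul_apply, map_smul, (isVac_tm_one w).annihilationExp_apply r (by omega),
        smul_zero]
    | add p q hp hq =>
      rw [map_add, LinearMap.add_apply]
      exact locNil_add hp hq
    | mul_X p s hp =>
      rw [mul_comm, ← create_tm]
      by_cases hs : s.1 = 3
      · have := locNil_apply_J (fockPoly_X W i) (fock_sys h).IJ r (-(s.2 + 1)) hp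
        rw [fockJ_of_ne (by omega), osc_neg, ← hs] at this
        exact this
      · exact locNil_apply_of_commute r
          (commute_polyHom_modes (fockPoly_X W i) (commute_create_fockI hs)) hp

theorem fockE_dressable (h : ZeroModes i e f j) : Dressable (fockPoly W i) (fockE i e) :=
  (fock_sys h).dressable_left (fockPoly_X W i) (fock_locNil h)

theorem fockF_dressable (h : ZeroModes i e f j) : Dressable (fockPoly W i) (fockF i f) :=
  (fock_sys h).dressable_right (fockPoly_X W i) (fock_locNil h)

theorem fock_affine_sys (h : ZeroModes i e f j) :
    Sys i (fun n => 0 + if n = 0 then 0 else 1)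
      (fun n => (if n = 0 then 1 else 0) + if n = 0 then 0 else 1)
      (vtw (fockPoly W i) 1 (fockE i e)) (vtw (fockPoly W i) (-1) (fockF i f))
      (fockI W i) (fockJ i j) :=
  (fock_sys h).dress (fockPoly_X W i) 1 (fock_locNil h)

/-- The affine Lie algebra acting on the Fock module. -/
def fockRep (h : ZeroModes i e f j) : UAff →ₐ[ℂ] Module.End ℂ (FockSpace W) :=
  UniversalEnvelopingAlgebra.lift ℂ <| affRep
    (fun n => h4Op (vtw (fockPoly W i) 1 (fockE i e) n) (vtw (fockPoly W i) (-1) (fockF i f) n)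
      (fockI W i n) (fockJ i j n)) <| (fock_affine_sys h).h4Op_mul_sub (fun n => zero_add _)
        (fun n => by split_ifs <;> simp) fockI_zero

theorem fockRep_mode (h : ZeroModes i e f j) (n : ℤ) (x : H4) : fockRep h (uMode n x) =
    h4Op (vtw (fockPoly W i) 1 (fockE i e) n) (vtw (fockPoly W i) (-1) (fockF i f) n)
      (fockI W i n) (fockJ i j n) x := by
  rw [fockRep, UniversalEnvelopingAlgebra.lift_ι_apply, affRep_mode]

theorem fockRep_K (h : ZeroModes i e f j) :
    fockRep h (UniversalEnvelopingAlgebra.ι ℂ K) = 1 := by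
  rw [fockRep, UniversalEnvelopingAlgebra.lift_ι_apply, affRep_K]

theorem oscCharge_tm_one (w : W) : oscCharge W (tm 1 w) = 0 := by
  rw [oscCharge_tm, Derivation.map_one_eq_zero, map_zero, LinearMap.zero_apply]

/-- Dressing does not alter nonnegative modes on the vacuum. So the vectors `tm 1 w` satisfy the
relations defining the induced module, which is what makes `toFock` well defined. -/
theorem fockRep_mode_tm_one_pos (h : ZeroModes i e f j) {n : ℤ} (hn : 0 < n) (x : H4) (w : W) :
    fockRep h (uMode n x) (tm 1 w) = 0 := by
  have hE (n : ℤ) (hn : 0 < n) : fockE i e n (tm 1 w) = 0 := by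
    rw [fockE_of_ne hn.ne', osc_tm_one _ hn]
  have hF (n : ℤ) (hn : 0 < n) : fockF i f n (tm 1 w) = 0 := by
    rw [fockF_of_ne hn.ne', osc_tm_one _ hn]
  rw [fockRep_mode, h4Op_apply]
  simp only [LinearMap.add_apply, LinearMap.smul_apply]
  rw [(fockE_dressable h).vtw_apply_vac 1 (isVac_tm_one w) hE hn.le,
    (fockF_dressable h).vtw_apply_vac (-1) (isVac_tm_one w) hF hn.le, hE n hn, hF n hn,
    fockI_of_ne hn.ne', fockJ_of_ne hn.ne', osc_tm_one _ hn, osc_tm_one _ hn]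
  simp

theorem fockRep_mode_tm_one_zero (h : ZeroModes i e f j) (x : H4) (w : W) :
    fockRep h (uMode 0 x) (tm 1 w) = tm 1 (h4Op e f (i • 1) j x w) := by
  have hE (n : ℤ) (hn : 0 < n) : fockE i e n (tm 1 w) = 0 := by
    rw [fockE_of_ne hn.ne', osc_tm_one _ hn]
  have hF (n : ℤ) (hn : 0 < n) : fockF i f n (tm 1 w) = 0 := by
    rw [fockF_of_ne hn.ne', osc_tm_one _ hn]
  rw [fockRep_mode, h4Op_apply, h4Op_apply]
  simp only [LinearMap.add_apply, LinearMap.smul_apply]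
  rw [(fockE_dressable h).vtw_apply_vac 1 (isVac_tm_one w) hE le_rfl,
    (fockF_dressable h).vtw_apply_vac (-1) (isVac_tm_one w) hF le_rfl, fockE_zero, fockF_zero,
    fockI_zero, fockJ_zero, LinearMap.add_apply, oscCharge_tm_one, onMult_tm, onMult_tm, onMult_tm]
  simp

/-- Subspaces stable under the four families of operators. -/
def Stable {M : Type*} [AddCommGroup M] [Module ℂ M] (X : Fin 4 → ℤ → Module.End ℂ M)
    (N : Submodule ℂ M) : Prop := ∀ τ n, ∀ v ∈ N, X τ n v ∈ N

theorem polyHom_apply_mem {M : Type*} [AddCommGroup M] [Module ℂ M]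
    {φ : MvPolynomial ℤ ℂ →ₐ[ℂ] Module.End ℂ M} {I : ℤ → Module.End ℂ M} (hφ : ∀ n, φ (X n) = I n)
    {N : Submodule ℂ M} (hN : ∀ n, ∀ v ∈ N, I n v ∈ N) (p : MvPolynomial ℤ ℂ) :
    ∀ v ∈ N, φ p v ∈ N := by
  induction p using MvPolynomial.induction_on with
  | C a =>
    intro v hv
    rw [← algebraMap_eq, AlgHom.commutes]
    exact N.smul_mem a hv
  | add p q hp hq =>
    intro v hv
    rw [map_add]
    exact N.add_mem (hp v hv) (hq v hv)
  | mul_X p n hp =>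
    intro v hv
    rw [map_mul, hφ]
    exact hp _ (hN n v hv)

end FockRep

/-! ### The structure of induced modules -/

section InducedModules

/-- The operator of an element of the enveloping algebra on a cyclic module. -/
def finAct (N : Submodule UH4 UH4) : UH4 →ₐ[ℂ] Module.End ℂ (UH4 ⧸ N) := Algebra.lsmul ℂ ℂ _

theorem finAct_apply (N : Submodule UH4 UH4) (a : UH4) (v : UH4 ⧸ N) : finAct N a v = a • v := rfl

/-- The left ideals on whose quotients `I` and `Q` act as scalars. -/
structure IsCentralIdeal (N : Submodule UH4 UH4) (i h : ℂ) : Prop where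
  I_mem : u H4.I - algebraMap ℂ UH4 i ∈ N
  Q_mem : u H4.F * u H4.E + u H4.I * u H4.J - algebraMap ℂ UH4 h ∈ N

theorem u_mul_sub (x y : H4) : u x * u y - u y * u x = u ⁅x, y⁆ := by
  rw [u, u, u, LieHom.map_lie, LieRing.of_associative_ring_bracket]

theorem smul_of_central {A : Type*} [Ring A] [Algebra ℂ A] {N : Submodule A A} {z : A} {c : ℂ}
    (hz : ∀ a, z * a = a * z) (hN : z - algebraMap ℂ A c ∈ N) (v : A ⧸ N) : z • v = c • v := by
  obtain ⟨a, rfl⟩ := N.mkQ_surjective v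
  rw [← map_smul, ← LinearMap.map_smul_of_tower, ← sub_eq_zero, ← map_sub, Submodule.mkQ_apply,
    Submodule.Quotient.mk_eq_zero, smul_eq_mul, hz, Algebra.smul_def, Algebra.commutes, ← mul_sub]
  exact N.smul_mem a hN

theorem uH4_central {z : UH4} (hz : ∀ x : H4, z * u x = u x * z) (a : UH4) : z * a = a * z := by
  have := uH4_mem (Subalgebra.centralizer ℂ {z}) (fun y => by
    rw [Subalgebra.mem_centralizer_iff]
    rintro _ rfl
    exact hz y) a
  exact (Subalgebra.mem_centralizer_iff ℂ).1 this z rfl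

theorem uAff_central {z : UAff}
    (hz : ∀ x : AffH4, z * UniversalEnvelopingAlgebra.ι ℂ x = UniversalEnvelopingAlgebra.ι ℂ x * z)
    (a : UAff) : z * a = a * z := by
  have := uAff_mem (Subalgebra.centralizer ℂ {z}) (fun y => by
    rw [Subalgebra.mem_centralizer_iff]
    rintro _ rfl
    exact hz y) a
  exact (Subalgebra.mem_centralizer_iff ℂ).1 this z rfl

theorem u_I_central (a : UH4) : u H4.I * a = a * u H4.I :=
  uH4_central (fun x => by rw [← sub_eq_zero, u_mul_sub, H4.lie_I, u, map_zero]) a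

theorem uH4_ext {z : UH4} (hE : z * u H4.E = u H4.E * z) (hF : z * u H4.F = u H4.F * z)
    (hJ : z * u H4.J = u H4.J * z) (a : UH4) : z * a = a * z := by
  refine uH4_central (fun x => ?_) a
  have hI := (u_I_central z).symm
  rw [H4.eq_sum x]
  simp only [u, map_add, map_smul, mul_add, add_mul, mul_smul_comm, smul_mul_assoc] at hE hF hI hJ ⊢
  rw [hE, hF, hI, hJ]

theorem casimir_central (a : UH4) :
    (u H4.F * u H4.E + u H4.I * u H4.J) * a = a * (u H4.F * u H4.E + u H4.I * u H4.J) := by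
  have hEF := u_mul_sub H4.E H4.F
  have hJE := u_mul_sub H4.J H4.E
  have hJF := u_mul_sub H4.J H4.F
  rw [H4.lie_E_F] at hEF
  rw [H4.lie_J_E] at hJE
  rw [H4.lie_J_F, u, u, u, map_neg, sub_eq_iff_eq_add] at hJF
  have hIE := u_I_central (u H4.E)
  have hIF := u_I_central (u H4.F)
  have hIJ := u_I_central (u H4.J)
  refine uH4_ext ?_ ?_ ?_ a
  · linear_combination (norm := noncomm_ring) -hEF * u H4.E + u H4.I * hJE + hIE * u H4.J
  · linear_combination (norm := noncomm_ring) u H4.F * hEF + u H4.I * hJF + hIF * u H4.J - hIF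
  · linear_combination (norm := noncomm_ring) -hJF * u H4.E - u H4.F * hJE + hIJ * u H4.J

variable {N : Submodule UH4 UH4} {i h : ℂ}

theorem IsCentralIdeal.finAct_I (hN : IsCentralIdeal N i h) : finAct N (u H4.I) = i • 1 :=
  LinearMap.ext fun v => smul_of_central u_I_central hN.I_mem v

theorem IsCentralIdeal.finAct_Q (hN : IsCentralIdeal N i h) :
    finAct N (u H4.F * u H4.E + u H4.I * u H4.J) = h • 1 :=
  LinearMap.ext fun v => smul_of_central casimir_central hN.Q_mem v

theorem IsCentralIdeal.zeroModes (hN : IsCentralIdeal N i h) :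
    ZeroModes i (finAct N (u H4.E)) (finAct N (u H4.F)) (finAct N (u H4.J)) where
  ef := by rw [← map_mul (finAct N), ← map_mul (finAct N), ← map_sub (finAct N), u_mul_sub, H4.lie_E_F, hN.finAct_I]
  je := by rw [← map_mul (finAct N), ← map_mul (finAct N), ← map_sub (finAct N), u_mul_sub, H4.lie_J_E]
  jf := by rw [← map_mul (finAct N), ← map_mul (finAct N), ← map_sub (finAct N), u_mul_sub, H4.lie_J_F, u, map_neg, map_neg]

theorem K_central (a : UAff) :
    UniversalEnvelopingAlgebra.ι ℂ K * a = a * UniversalEnvelopingAlgebra.ι ℂ K :=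
  uAff_central (fun x => by
    rw [← sub_eq_zero, ← LieRing.of_associative_ring_bracket, ← LieHom.map_lie, ← lie_skew, lie_K,
      neg_zero, map_zero]) a

theorem uMode_I_central (a : UAff) : uMode 0 H4.I * a = a * uMode 0 H4.I :=
  uAff_central (fun x => by
    induction x using aff_induction with
    | mode n x => rw [← sub_eq_zero, uMode_mul_sub, H4.lie_I, uMode, map_zero, map_zero]; simp
    | K => exact (K_central _).symm
    | add x y hx hy => rw [map_add, mul_add, add_mul, hx, hy]
    | smul c x hx => rw [map_smul, mul_smul_comm, smul_mul_assoc, hx]) a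

theorem zeroModeU_u (x : H4) : zeroModeU (u x) = uMode 0 x :=
  UniversalEnvelopingAlgebra.lift_ι_apply ℂ _ x

theorem induced_K_smul (v : Induced N) : UniversalEnvelopingAlgebra.ι ℂ K • v = v := by
  have := smul_of_central (N := inducedIdeal N) (c := 1) K_central
    (by rw [map_one]; exact Submodule.subset_span (Or.inl (Or.inr rfl))) v
  rwa [one_smul] at this

theorem IsCentralIdeal.modeOp_I (hN : IsCentralIdeal N i h) :
    modeOp (Induced N) H4.I 0 = i • 1 := LinearMap.ext fun v =>
  smul_of_central (N := inducedIdeal N) uMode_I_central (Submodule.subset_span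
    (Or.inr ⟨_, hN.I_mem, by rw [map_sub, zeroModeU_u, AlgHom.commutes]⟩)) v

/-- I_0 acts as the scalar i, so the I_0 term of [E_m, F_{-m}] is moved into the central term and
c_0 becomes 0. -/
theorem IsCentralIdeal.sys (hN : IsCentralIdeal N i h) :
    Sys i (fun n => if n = 0 then 0 else 1) (fun _ => 1) (modeOp (Induced N) H4.E)
      (modeOp (Induced N) H4.F) (modeOp (Induced N) H4.I) (modeOp (Induced N) H4.J) where
  EE := modeOp_E_E induced_K_smul
  FF := modeOp_F_F induced_K_smul
  II := modeOp_I_I induced_K_smul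
  JJ := modeOp_J_J induced_K_smul
  EI m n := (modeOp_I_E induced_K_smul n m).symm
  FI m n := (modeOp_I_F induced_K_smul n m).symm
  EF m n := by
    rw [modeOp_E_F induced_K_smul]
    by_cases hmn : m + n = 0
    · rw [if_pos hmn, if_pos hmn, if_pos hmn, hmn, hN.modeOp_I]; module
    · rw [if_neg hmn, if_neg hmn, if_neg hmn, one_smul]
  JE m n := by rw [modeOp_J_E induced_K_smul, one_smul]
  JF m n := by rw [modeOp_J_F induced_K_smul]; module
  IJ := modeOp_I_J induced_K_smul
  bddE := bddModes_modeOp _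
  bddF := bddModes_modeOp _

theorem induced_stable (Y : Submodule ℂ (Induced N))
    (hE : ∀ n, ∀ v ∈ Y, modeOp (Induced N) H4.E n v ∈ Y)
    (hF : ∀ n, ∀ v ∈ Y, modeOp (Induced N) H4.F n v ∈ Y)
    (hI : ∀ n, ∀ v ∈ Y, modeOp (Induced N) H4.I n v ∈ Y)
    (hJ : ∀ n, ∀ v ∈ Y, modeOp (Induced N) H4.J n v ∈ Y) (a : UAff) :
    ∀ v ∈ Y, a • v ∈ Y :=
  uAff_stable (Algebra.lsmul ℂ ℂ (Induced N)) Y hE hF hI hJ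
    (fun v hv => by
      change UniversalEnvelopingAlgebra.ι ℂ K • v ∈ Y
      rw [induced_K_smul]; exact hv) a

/-- The vectors annihilated by the positive modes. -/
def positiveVac (M : Type*) [AddCommGroup M] [Module ℂ M] [Module UAff M] [IsScalarTower ℂ UAff M] :
    Submodule ℂ M where
  carrier := {v | ∀ n : ℤ, 0 < n → ∀ x : H4, uMode n x • v = 0}
  add_mem' hv hw n hn x := by rw [smul_add, hv n hn x, hw n hn x, add_zero]
  zero_mem' n hn x := smul_zero _
  smul_mem' c v hv n hn x := by rw [smul_comm, hv n hn x, smul_zero]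

theorem uMode_zero_smul_mem_positiveVac (x : H4) :
    ∀ v ∈ positiveVac (Induced N), uMode 0 x • v ∈ positiveVac (Induced N) := by
  intro v hv n hn y
  have := uMode_mul_sub n 0 y x
  rw [add_zero, if_neg hn.ne', zero_smul, add_zero, sub_eq_iff_eq_add] at this
  rw [← mul_smul, this, add_smul, mul_smul, hv n hn, hv n hn, smul_zero, add_zero]

variable (N) in
/-- The inclusion of the inducing module. -/
def inclusion : (UH4 ⧸ N) →ₗ[ℂ] Induced N :=
  (N.restrictScalars ℂ).liftQ (((inducedIdeal N).mkQ.restrictScalars ℂ).comp zeroModeU.toLinearMap)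
    fun a ha => by
      change (inducedIdeal N).mkQ (zeroModeU a) = 0
      rw [Submodule.mkQ_apply, Submodule.Quotient.mk_eq_zero]
      exact Submodule.subset_span (Or.inr ⟨a, ha, rfl⟩)

theorem inclusion_mkQ (a : UH4) :
    inclusion N (N.mkQ a) = (inducedIdeal N).mkQ (zeroModeU a) := rfl

theorem inclusion_smul (a : UH4) (w : UH4 ⧸ N) :
    inclusion N (a • w) = zeroModeU a • inclusion N w := by
  obtain ⟨b, rfl⟩ := N.mkQ_surjective w
  rw [← map_smul, inclusion_mkQ, inclusion_mkQ, ← map_smul, smul_eq_mul, smul_eq_mul, map_mul]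

theorem mkQ_one_mem_positiveVac : (inducedIdeal N).mkQ 1 ∈ positiveVac (Induced N) := by
  intro n hn x
  rw [← map_smul, Submodule.mkQ_apply, Submodule.Quotient.mk_eq_zero, smul_eq_mul, mul_one]
  exact Submodule.subset_span (Or.inl (Or.inl ⟨n, hn, x, rfl⟩))

theorem inclusion_mem_positiveVac (w : UH4 ⧸ N) : inclusion N w ∈ positiveVac (Induced N) := by
  obtain ⟨a, rfl⟩ := N.mkQ_surjective w
  have key (x : H4) : ∀ v ∈ positiveVac (Induced N),
      ((Algebra.lsmul ℂ ℂ (Induced N)).comp zeroModeU) (u x) v ∈ positiveVac (Induced N) := by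
    intro v hv
    rw [AlgHom.comp_apply, zeroModeU_u]
    exact uMode_zero_smul_mem_positiveVac x v hv
  have := uH4_stable ((Algebra.lsmul ℂ ℂ (Induced N)).comp zeroModeU) (positiveVac (Induced N))
    (key _) (key _) (key _) (key _) a _ mkQ_one_mem_positiveVac
  change zeroModeU a • (inducedIdeal N).mkQ 1 ∈ _ at this
  rwa [← map_smul, smul_eq_mul, mul_one] at this

variable (N) in
/-- Polynomials in the modes of `I`. -/
def indPoly : MvPolynomial ℤ ℂ →ₐ[ℂ] Module.End ℂ (Induced N) :=
  (exists_algHom_of_commute _ (modeOp_I_I induced_K_smul)).choose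

variable (N) in
theorem indPoly_X (n : ℤ) : indPoly N (MvPolynomial.X n) = modeOp (Induced N) H4.I n :=
  (exists_algHom_of_commute _ (modeOp_I_I induced_K_smul)).choose_spec n

theorem isVac_inclusion (w : UH4 ⧸ N) : IsVac (indPoly N) (inclusion N w) := fun n hn => by
  rw [indPoly_X]
  exact inclusion_mem_positiveVac w n hn _

/-- The locally nilpotent vectors form a subspace stable under all modes and containing the
generator. -/
theorem induced_locNil (r : ℂ) : LocNil (indPoly N) r := by
  let Y : Submodule ℂ (Induced N) :=
    { carrier := {v | ∃ m : ℕ, ∀ b : ℤ, (m : ℤ) ≤ b →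
        indPoly N (expCoeffZ (annihilationExp r) b) v = 0}
      add_mem' := locNil_add
      zero_mem' := ⟨0, fun b _ => map_zero _⟩
      smul_mem' := fun c v ⟨m, hm⟩ => ⟨m, fun b hb => by rw [map_smul, hm b hb, smul_zero]⟩ }
  have hc {x : H4} (hx : ∀ m n, Commute (modeOp (Induced N) x m) (modeOp (Induced N) H4.I n))
      (n : ℤ) : ∀ v ∈ Y, modeOp (Induced N) x n v ∈ Y := fun v hv =>
    locNil_apply_of_commute r (commute_polyHom_modes (indPoly_X N) (hx n)) hv
  intro v
  obtain ⟨a, rfl⟩ := (inducedIdeal N).mkQ_surjective v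
  have h1 : (inducedIdeal N).mkQ 1 ∈ Y := by
    refine ⟨1, fun b hb => ?_⟩
    have := (isVac_inclusion (N.mkQ 1)).annihilationExp_apply r (b := b) (by omega)
    rwa [inclusion_mkQ, map_one] at this
  have := induced_stable Y (hc fun m n => (modeOp_I_E induced_K_smul n m).symm)
    (hc fun m n => (modeOp_I_F induced_K_smul n m).symm) (hc (modeOp_I_I induced_K_smul))
    (fun n v hv => locNil_apply_J (indPoly_X N) (modeOp_I_J induced_K_smul) r n hv) a _ h1
  rwa [← map_smul, smul_eq_mul, mul_one] at this

theorem indE_dressable : Dressable (indPoly N) (modeOp (Induced N) H4.E) where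
  comm p n := (commute_polyHom_modes (indPoly_X N)
    (fun m => (modeOp_I_E induced_K_smul m n).symm) p).symm
  bdd := bddModes_modeOp _
  nil := induced_locNil

theorem indF_dressable : Dressable (indPoly N) (modeOp (Induced N) H4.F) where
  comm p n := (commute_polyHom_modes (indPoly_X N)
    (fun m => (modeOp_I_F induced_K_smul m n).symm) p).symm
  bdd := bddModes_modeOp _
  nil := induced_locNil

variable (N) in
/-- The decoupled modes on the induced module. -/
def hat : Fin 4 → ℤ → Module.End ℂ (Induced N) :=
  family (vtw' (indPoly N) (-1) (modeOp (Induced N) H4.E)) (vtw' (indPoly N) 1 (modeOp (Induced N) H4.F))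
    (modeOp (Induced N) H4.I) (modeOp (Induced N) H4.J)

theorem modeOp_E_eq : modeOp (Induced N) H4.E = vtw (indPoly N) 1 (hat N 0) :=
  (indE_dressable.vtw_vtw' 1).symm

theorem modeOp_F_eq : modeOp (Induced N) H4.F = vtw (indPoly N) (-1) (hat N 1) := by
  have := (indF_dressable (N := N)).vtw_vtw' (-1)
  rw [neg_neg] at this
  exact this.symm

/-- The decoupling: dressing with r = -1 cancels c and d at all nonzero indices, leaving free
oscillators whose commutators are shifted by i. -/
theorem IsCentralIdeal.hat_sys (hN : IsCentralIdeal N i h) :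
    Sys i (fun _ => 0) (fun n => if n = 0 then 1 else 0) (hat N 0) (hat N 1) (hat N 2) (hat N 3) := by
  have := hN.sys.dress' (indPoly_X N) (-1) induced_locNil
  rw [neg_neg] at this
  have hc : (fun n : ℤ => (if n = 0 then 0 else 1) + if n = 0 then 0 else (-1 : ℂ)) = fun _ => 0 := by
    ext1 n; split_ifs <;> simp
  have hd : (fun n : ℤ => 1 + if n = 0 then 0 else (-1 : ℂ)) = fun n => if n = 0 then 1 else 0 := by
    ext1 n; split_ifs <;> simp
  rw [hc, hd] at this
  exact this

theorem Sys.family_mul_sub {M : Type*} [AddCommGroup M] [Module ℂ M] {X : Fin 4 → ℤ → Module.End ℂ M}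
    (hX : Sys i (fun _ => 0) (fun n => if n = 0 then 1 else 0) (X 0) (X 1) (X 2) (X 3))
    (τ τ' : Fin 4) {m n : ℤ} (hm : m ≠ 0) (hn : n ≠ 0) :
    X τ m * X τ' n - X τ' n * X τ m =
      (if τ' = dual τ ∧ m + n = 0 then kappa i τ m else 0) • 1 := by
  have hEF (m n : ℤ) := hX.EF m n
  have hJE (m n : ℤ) (hm : m ≠ 0) : Commute (X 3 m) (X 0 n) := by
    rw [commute_iff_eq, ← sub_eq_zero, hX.JE, if_neg hm, zero_smul]
  have hJF (m n : ℤ) (hm : m ≠ 0) : Commute (X 3 m) (X 1 n) := by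
    rw [commute_iff_eq, ← sub_eq_zero, hX.JF, if_neg hm, neg_zero, zero_smul]
  have hc {A B : Module.End ℂ M} (hAB : Commute A B) {p : Prop} [Decidable p] {c : ℂ} (hp : ¬ p) :
      A * B - B * A = (if p then c else 0) • 1 := by
    rw [hAB.eq, sub_self, if_neg hp, zero_smul]
  have hd {σ σ' : Fin 4} {p : Prop} (hσ : σ' ≠ dual σ) : ¬ (σ' = dual σ ∧ p) := fun h => hσ h.1
  fin_cases τ <;> fin_cases τ'
  · exact hc (hX.EE m n) (hd (by decide))
  · change X 0 m * X 1 n - X 1 n * X 0 m = _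
    rw [hX.EF, zero_smul, zero_add]
    congr 1
    simp [dual, kappa, charge]
  · exact hc (hX.EI m n) (hd (by decide))
  · exact hc (hJE n m hn).symm (hd (by decide))
  · change X 1 m * X 0 n - X 0 n * X 1 m = _
    rw [← neg_sub, hX.EF, zero_smul, zero_add, ← neg_smul, add_comm n m]
    congr 1
    by_cases hmn : m + n = 0
    · obtain rfl : n = -m := by omega
      simp [dual, kappa, charge, add_comm]
    · simp [hmn]
  · exact hc (hX.FF m n) (hd (by decide))
  · exact hc (hX.FI m n) (hd (by decide))
  · exact hc (hJF n m hn).symm (hd (by decide))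
  · exact hc (hX.EI n m).symm (hd (by decide))
  · exact hc (hX.FI n m).symm (hd (by decide))
  · exact hc (hX.II m n) (hd (by decide))
  · change X 2 m * X 3 n - X 3 n * X 2 m = _
    rw [hX.IJ]
    simp [dual, kappa, charge]
  · exact hc (hJE m n hm) (hd (by decide))
  · exact hc (hJF m n hm) (hd (by decide))
  · change X 3 m * X 2 n - X 2 n * X 3 m = _
    rw [← neg_sub, hX.IJ, ← neg_smul, add_comm n m]
    congr 1
    by_cases hmn : m + n = 0
    · obtain rfl : n = -m := by omega
      simp [dual, kappa, charge]
    · simp [hmn]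
  · exact hc (hX.JJ m n) (hd (by decide))

end InducedModules

/-! ### Induced modules as Fock modules -/

section FockEquiv

open MvPolynomial FockSpace

variable {N : Submodule UH4 UH4} {i h : ℂ} (hN : IsCentralIdeal N i h)

variable (N i) in
/-- The decoupled modes on the Fock module. -/
def fockHat : Fin 4 → ℤ → Module.End ℂ (FockSpace (UH4 ⧸ N)) :=
  family (fockE i (finAct N (u H4.E))) (fockF i (finAct N (u H4.F))) (fockI _ i)
    (fockJ i (finAct N (u H4.J)))

include hN in
theorem h4Op_finAct (x : H4) : h4Op (finAct N (u H4.E)) (finAct N (u H4.F)) (i • 1)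
    (finAct N (u H4.J)) x = finAct N (u x) := by
  rw [h4Op_apply]
  conv_rhs => rw [H4.eq_sum x]
  simp only [u, map_add, map_smul, ← hN.finAct_I]

theorem fockRep_zeroModeU (a : UH4) (w : UH4 ⧸ N) :
    fockRep hN.zeroModes (zeroModeU a) (tm 1 w) = tm 1 (a • w) := by
  let T : Subalgebra ℂ UH4 :=
    { carrier := {a | ∀ w : UH4 ⧸ N, fockRep hN.zeroModes (zeroModeU a) (tm 1 w) = tm 1 (a • w)}
      mul_mem' := fun {a b} ha hb w => by
        rw [map_mul, map_mul, Module.End.mul_apply, hb, ha, mul_smul]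
      add_mem' := fun {a b} ha hb w => by
        rw [map_add, map_add, LinearMap.add_apply, hb, ha, add_smul, map_add]
      algebraMap_mem' := fun c w => by
        rw [AlgHom.commutes, AlgHom.commutes, Module.algebraMap_end_apply, algebraMap_smul, map_smul] }
  refine uH4_mem T (fun x w => ?_) a w
  rw [zeroModeU_u, fockRep_mode_tm_one_zero, h4Op_finAct hN, finAct_apply]

/-- The map from the induced module to the Fock module. -/
def toFock : Induced N →ₗ[ℂ] FockSpace (UH4 ⧸ N) :=
  ((inducedIdeal N).restrictScalars ℂ).liftQ
    ((LinearMap.applyₗ (tm 1 (N.mkQ 1))).comp (fockRep hN.zeroModes).toLinearMap) (by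
      intro a ha
      rw [LinearMap.mem_ker]
      change fockRep hN.zeroModes a (tm 1 (N.mkQ 1)) = 0
      refine Submodule.span_induction (p := fun a _ => fockRep hN.zeroModes a (tm 1 (N.mkQ 1)) = 0)
        ?_ ?_ ?_ ?_ ha
      · rintro a ((⟨n, hn, x, rfl⟩ | rfl) | ⟨b, hb, rfl⟩)
        · exact fockRep_mode_tm_one_pos _ hn x _
        · rw [map_sub, fockRep_K, map_one, sub_self, LinearMap.zero_apply]
        · rw [fockRep_zeroModeU hN, ← map_smul, smul_eq_mul, mul_one, Submodule.mkQ_apply,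
            (Submodule.Quotient.mk_eq_zero N).2 hb, map_zero]
      · rw [map_zero, LinearMap.zero_apply]
      · intro a b _ _ ha hb
        rw [map_add, LinearMap.add_apply, ha, hb, add_zero]
      · intro a b _ hb
        rw [smul_eq_mul, map_mul, Module.End.mul_apply, hb, map_zero])

theorem toFock_mkQ (a : UAff) :
    toFock hN ((inducedIdeal N).mkQ a) = fockRep hN.zeroModes a (tm 1 (N.mkQ 1)) := rfl

theorem toFock_smul (a : UAff) (v : Induced N) :
    toFock hN (a • v) = fockRep hN.zeroModes a (toFock hN v) := by
  obtain ⟨b, rfl⟩ := (inducedIdeal N).mkQ_surjective v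
  rw [← map_smul, toFock_mkQ, toFock_mkQ, smul_eq_mul, map_mul, Module.End.mul_apply]

theorem toFock_inclusion (w : UH4 ⧸ N) : toFock hN (inclusion N w) = tm 1 w := by
  obtain ⟨a, rfl⟩ := N.mkQ_surjective w
  rw [inclusion_mkQ, toFock_mkQ, fockRep_zeroModeU hN, ← map_smul, smul_eq_mul, mul_one]

theorem toFock_modeOp (x : H4) (n : ℤ) (v : Induced N) : toFock hN (modeOp (Induced N) x n v) =
    h4Op (vtw (fockPoly _ i) 1 (fockHat N i 0) n) (vtw (fockPoly _ i) (-1) (fockHat N i 1) n)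
      (fockHat N i 2 n) (fockHat N i 3 n) x (toFock hN v) := by
  rw [modeOp_apply, toFock_smul, fockRep_mode]
  rfl

theorem toFock_indPoly (p : MvPolynomial ℤ ℂ) (v : Induced N) :
    toFock hN (indPoly N p v) = fockPoly _ i p (toFock hN v) := by
  induction p using MvPolynomial.induction_on generalizing v with
  | C a =>
    rw [← algebraMap_eq, AlgHom.commutes, AlgHom.commutes, Module.algebraMap_end_apply, map_smul,
      Module.algebraMap_end_apply]
  | add p q hp hq =>
    rw [map_add, map_add, LinearMap.add_apply, LinearMap.add_apply, map_add, hp, hq]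
  | mul_X p n hp =>
    rw [map_mul, map_mul, Module.End.mul_apply, Module.End.mul_apply, hp, indPoly_X, toFock_modeOp,
      h4Op_I, fockPoly_X]
    rfl

/-- `toFock` intertwines the affine modes, hence also their dressings; on the Fock side `vtw'`
undoes the `vtw` by which the affine action was defined. -/
theorem toFock_hat (τ : Fin 4) (n : ℤ) (v : Induced N) :
    toFock hN (hat N τ n v) = fockHat N i τ n (toFock hN v) := by
  have hE := fockE_dressable hN.zeroModes
  have hF := fockF_dressable hN.zeroModes
  fin_cases τ
  · refine (indE_dressable.map_vtw' (hE.dress 1) (-1) (toFock hN) (toFock_indPoly hN)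
      (fun n v => ?_) n v).trans ?_
    · rw [toFock_modeOp, h4Op_E]; rfl
    · rw [hE.vtw'_vtw 1]; rfl
  · refine (indF_dressable.map_vtw' (hF.dress (-1)) 1 (toFock hN) (toFock_indPoly hN)
      (fun n v => ?_) n v).trans ?_
    · rw [toFock_modeOp, h4Op_F]; rfl
    · have := hF.vtw'_vtw (-1)
      rw [neg_neg] at this
      rw [this]; rfl
  · refine (toFock_modeOp hN H4.I n v).trans ?_
    rw [h4Op_I]; rfl
  · refine (toFock_modeOp hN H4.J n v).trans ?_
    rw [h4Op_J]; rfl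

include hN in
theorem commute_hat_neg (s t : Osc) :
    Commute (hat N s.1 (-(s.2 + 1))) (hat N t.1 (-(t.2 + 1))) := by
  rw [commute_iff_eq, ← sub_eq_zero, hN.hat_sys.family_mul_sub _ _ (by omega) (by omega),
    if_neg (fun h => by omega), zero_smul]

/-- Polynomials in the decoupled creation operators. -/
def hatPoly : MvPolynomial Osc ℂ →ₐ[ℂ] Module.End ℂ (Induced N) :=
  (exists_algHom_of_commute _ (commute_hat_neg hN)).choose

theorem hatPoly_X (s : Osc) : hatPoly hN (X s) = hat N s.1 (-(s.2 + 1)) :=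
  (exists_algHom_of_commute _ (commute_hat_neg hN)).choose_spec s

/-- The map from the Fock module to the induced module. -/
def ofFock : FockSpace (UH4 ⧸ N) →ₗ[ℂ] Induced N :=
  FockSpace.lift (LinearMap.mk₂ ℂ (fun p w => hatPoly hN p (inclusion N w))
    (fun p q w => by rw [map_add, LinearMap.add_apply])
    (fun c p w => by rw [map_smul, LinearMap.smul_apply])
    (fun p w w' => by rw [map_add, map_add])
    (fun c p w => by rw [map_smul, map_smul]))

theorem ofFock_tm (p : MvPolynomial Osc ℂ) (w : UH4 ⧸ N) :
    ofFock hN (tm p w) = hatPoly hN p (inclusion N w) := by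
  rw [ofFock, FockSpace.lift_tm]; rfl

theorem fockHat_neg (s : Osc) : fockHat N i s.1 (-(s.2 + 1)) = create _ s := by
  rw [fockHat, fockFamily_of_ne _ (by omega), osc_neg]

/-- Dressed creation operators become multiplication by variables, so `ofFock` has a left inverse.
This plays the part of the Poincaré–Birkhoff–Witt theorem. -/
theorem toFock_hatPoly (p : MvPolynomial Osc ℂ) (w : UH4 ⧸ N) :
    toFock hN (hatPoly hN p (inclusion N w)) = tm p w := by
  induction p using MvPolynomial.induction_on with
  | C a =>
    rw [← algebraMap_eq, AlgHom.commutes, Module.algebraMap_end_apply, map_smul, toFock_inclusion,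
      Algebra.algebraMap_eq_smul_one, map_smul, LinearMap.smul_apply]
  | add p q hp hq => rw [map_add, LinearMap.add_apply, map_add, hp, hq, map_add, LinearMap.add_apply]
  | mul_X p s hp =>
    rw [mul_comm, map_mul, Module.End.mul_apply, hatPoly_X, toFock_hat, hp, fockHat_neg, create_tm]

theorem toFock_ofFock (v : FockSpace (UH4 ⧸ N)) : toFock hN (ofFock hN v) = v := by
  have : (toFock hN).comp (ofFock hN) = LinearMap.id := FockSpace.hom_ext fun p w => by
    rw [LinearMap.comp_apply, ofFock_tm, toFock_hatPoly, LinearMap.id_apply]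
  exact LinearMap.congr_fun this v

theorem ofFock_mem {v : FockSpace (UH4 ⧸ N)} : ofFock hN v ∈ LinearMap.range (ofFock hN) := ⟨v, rfl⟩

theorem hat_pos_inclusion (τ : Fin 4) {n : ℤ} (hn : 0 < n) (w : UH4 ⧸ N) :
    hat N τ n (inclusion N w) = 0 := by
  have hx (x : H4) (n : ℤ) (hn : 0 < n) : modeOp (Induced N) x n (inclusion N w) = 0 :=
    inclusion_mem_positiveVac w n hn x
  fin_cases τ
  · exact (indE_dressable.vtw'_apply_vac _ (isVac_inclusion w) (hx H4.E) hn.le).trans (hx _ n hn)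
  · exact (indF_dressable.vtw'_apply_vac _ (isVac_inclusion w) (hx H4.F) hn.le).trans (hx _ n hn)
  · exact hx _ n hn
  · exact hx _ n hn

theorem modeOp_zero_inclusion (x : H4) (w : UH4 ⧸ N) :
    modeOp (Induced N) x 0 (inclusion N w) = inclusion N (u x • w) := by
  rw [inclusion_smul, zeroModeU_u, modeOp_apply]

theorem hat_zero_inclusion (τ : Fin 4) (w : UH4 ⧸ N) :
    hat N τ 0 (inclusion N w) ∈ LinearMap.range (inclusion N) := by
  have hx (x : H4) (n : ℤ) (hn : 0 < n) : modeOp (Induced N) x n (inclusion N w) = 0 :=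
    inclusion_mem_positiveVac w n hn x
  fin_cases τ
  · exact ⟨_, ((indE_dressable.vtw'_apply_vac _ (isVac_inclusion w) (hx H4.E) le_rfl).trans
      (modeOp_zero_inclusion _ w)).symm⟩
  · exact ⟨_, ((indF_dressable.vtw'_apply_vac _ (isVac_inclusion w) (hx H4.F) le_rfl).trans
      (modeOp_zero_inclusion _ w)).symm⟩
  · exact ⟨_, (modeOp_zero_inclusion _ w).symm⟩
  · exact ⟨_, (modeOp_zero_inclusion _ w).symm⟩

theorem lie_hat_pos (τ : Fin 4) (k : ℕ) (p : MvPolynomial Osc ℂ) :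
    hat N τ (k + 1) * hatPoly hN p - hatPoly hN p * hat N τ (k + 1) =
      hatPoly hN (kappa i τ (k + 1) • pderiv (dual τ, k) p) :=
  lie_polyHom (hatPoly hN) (kappa i τ (k + 1) • pderiv (dual τ, k)) (fun s => by
    rw [hatPoly_X, hN.hat_sys.family_mul_sub _ _ (by omega) (by omega), Derivation.smul_apply,
      pderiv_X, map_smul]
    by_cases hs : (dual τ, k) = s
    · subst hs
      simp
    · rw [Pi.single_eq_of_ne (fun h => hs h.symm), map_zero, smul_zero, if_neg, zero_smul]
      rintro ⟨h1, h2⟩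
      exact hs (Prod.ext h1.symm (by simp only at h2 ⊢; omega))) p

theorem lie_hat_J_zero (p : MvPolynomial Osc ℂ) :
    hat N 3 0 * hatPoly hN p - hatPoly hN p * hat N 3 0 =
      hatPoly hN (mkDerivation ℂ (fun s : Osc => charge s.1 • (X s : MvPolynomial Osc ℂ)) p) :=
  lie_polyHom (hatPoly hN) _ (fun s => by
    obtain ⟨τ, k⟩ := s
    rw [hatPoly_X, mkDerivation_X, map_smul, hatPoly_X]
    have hS := hN.hat_sys
    fin_cases τ
    · refine (hS.JE _ _).trans ?_
      simp [charge]
    · refine (hS.JF _ _).trans ?_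
      simp [charge]
    · have hJI : Commute (hat N 2 (-(k + 1))) (hat N 3 0) := by
        rw [commute_iff_eq, ← sub_eq_zero, hS.IJ, if_neg (by omega), zero_smul]
      refine (sub_eq_zero.2 hJI.eq.symm).trans ?_
      simp [charge]
    · refine (sub_eq_zero.2 (hS.JJ _ _).eq).trans ?_
      simp [charge]) p

theorem commute_hat_zero {τ : Fin 4} (hτ : τ ≠ 3) (p : MvPolynomial Osc ℂ) :
    Commute (hat N τ 0) (hatPoly hN p) := by
  have hS := hN.hat_sys
  refine commute_polyHom _ (fun s => ?_) p
  obtain ⟨σ, k⟩ := s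
  rw [hatPoly_X]
  have h0 : -((k : ℤ) + 1) ≠ 0 := by omega
  have hEF : Commute (hat N 0 0) (hat N 1 (-(k + 1))) := by
    rw [commute_iff_eq, ← sub_eq_zero, hS.EF, if_neg (by omega)]; simp
  have hFE : Commute (hat N 1 0) (hat N 0 (-(k + 1))) := by
    rw [commute_iff_eq, eq_comm, ← sub_eq_zero, hS.EF, if_neg (by omega)]; simp
  have hEJ : Commute (hat N 0 0) (hat N 3 (-(k + 1))) := by
    rw [commute_iff_eq, eq_comm, ← sub_eq_zero, hS.JE, if_neg h0, zero_smul]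
  have hFJ : Commute (hat N 1 0) (hat N 3 (-(k + 1))) := by
    rw [commute_iff_eq, eq_comm, ← sub_eq_zero, hS.JF, if_neg h0, neg_zero, zero_smul]
  have hI (τ : Fin 4) (n : ℤ) : Commute (hat N 2 0) (hat N τ n) := by
    change Commute (modeOp (Induced N) H4.I 0) _
    rw [hN.modeOp_I]
    exact (Commute.one_left _).smul_left i
  fin_cases τ <;> fin_cases σ <;> first | exact absurd rfl hτ | exact hI _ _ | skip
  · exact hS.EE _ _
  · exact hEF
  · exact hS.EI _ _
  · exact hEJ
  · exact hFE
  · exact hS.FF _ _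
  · exact hS.FI _ _
  · exact hFJ

/-- A normal-ordering argument: creation modes multiply the polynomial, annihilation modes
differentiate it since they kill the ground states, and zero modes act on the ground states, with
J_0 also acting by charge. -/
theorem stable_range_ofFock : Stable (hat N) (LinearMap.range (ofFock hN)) := by
  intro τ n v hv
  obtain ⟨v, rfl⟩ := hv
  induction v using FockSpace.induction_on with
  | hadd v w hv hw => rw [map_add, map_add]; exact add_mem hv hw
  | htm p w =>
    rw [ofFock_tm]
    induction n using int_cases with
    | hneg k =>
      refine ⟨tm (X (τ, k) * p) w, ?_⟩
      rw [ofFock_tm, map_mul, hatPoly_X, Module.End.mul_apply]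
    | hpos k =>
      have := LinearMap.congr_fun (lie_hat_pos hN τ k p) (inclusion N w)
      rw [LinearMap.sub_apply, Module.End.mul_apply, Module.End.mul_apply,
        hat_pos_inclusion τ (by omega), map_zero, sub_zero] at this
      rw [this, ← ofFock_tm]
      exact ofFock_mem hN
    | h0 =>
      obtain ⟨w', hw'⟩ := hat_zero_inclusion τ w
      by_cases hτ : τ = 3
      · subst hτ
        have := LinearMap.congr_fun (lie_hat_J_zero hN p) (inclusion N w)
        rw [LinearMap.sub_apply, Module.End.mul_apply, Module.End.mul_apply, ← hw',
          sub_eq_iff_eq_add] at this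
        rw [this, ← ofFock_tm, ← ofFock_tm]
        exact add_mem (ofFock_mem hN) (ofFock_mem hN)
      · rw [← Module.End.mul_apply, (commute_hat_zero hN hτ p).eq, Module.End.mul_apply, ← hw',
          ← ofFock_tm]
        exact ofFock_mem hN

/-- The original modes are recovered from the dressed ones by the inverse dressing. With
`stable_hat` this identifies submodules with subspaces stable under free oscillators. -/
theorem Stable.smul_mem {Y : Submodule ℂ (Induced N)} (hY : Stable (hat N) Y) (a : UAff) :
    ∀ v ∈ Y, a • v ∈ Y := by
  have hp := polyHom_apply_mem (indPoly_X N) (hY 2)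
  refine induced_stable Y (fun n v hv => ?_) (fun n v hv => ?_) (hY 2) (hY 3) a
  · rw [modeOp_E_eq]
    exact (indE_dressable.dress' (-1)).vtw_apply_mem 1 Y hp (hY 0) n hv
  · rw [modeOp_F_eq]
    exact (indF_dressable.dress' 1).vtw_apply_mem (-1) Y hp (hY 1) n hv

theorem stable_hat (Y : Submodule UAff (Induced N)) : Stable (hat N) (Y.restrictScalars ℂ) := by
  have hx (x : H4) (n : ℤ) : ∀ v ∈ Y.restrictScalars ℂ, modeOp (Induced N) x n v ∈ Y.restrictScalars ℂ :=
    fun v hv => Y.smul_mem _ hv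
  have hp := polyHom_apply_mem (indPoly_X N) (hx H4.I)
  intro τ
  fin_cases τ
  · exact fun n v hv => indE_dressable.vtw'_apply_mem _ _ hp (hx H4.E) n hv
  · exact fun n v hv => indF_dressable.vtw'_apply_mem _ _ hp (hx H4.F) n hv
  · exact hx _
  · exact hx _

theorem range_ofFock : LinearMap.range (ofFock hN) = ⊤ := by
  rw [eq_top_iff]
  rintro v -
  obtain ⟨a, rfl⟩ := (inducedIdeal N).mkQ_surjective v
  have h1 : (inducedIdeal N).mkQ 1 ∈ LinearMap.range (ofFock hN) := by
    refine ⟨tm 1 (N.mkQ 1), ?_⟩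
    rw [ofFock_tm, map_one, Module.End.one_apply, inclusion_mkQ, map_one]
  have := (stable_range_ofFock hN).smul_mem a _ h1
  rwa [← map_smul, smul_eq_mul, mul_one] at this

/-- The identification of the induced module with the Fock module. -/
def fockEquiv : Induced N ≃ₗ[ℂ] FockSpace (UH4 ⧸ N) :=
  LinearEquiv.ofBijective (toFock hN) ⟨by
    intro v w hvw
    obtain ⟨v, rfl⟩ := LinearMap.range_eq_top.1 (range_ofFock hN) v
    obtain ⟨w, rfl⟩ := LinearMap.range_eq_top.1 (range_ofFock hN) w
    rw [toFock_ofFock, toFock_ofFock] at hvw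
    rw [hvw], fun v => ⟨ofFock hN v, toFock_ofFock hN v⟩⟩

theorem fockEquiv_symm_tm (p : MvPolynomial Osc ℂ) (w : UH4 ⧸ N) :
    (fockEquiv hN).symm (tm p w) = hatPoly hN p (inclusion N w) := by
  rw [LinearEquiv.symm_apply_eq]
  exact (toFock_hatPoly hN p w).symm

/-! ### The Virasoro zero mode -/

-- Positive modes vanish on the image of the inducing module, and the zero-mode part of L_0 is Q +
-- I/2 - I²/2, which is scalar there.
include hN in
theorem L0_inclusion (w : UH4 ⧸ N) : L0 (Induced N) (inclusion N w) = relWeight i h • inclusion N w := by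
  have hT (m : ℕ) : sugawaraTerm (m + 1) • inclusion N w = 0 := by
    have hx (x : H4) := inclusion_mem_positiveVac w ((m : ℤ) + 1) (by omega) x
    simp only [sugawaraTerm, add_smul, sub_smul, mul_smul, hx, smul_zero, add_zero, sub_zero]
  have h0 : sugawaraZero = zeroModeU (u H4.F * u H4.E + u H4.I * u H4.J + (1 / 2 : ℂ) • u H4.I -
      (1 / 2 : ℂ) • (u H4.I * u H4.I)) := by
    simp only [sugawaraZero, map_add, map_sub, map_mul, map_smul, zeroModeU_u]
  change sugawaraZero • inclusion N w + ∑ᶠ m : ℕ, sugawaraTerm (m + 1) • inclusion N w = _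
  simp only [hT, finsum_zero, add_zero]
  have e : finAct N (u H4.F * u H4.E + u H4.I * u H4.J + (1 / 2 : ℂ) • u H4.I -
      (1 / 2 : ℂ) • (u H4.I * u H4.I)) = relWeight i h • 1 := by
    rw [map_sub (finAct N), map_add (finAct N), map_smul (finAct N) _ (u H4.I),
      map_smul (finAct N) _ (u H4.I * u H4.I), hN.finAct_Q, map_mul (finAct N), hN.finAct_I,
      smul_mul_smul_comm, mul_one, relWeight]
    module
  rw [h0, ← inclusion_smul, ← finAct_apply, e, LinearMap.smul_apply, Module.End.one_apply, map_smul]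

theorem lie_L0_hat (τ : Fin 4) (n : ℤ) :
    L0 (Induced N) * hat N τ n - hat N τ n * L0 (Induced N) = (-n : ℂ) • hat N τ n := by
  have hI (n : ℤ) := lie_L0_I (M := Induced N) induced_K_smul n
  have hP (n : ℤ) : L0 (Induced N) * indPoly N (X n) - indPoly N (X n) * L0 (Induced N) =
      (-n : ℂ) • indPoly N (X n) := by rw [indPoly_X, hI]
  fin_cases τ
  · exact indE_dressable.vtw'_degree _ hP (lie_L0_E induced_K_smul) n
  · exact indF_dressable.vtw'_degree _ hP (lie_L0_F induced_K_smul) n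
  · exact hI n
  · exact lie_L0_J induced_K_smul n

theorem lie_L0_hatPoly (p : MvPolynomial Osc ℂ) :
    L0 (Induced N) * hatPoly hN p - hatPoly hN p * L0 (Induced N) =
      hatPoly hN (mkDerivation ℂ (fun s : Osc => (s.2 + 1 : ℂ) • (X s : MvPolynomial Osc ℂ)) p) :=
  lie_polyHom (hatPoly hN) _ (fun s => by
    rw [hatPoly_X, lie_L0_hat, mkDerivation_X, map_smul, hatPoly_X]
    congr 1
    push_cast
    ring) p

theorem weightDerivation_monomial (c : Osc → ℂ) (m : Osc →₀ ℕ) :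
    mkDerivation ℂ (fun s : Osc => c s • (X s : MvPolynomial Osc ℂ)) (monomial m 1) =
      (m.sum fun s k => k * c s) • monomial m 1 := by
  rw [mkDerivation_monomial, one_smul, Finsupp.sum, Finsupp.sum, Finset.sum_smul]
  refine Finset.sum_congr rfl fun s hs => ?_
  have hle : Finsupp.single s 1 ≤ m := by
    rw [Finsupp.single_le_iff]
    exact Nat.one_le_iff_ne_zero.2 (Finsupp.mem_support_iff.1 hs)
  rw [smul_eq_mul, mul_smul_comm, X, monomial_mul, tsub_add_cancel_of_le hle, mul_one, smul_monomial,
    smul_monomial, smul_eq_mul, smul_eq_mul, mul_one, mul_comm]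

end FockEquiv

/-! ### Modules with a basis of weight vectors -/

section WeightBasis

theorem repr_aeval {V ι : Type*} [AddCommGroup V] [Module ℂ V] (b : Module.Basis ι ℂ V)
    {D : Module.End ℂ V} {c : ι → ℂ} (hD : ∀ x, D (b x) = c x • b x) (p : Polynomial ℂ) (v : V)
    (x : ι) : b.repr (Polynomial.aeval D p v) x = p.eval (c x) * b.repr v x := by
  have h1 (v : V) : b.repr (D v) x = c x * b.repr v x := by
    have : (Finsupp.lapply x ∘ₗ b.repr.toLinearMap) ∘ₗ D =
        c x • (Finsupp.lapply x ∘ₗ b.repr.toLinearMap) := b.ext fun y => by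
      simp only [LinearMap.comp_apply, hD, map_smul, LinearMap.smul_apply, LinearEquiv.coe_coe,
        b.repr_self, Finsupp.lapply_apply, smul_eq_mul]
      by_cases hxy : y = x
      · rw [hxy]
      · rw [Finsupp.single_eq_of_ne (Ne.symm hxy), mul_zero, mul_zero]
    exact LinearMap.congr_fun this v
  induction p using Polynomial.induction_on' generalizing v with
  | add p q hp hq => rw [map_add, LinearMap.add_apply, map_add, Finsupp.add_apply, hp, hq,
      Polynomial.eval_add, add_mul]
  | monomial n a =>
    rw [Polynomial.aeval_monomial, Module.End.mul_apply, Module.algebraMap_end_apply, map_smul,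
      Finsupp.smul_apply, Polynomial.eval_monomial, smul_eq_mul, mul_assoc]
    congr 1
    induction n generalizing v with
    | zero => rw [pow_zero, pow_zero, one_mul, Module.End.one_apply]
    | succ n ih => rw [pow_succ, Module.End.mul_apply, ih, h1, pow_succ, mul_assoc]

theorem repr_of_mem_maxGenEigenspace {V ι : Type*} [AddCommGroup V] [Module ℂ V]
    (b : Module.Basis ι ℂ V) {D : Module.End ℂ V} {c : ι → ℂ} (hD : ∀ x, D (b x) = c x • b x)
    {μ : ℂ} {v : V} (hv : v ∈ D.maxGenEigenspace μ) {x : ι} (hx : b.repr v x ≠ 0) : c x = μ := by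
  obtain ⟨n, hn⟩ := (Module.End.mem_maxGenEigenspace D μ v).1 hv
  have h := repr_aeval b hD ((Polynomial.X - Polynomial.C μ) ^ n) v x
  rw [map_pow, map_sub, Polynomial.aeval_X, Polynomial.aeval_C, Algebra.algebraMap_eq_smul_one, hn,
    map_zero, Finsupp.zero_apply] at h
  have := (mul_eq_zero.1 h.symm).resolve_right hx
  simp only [Polynomial.eval_pow, Polynomial.eval_sub, Polynomial.eval_X, Polynomial.eval_C] at this
  exact sub_eq_zero.1 (by by_contra h0; exact pow_ne_zero n h0 this)

theorem repr_of_mem_eigenspace {V ι : Type*} [AddCommGroup V] [Module ℂ V]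
    (b : Module.Basis ι ℂ V) {D : Module.End ℂ V} {c : ι → ℂ} (hD : ∀ x, D (b x) = c x • b x)
    {μ : ℂ} {v : V} (hv : v ∈ D.eigenspace μ) {x : ι} (hx : b.repr v x ≠ 0) : c x = μ :=
  repr_of_mem_maxGenEigenspace b hD ((Module.End.mem_maxGenEigenspace D μ v).2 ⟨1, by
    rw [pow_one, LinearMap.sub_apply, Module.End.mem_eigenspace_iff.1 hv]; simp⟩) hx

theorem aeval_apply_mem {V : Type*} [AddCommGroup V] [Module ℂ V] {D : Module.End ℂ V}
    {Y : Submodule ℂ V} (hD : ∀ v ∈ Y, D v ∈ Y) (p : Polynomial ℂ) {v : V} (hv : v ∈ Y) :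
    Polynomial.aeval D p v ∈ Y := by
  induction p using Polynomial.induction_on' with
  | add p q hp hq => rw [map_add]; exact Y.add_mem hp hq
  | monomial n a =>
    rw [Polynomial.aeval_monomial, Module.End.mul_apply, Module.algebraMap_end_apply]
    refine Y.smul_mem a ?_
    induction n with
    | zero => exact hv
    | succ n ih => rw [pow_succ', Module.End.mul_apply]; exact hD _ ih

/-- The components of a vector for the eigenvalues of a diagonalizable operator belong to every
stable subspace containing the vector. -/
theorem exists_component {V ι : Type*} [AddCommGroup V] [Module ℂ V] (b : Module.Basis ι ℂ V)
    {D : Module.End ℂ V} {c : ι → ℂ} (hD : ∀ x, D (b x) = c x • b x) {Y : Submodule ℂ V}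
    (hY : ∀ v ∈ Y, D v ∈ Y) {v : V} (hv : v ∈ Y) (μ : ℂ) : ∃ w ∈ Y, ∃ r : ℂ, r ≠ 0 ∧
      (∀ x, c x = μ → b.repr w x = r * b.repr v x) ∧ ∀ x, c x ≠ μ → b.repr w x = 0 := by
  classical
  -- The polynomial vanishes at all eigenvalues occurring in `v` other than μ. It is not normalised,
  -- which accounts for the nonzero factor `r`.
  let F := ((b.repr v).support.image c).erase μ
  let p : Polynomial ℂ := ∏ ν ∈ F, (Polynomial.X - Polynomial.C ν)
  have hp (z : ℂ) : p.eval z = ∏ ν ∈ F, (z - ν) := by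
    simp only [p, Polynomial.eval_prod, Polynomial.eval_sub, Polynomial.eval_X, Polynomial.eval_C]
  refine ⟨Polynomial.aeval D p v, aeval_apply_mem hY p hv, p.eval μ, ?_, fun x hx => ?_,
    fun x hx => ?_⟩
  · rw [hp, Finset.prod_ne_zero_iff]
    intro ν hν
    exact sub_ne_zero.2 (Finset.ne_of_mem_erase hν).symm
  · rw [repr_aeval b hD, hx]
  · rw [repr_aeval b hD, hp]
    by_cases hv0 : b.repr v x = 0
    · rw [hv0, mul_zero]
    · rw [Finset.prod_eq_zero (i := c x), zero_mul]
      · exact Finset.mem_erase.2 ⟨hx, Finset.mem_image_of_mem _ (Finsupp.mem_support_iff.2 hv0)⟩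
      · rw [sub_self]

variable {M : Type*} [AddCommGroup M] [Module ℂ M] [Module UAff M] [IsScalarTower ℂ UAff M]
  [IsSmooth M] {ι : Type*}

/-- A basis of weight vectors, only finitely many of them of a given weight. -/
structure IsWeightBasis (b : Module.Basis ι ℂ M) (wt : ι → ℂ × ℂ × ℂ) : Prop where
  apply_I : ∀ x, modeOp M H4.I 0 (b x) = (wt x).1 • b x
  apply_J : ∀ x, modeOp M H4.J 0 (b x) = (wt x).2.1 • b x
  apply_K : ∀ v : M, UniversalEnvelopingAlgebra.ι ℂ K • v = v
  apply_L0 : ∀ x, L0 M (b x) = (wt x).2.2 • b x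
  finite : ∀ w, {x | wt x = w}.Finite

namespace IsWeightBasis

variable {b : Module.Basis ι ℂ M} {wt : ι → ℂ × ℂ × ℂ} (h : IsWeightBasis b wt)

include h

theorem weightSpace_eq (w : ℂ × ℂ × ℂ) : weightSpace M w = Submodule.span ℂ (b '' {x | wt x = w}) := by
  refine le_antisymm (fun v hv => ?_) (Submodule.span_le.2 ?_)
  · obtain ⟨⟨⟨h1, h2⟩, -⟩, h3⟩ := hv
    refine b.mem_span_image.2 fun x hx => ?_
    have hx := Finsupp.mem_support_iff.1 hx
    exact Prod.ext (repr_of_mem_eigenspace b h.apply_I h1 hx)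
      (Prod.ext (repr_of_mem_eigenspace b h.apply_J h2 hx)
        (repr_of_mem_maxGenEigenspace b h.apply_L0 h3 hx))
  · rintro _ ⟨x, rfl, rfl⟩
    refine ⟨⟨⟨Module.End.mem_eigenspace_iff.2 (h.apply_I x),
      Module.End.mem_eigenspace_iff.2 (h.apply_J x)⟩,
      Module.End.mem_eigenspace_iff.2 ((h.apply_K _).trans (one_smul ℂ _).symm)⟩,
      (Module.End.mem_maxGenEigenspace _ _ _).2 ⟨1, ?_⟩⟩
    rw [pow_one, LinearMap.sub_apply, h.apply_L0]
    simp

theorem isWeight : IsWeight M where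
  finite w := by
    rw [h.weightSpace_eq]
    exact FiniteDimensional.span_of_finite ℂ ((h.finite w).image b)
  indep w := by
    rw [h.weightSpace_eq]
    refine (b.linearIndependent.disjoint_span_image
      (s := {x | wt x = w}) (t := {x | wt x ≠ w}) ?_).mono_right (iSup₂_le fun w' hw' => ?_)
    · exact Set.disjoint_left.2 fun x hx hx' => hx' hx
    · rw [h.weightSpace_eq]
      refine Submodule.span_mono (Set.image_mono fun x hx => ?_)
      rintro rfl
      exact hw' hx.symm
  span := by
    rw [eq_top_iff, ← b.span_eq, Submodule.span_le]
    rintro _ ⟨x, rfl⟩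
    refine Submodule.mem_iSup_of_mem (wt x) ?_
    rw [h.weightSpace_eq]
    exact Submodule.subset_span ⟨x, rfl, rfl⟩

theorem ch_eq (w : ℂ × ℂ × ℂ) : ch M w = {x | wt x = (w.1, w.2.1, w.2.2 + 1 / 6)}.ncard := by
  rw [ch, h.weightSpace_eq]
  have hf := (h.finite (w.1, w.2.1, w.2.2 + 1 / 6)).image b
  have := hf.fintype
  rw [finrank_span_set_eq_card ((b.linearIndependent.linearIndepOn _).id_image),
    ← Set.ncard_eq_toFinset_card', Set.ncard_image_of_injective _ b.injective]

end IsWeightBasis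

omit [IsSmooth M] in
theorem modeOp_mkQ (S : Submodule UAff M) (x : H4) (n : ℤ) (v : M) :
    modeOp (M ⧸ S) x n (S.mkQ v) = S.mkQ (modeOp M x n v) := by
  rw [modeOp_apply, modeOp_apply, map_smul]

theorem L0_mkQ (S : Submodule UAff M) (v : M) : L0 (M ⧸ S) (S.mkQ v) = S.mkQ (L0 M v) := by
  change sugawaraZero • S.mkQ v + ∑ᶠ m : ℕ, sugawaraTerm (m + 1) • S.mkQ v =
    S.mkQ (sugawaraZero • v + ∑ᶠ m : ℕ, sugawaraTerm (m + 1) • v)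
  rw [map_add, map_smul]
  congr 1
  refine Eq.trans ?_ (S.mkQ.toAddMonoidHom.map_finsum (finite_support_sugawara v)).symm
  exact finsum_congr fun m => (map_smul S.mkQ _ _).symm

theorem L0_mem (S : Submodule UAff M) {v : M} (hv : v ∈ S) : L0 M v ∈ S := by
  rw [← Submodule.Quotient.mk_eq_zero, ← Submodule.mkQ_apply, ← L0_mkQ, Submodule.mkQ_apply,
    (Submodule.Quotient.mk_eq_zero S).2 hv, map_zero]

omit [IsSmooth M] in
/-- The basis of the quotient by the span of part of a basis. -/
theorem exists_quotient_basis (b : Module.Basis ι ℂ M) (S : Submodule UAff M) (A : Set ι)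
    (hS : S.restrictScalars ℂ = Submodule.span ℂ (b '' A)) :
    ∃ b' : Module.Basis (Aᶜ : Set ι) ℂ (M ⧸ S), ∀ x, b' x = S.mkQ (b x) := by
  let q : M →ₗ[ℂ] M ⧸ S := S.mkQ.restrictScalars ℂ
  have hq : LinearMap.ker q = Submodule.span ℂ (b '' A) := by
    rw [← hS]
    ext v
    exact Submodule.Quotient.mk_eq_zero S
  have hli : LinearIndependent ℂ (q ∘ fun x : (Aᶜ : Set ι) => b x) := by
    refine (b.linearIndependent.comp _ Subtype.val_injective).map ?_
    rw [hq, Set.range_comp, Subtype.range_coe]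
    exact b.linearIndependent.disjoint_span_image disjoint_compl_left
  refine ⟨Module.Basis.mk hli ?_, fun x => by rw [Module.Basis.mk_apply]; rfl⟩
  rintro v -
  obtain ⟨v, rfl⟩ := S.mkQ_surjective v
  have hle : (Submodule.span ℂ (Set.range b)).map q ≤
      Submodule.span ℂ (Set.range (q ∘ fun x : (Aᶜ : Set ι) => b x)) := by
    rw [Submodule.map_span_le]
    rintro _ ⟨x, rfl⟩
    by_cases hx : x ∈ A
    · have : q (b x) = 0 := by
        rw [← LinearMap.mem_ker, hq]
        exact Submodule.subset_span ⟨x, hx, rfl⟩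
      rw [this]
      exact zero_mem _
    · exact Submodule.subset_span ⟨⟨x, hx⟩, rfl⟩
  refine hle ⟨v, ?_, rfl⟩
  rw [b.span_eq]
  trivial

/-- The character of the quotient by the span of a shifted copy of a basis. -/
theorem IsWeightBasis.quotient {b : Module.Basis ι ℂ M} {wt : ι → ℂ × ℂ × ℂ}
    (h : IsWeightBasis b wt) (S : Submodule UAff M) {σ : ι → ι} (hσ : σ.Injective)
    (hS : S.restrictScalars ℂ = Submodule.span ℂ (b '' Set.range σ)) {t : ℂ × ℂ × ℂ}
    (ht : ∀ x, wt (σ x) = wt x + t) :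
    IsWeight (M ⧸ S) ∧ ch (M ⧸ S) = mulFormal (1 - mono t.1 t.2.1 t.2.2) (ch M) := by
  obtain ⟨b', hb'⟩ := exists_quotient_basis b S _ hS
  have h' : IsWeightBasis b' (fun x => wt x) :=
    { apply_I := fun x => by rw [hb', modeOp_mkQ, h.apply_I, LinearMap.map_smul_of_tower]
      apply_J := fun x => by rw [hb', modeOp_mkQ, h.apply_J, LinearMap.map_smul_of_tower]
      apply_K := fun v => by
        obtain ⟨v, rfl⟩ := S.mkQ_surjective v
        rw [← map_smul, h.apply_K]
      apply_L0 := fun x => by rw [hb', L0_mkQ, h.apply_L0, LinearMap.map_smul_of_tower]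
      finite := fun w => (h.finite w).preimage Subtype.val_injective.injOn }
  refine ⟨h'.isWeight, funext fun w => ?_⟩
  rw [mulFormal_one_sub_mono, h.ch_eq, h.ch_eq, h'.ch_eq]
  set w' : ℂ × ℂ × ℂ := (w.1, w.2.1, w.2.2 + 1 / 6) with hw'
  have e1 : ((w - (t.1, t.2.1, t.2.2)).1, (w - (t.1, t.2.1, t.2.2)).2.1,
      (w - (t.1, t.2.1, t.2.2)).2.2 + 1 / 6) = w' - t := by
    ext <;> simp [hw', sub_add_eq_add_sub]
  rw [e1]
  -- The basis vectors of weight w' lying in the submodule correspond under σ to all basis vectors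
  -- of weight w' - t; the remaining ones of weight w' index the quotient.
  have e2 : σ '' {x | wt x = w' - t} = {x | wt x = w'} ∩ Set.range σ := by
    ext y
    constructor
    · rintro ⟨x, hx, rfl⟩
      refine ⟨?_, x, rfl⟩
      change wt (σ x) = w'
      rw [ht, show wt x = w' - t from hx, sub_add_cancel]
    · rintro ⟨hy, x, rfl⟩
      refine ⟨x, ?_, rfl⟩
      change wt (σ x) = w' at hy
      rw [ht] at hy
      exact eq_sub_of_add_eq hy
  have e3 : Subtype.val '' {x : ((Set.range σ)ᶜ : Set ι) | wt x = w'} =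
      {x | wt x = w'} \ Set.range σ := by
    ext y
    constructor
    · rintro ⟨x, hx, rfl⟩
      exact ⟨hx, x.2⟩
    · rintro ⟨hy, hy'⟩
      exact ⟨⟨y, hy'⟩, hy, rfl⟩
  rw [← Set.ncard_image_of_injective {x | wt x = w' - t} hσ, e2,
    ← Set.ncard_image_of_injective _ Subtype.val_injective, e3, ← Set.ncard_inter_add_ncard_sdiff_eq_ncard _ (Set.range σ) (h.finite w')]
  push_cast
  ring

end WeightBasis

/-! ### The weight basis of an induced module and its submodules -/

section InducedBasis

open MvPolynomial FockSpace

variable {N : Submodule UH4 UH4} {i h : ℂ} (hN : IsCentralIdeal N i h) {B : Type*}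
  (b : Module.Basis B ℂ (UH4 ⧸ N))

/-- The basis of an induced module given by a basis of the inducing module. -/
def indBasis : Module.Basis ((Osc →₀ ℕ) × B) ℂ (Induced N) :=
  Module.Basis.map (M' := Induced N)
    (show Module.Basis _ ℂ (FockSpace (UH4 ⧸ N)) from (basisMonomials Osc ℂ).tensorProduct b)
    (fockEquiv hN).symm

theorem indBasis_apply (x : (Osc →₀ ℕ) × B) :
    indBasis hN b x = hatPoly hN (monomial x.1 1) (inclusion N (b x.2)) := by
  rw [← fockEquiv_symm_tm, indBasis, Module.Basis.map_apply]
  congr 1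
  refine (Module.Basis.tensorProduct_apply' _ _ _).trans ?_
  rw [coe_basisMonomials]
  rfl

/-- The conformal weight of a monomial. -/
def oscDegree (m : Osc →₀ ℕ) : ℕ := m.sum fun s k => k * (s.2 + 1)

/-- The charge of a monomial. -/
def oscChargeOf (m : Osc →₀ ℕ) : ℂ := m.sum fun s k => k * charge s.1

theorem oscDegree_add_single (m : Osc →₀ ℕ) (s : Osc) :
    oscDegree (m + Finsupp.single s 1) = oscDegree m + (s.2 + 1) := by
  rw [oscDegree, Finsupp.sum_add_index' (by simp) (by intros; ring), Finsupp.sum_single_index (by simp),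
    one_mul]
  rfl

theorem oscChargeOf_add_single (m : Osc →₀ ℕ) (s : Osc) :
    oscChargeOf (m + Finsupp.single s 1) = oscChargeOf m + charge s.1 := by
  rw [oscChargeOf, Finsupp.sum_add_index' (by simp) (by intros; push_cast; ring),
    Finsupp.sum_single_index (by simp)]
  simp [oscChargeOf]

theorem oscDegree_eq_zero {m : Osc →₀ ℕ} : oscDegree m = 0 ↔ m = 0 := by
  constructor
  · intro hm
    rw [oscDegree, Finsupp.sum, Finset.sum_eq_zero_iff] at hm
    ext s
    by_contra hs
    have := hm s (Finsupp.mem_support_iff.2 hs)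
    rw [Nat.mul_eq_zero] at this
    exact this.elim hs (by omega)
  · rintro rfl
    rfl

theorem finite_oscDegree (d : ℕ) : {m : Osc →₀ ℕ | oscDegree m = d}.Finite := by
  classical
  refine (Set.finite_Iic (∑ s ∈ (Finset.univ : Finset (Fin 4)) ×ˢ Finset.range d,
    Finsupp.single s d)).subset fun m hm s => ?_
  rw [Finsupp.finsetSum_apply]
  by_cases hs : m s = 0
  · rw [hs]; exact Nat.zero_le _
  have h1 : m s * (s.2 + 1) ≤ d := by
    rw [← show oscDegree m = d from hm, oscDegree, Finsupp.sum]
    exact Finset.single_le_sum (f := fun s => m s * (s.2 + 1)) (fun _ _ => Nat.zero_le _)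
      (Finsupp.mem_support_iff.2 hs)
  have h2 : m s ≤ d := le_trans (Nat.le_mul_of_pos_right _ (by omega)) h1
  have h3 : s.2 < d := by
    have : 1 * (s.2 + 1) ≤ m s * (s.2 + 1) := Nat.mul_le_mul_right _ (by omega)
    omega
  refine h2.trans ?_
  refine le_trans (le_of_eq (Finsupp.single_eq_same (a := s) (b := d)).symm) ?_
  exact Finset.single_le_sum (f := fun t : Osc => (Finsupp.single t d) s) (fun _ _ => Nat.zero_le _)
    (Finset.mem_product.2 ⟨Finset.mem_univ _, Finset.mem_range.2 h3⟩)

theorem L0_indBasis (x : (Osc →₀ ℕ) × B) : L0 (Induced N) (indBasis hN b x) =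
    (relWeight i h + oscDegree x.1 : ℂ) • indBasis hN b x := by
  have := LinearMap.congr_fun (lie_L0_hatPoly hN (monomial x.1 1)) (inclusion N (b x.2))
  rw [weightDerivation_monomial, LinearMap.sub_apply, Module.End.mul_apply, Module.End.mul_apply,
    L0_inclusion hN, map_smul, map_smul, LinearMap.smul_apply, ← indBasis_apply,
    sub_eq_iff_eq_add, ← add_smul, add_comm] at this
  rw [this, oscDegree, Finsupp.sum, Finsupp.sum]
  push_cast
  rfl

theorem J_indBasis {c : ℂ} {x : (Osc →₀ ℕ) × B} (hJ : u H4.J • b x.2 = c • b x.2) :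
    modeOp (Induced N) H4.J 0 (indBasis hN b x) = (c + oscChargeOf x.1) • indBasis hN b x := by
  have := LinearMap.congr_fun (lie_hat_J_zero hN (monomial x.1 1)) (inclusion N (b x.2))
  have h3 : hat N 3 0 = modeOp (Induced N) H4.J 0 := rfl
  rw [weightDerivation_monomial, LinearMap.sub_apply, Module.End.mul_apply, Module.End.mul_apply, h3,
    modeOp_zero_inclusion, hJ, map_smul, map_smul, map_smul, LinearMap.smul_apply, ← indBasis_apply,
    sub_eq_iff_eq_add, ← add_smul, add_comm] at this
  rw [this]
  rfl

/-- The weight of a basis vector. -/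
def indWeight (i h j : ℂ) (k : B → ℤ) (x : (Osc →₀ ℕ) × B) : ℂ × ℂ × ℂ :=
  (i, j + k x.2 + oscChargeOf x.1, relWeight i h + oscDegree x.1)

variable {j : ℂ} {k : B → ℤ} (hk : k.Injective) (hJ : ∀ x, u H4.J • b x = (j + k x : ℂ) • b x)

-- The L_0-eigenvalue fixes the degree of the monomial and so leaves finitely many monomials; for
-- each of them the J_0-eigenvalue determines the ground state, since `k` is injective.
include hk hJ in
theorem isWeightBasis_indBasis : IsWeightBasis (indBasis hN b) (indWeight i h j k) where
  apply_I x := by rw [hN.modeOp_I]; rfl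
  apply_J x := J_indBasis hN b (hJ x.2)
  apply_K := induced_K_smul
  apply_L0 := L0_indBasis hN b
  finite w := by
    by_cases hd : ∃ d : ℕ, w.2.2 = relWeight i h + d
    · obtain ⟨d, hd⟩ := hd
      refine Set.Finite.of_finite_image (f := Prod.fst) ((finite_oscDegree d).subset ?_) ?_
      · rintro _ ⟨x, hx, rfl⟩
        have : relWeight i h + oscDegree x.1 = relWeight i h + d := by
          rw [← hd, ← show indWeight i h j k x = w from hx]; rfl
        exact_mod_cast add_left_cancel this
      · rintro ⟨m, x⟩ hx ⟨m', x'⟩ hx' hm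
        obtain rfl : m = m' := hm
        have : indWeight i h j k (m, x) = indWeight i h j k (m, x') :=
          (show indWeight i h j k (m, x) = w from hx).trans
            (show indWeight i h j k (m, x') = w from hx').symm
        have h2 : j + k x + oscChargeOf m = j + k x' + oscChargeOf m := congrArg (fun w => w.2.1) this
        have h3 : (k x : ℂ) = k x' := add_left_cancel (add_right_cancel h2)
        obtain rfl : x = x' := hk (by exact_mod_cast h3)
        rfl
    · convert Set.finite_empty
      refine Set.eq_empty_of_forall_notMem fun x hx => hd ⟨oscDegree x.1, ?_⟩
      rw [← show indWeight i h j k x = w from hx]; rfl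

/-- The creation operators commuting with all modes of nonzero index. -/
def IsSpecial (i : ℂ) (s : Osc) : Prop := ∀ t : Osc, kappa i (dual t.1) (t.2 + 1) = 0 ↔ t = s

variable {s : Osc} (hs : IsSpecial i s)

-- The only modes of nonzero index that could fail to commute with x_s are those dual to it, and
-- there the commutator coefficient vanishes by speciality. J_0 still sees its charge.
include hs in
theorem hat_special (τ : Fin 4) (n : ℤ) (v : Induced N) :
    hat N τ n (hatPoly hN (X s) v) = hatPoly hN (X s) (hat N τ n v) +
      (if τ = 3 ∧ n = 0 then charge s.1 else 0) • hatPoly hN (X s) v := by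
  by_cases hn : n = 0
  · subst hn
    by_cases hτ : τ = 3
    · subst hτ
      have := LinearMap.congr_fun (lie_hat_J_zero hN (X s)) v
      rw [mkDerivation_X, map_smul, LinearMap.sub_apply, sub_eq_iff_eq_add'] at this
      rw [if_pos ⟨rfl, rfl⟩]
      exact this
    · rw [if_neg (fun h => hτ h.1), zero_smul, add_zero]
      exact LinearMap.congr_fun (commute_hat_zero hN hτ (X s)).eq v
  · have := LinearMap.congr_fun (hN.hat_sys.family_mul_sub τ s.1 hn
      (show -((s.2 : ℤ) + 1) ≠ 0 by omega)) v
    rw [if_neg (fun h => hn h.2), zero_smul, add_zero, hatPoly_X, ← sub_eq_zero]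
    refine this.trans ?_
    split_ifs with h
    · have h2 := (hs s).2 rfl
      rw [h.1, dual_dual] at h2
      rw [show n = s.2 + 1 by omega, h2, zero_smul, LinearMap.zero_apply]
    · rw [zero_smul, LinearMap.zero_apply]

/-- The submodule generated by a special creation operator. -/
def specialSubmodule : Submodule UAff (Induced N) where
  carrier := Set.range (hatPoly hN (X s))
  add_mem' := by
    rintro _ _ ⟨v, rfl⟩ ⟨w, rfl⟩
    exact ⟨v + w, map_add _ _ _⟩
  zero_mem' := ⟨0, map_zero _⟩
  smul_mem' a v hv := by
    have : Stable (hat N) (LinearMap.range (hatPoly hN (X s))) := by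
      rintro τ n _ ⟨v, rfl⟩
      rw [hat_special hN hs]
      exact add_mem ⟨_, rfl⟩ (Submodule.smul_mem _ _ ⟨v, rfl⟩)
    exact this.smul_mem a v hv

theorem specialSubmodule_eq_span (A : Set ((Osc →₀ ℕ) × B)) (hA : ∀ x, x ∈ A ↔ x.1 s ≠ 0) :
    (specialSubmodule hN hs).restrictScalars ℂ = Submodule.span ℂ (indBasis hN b '' A) := by
  have h1 : (specialSubmodule hN hs).restrictScalars ℂ =
      (⊤ : Submodule ℂ (Induced N)).map (hatPoly hN (X s)) := by
    rw [Submodule.map_top]; rfl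
  rw [h1, ← (indBasis hN b).span_eq, Submodule.map_span]
  congr 1
  have key (m : Osc →₀ ℕ) (x : B) : hatPoly hN (X s) (indBasis hN b (m, x)) =
      indBasis hN b (m + Finsupp.single s 1, x) := by
    rw [indBasis_apply, indBasis_apply, ← Module.End.mul_apply, ← map_mul, X, monomial_mul, one_mul,
      add_comm]
  ext v
  constructor
  · rintro ⟨_, ⟨⟨m, x⟩, rfl⟩, rfl⟩
    rw [key]
    exact ⟨_, (hA _).2 (by simp), rfl⟩
  · rintro ⟨⟨m, x⟩, hx, rfl⟩
    rw [hA] at hx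
    refine ⟨_, ⟨(m - Finsupp.single s 1, x), rfl⟩, ?_⟩
    rw [key, tsub_add_cancel_of_le]
    rw [Finsupp.single_le_iff]
    exact Nat.one_le_iff_ne_zero.2 hx

theorem mem_specialSubmodule (v : Induced N) :
    v ∈ specialSubmodule hN hs ↔ ∀ x, (indBasis hN b).repr v x ≠ 0 → x.1 s ≠ 0 := by
  rw [← Submodule.restrictScalars_mem ℂ,
    specialSubmodule_eq_span hN b hs {x | x.1 s ≠ 0} (fun _ => Iff.rfl), Module.Basis.mem_span_image]
  simp [Set.subset_def]

theorem repr_hat_pos (τ : Fin 4) (n : ℕ) (v : Induced N) (m : Osc →₀ ℕ) (x : B) :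
    (indBasis hN b).repr (hat N τ (n + 1) v) (m, x) =
      kappa i τ (n + 1) * (m (dual τ, n) + 1) *
        (indBasis hN b).repr v (m + Finsupp.single (dual τ, n) 1, x) := by
  set t : Osc := (dual τ, n) with ht
  have : (Finsupp.lapply (m, x) ∘ₗ (indBasis hN b).repr.toLinearMap) ∘ₗ hat N τ (n + 1) =
      (kappa i τ (n + 1) * (m t + 1)) •
        (Finsupp.lapply (m + Finsupp.single t 1, x) ∘ₗ (indBasis hN b).repr.toLinearMap) := by
    refine (indBasis hN b).ext fun ⟨m', x'⟩ => ?_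
    have h1 : hat N τ (n + 1) (indBasis hN b (m', x')) =
        (kappa i τ (n + 1) * m' t) • indBasis hN b (m' - Finsupp.single t 1, x') := by
      have := LinearMap.congr_fun (lie_hat_pos hN τ n (monomial m' 1)) (inclusion N (b x'))
      rw [LinearMap.sub_apply, Module.End.mul_apply, Module.End.mul_apply,
        hat_pos_inclusion τ (by omega), map_zero, sub_zero] at this
      rw [indBasis_apply, this, ← ht, pderiv_monomial, one_mul, map_smul, LinearMap.smul_apply,
        indBasis_apply, mul_smul]
      congr 1
      rw [← LinearMap.smul_apply, ← map_smul, smul_monomial, smul_eq_mul, mul_one]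
    simp only [LinearMap.comp_apply, h1, map_smul, LinearMap.smul_apply, LinearEquiv.coe_coe,
        Module.Basis.repr_self, Finsupp.lapply_apply, smul_eq_mul]
    by_cases h0 : m' t = 0
    · rw [h0, Nat.cast_zero, mul_zero, zero_mul, Finsupp.single_eq_of_ne, mul_zero]
      intro h
      have := congrArg (fun y => y.1 t) h
      simp [h0] at this
    · have hm' : m' - Finsupp.single t 1 + Finsupp.single t 1 = m' :=
        tsub_add_cancel_of_le (by rw [Finsupp.single_le_iff]; exact Nat.one_le_iff_ne_zero.2 h0)
      by_cases h : (m', x') = (m + Finsupp.single t 1, x)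
      · rw [h]
        obtain ⟨rfl, rfl⟩ := Prod.mk.inj h
        simp
      · rw [Finsupp.single_eq_of_ne, Finsupp.single_eq_of_ne (Ne.symm h), mul_zero, mul_zero]
        intro h2
        obtain ⟨rfl, rfl⟩ := Prod.mk.inj h2
        exact h (by rw [hm'])
  exact LinearMap.congr_fun this v

-- Every variable other than x_s is removed by its dual annihilation mode, whose coefficient is
-- nonzero. Since x_s does not occur in the chosen monomial, the descent reaches the constant
-- monomial.
include hs in
theorem exists_repr_zero {Y : Submodule UAff (Induced N)} (m : Osc →₀ ℕ) (hm : m s = 0) (x : B)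
    {v : Induced N} (hv : v ∈ Y) (hvm : (indBasis hN b).repr v (m, x) ≠ 0) :
    ∃ w ∈ Y, (indBasis hN b).repr w (0, x) ≠ 0 := by
  induction m using WellFoundedLT.induction generalizing v with
  | ind m ih =>
    by_cases h0 : m = 0
    · subst h0
      exact ⟨v, hv, hvm⟩
    · obtain ⟨t, ht⟩ : ∃ t, m t ≠ 0 := by
        by_contra hc
        push Not at hc
        exact h0 (Finsupp.ext hc)
      have hts : t ≠ s := by rintro rfl; exact ht hm
      have hle : m - Finsupp.single t 1 + Finsupp.single t 1 = m :=
        tsub_add_cancel_of_le (by rw [Finsupp.single_le_iff]; exact Nat.one_le_iff_ne_zero.2 ht)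
      have hlt : m - Finsupp.single t 1 < m := by
        refine lt_of_le_of_ne tsub_le_self fun h => ?_
        have := congrArg (fun y => y t) h
        simp at this
        omega
      refine ih _ hlt (by simp [hm]) (stable_hat Y (dual t.1) (t.2 + 1) v hv) ?_
      have := repr_hat_pos hN b (dual t.1) t.2 v (m - Finsupp.single t 1) x
      rw [dual_dual, Prod.mk.eta, hle] at this
      rw [this]
      refine mul_ne_zero (mul_ne_zero (fun h => hts ((hs t).1 h)) ?_) hvm
      exact Nat.cast_add_one_ne_zero _

-- Outside the special submodule some monomial without x_s occurs. Descending to a ground-state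
-- coefficient and projecting to its weight isolates one ground-state basis vector.
include hs hk hJ in
theorem exists_inclusion_mem {Y : Submodule UAff (Induced N)} (hY : ¬ Y ≤ specialSubmodule hN hs) :
    ∃ x, inclusion N (b x) ∈ Y := by
  obtain ⟨v, hv, hvs⟩ := SetLike.not_le_iff_exists.1 hY
  rw [mem_specialSubmodule hN b hs] at hvs
  push Not at hvs
  obtain ⟨⟨m, x⟩, hvm, hm⟩ := hvs
  obtain ⟨w, hw, hwx⟩ := exists_repr_zero hN b hs m hm x hv hvm
  refine ⟨x, ?_⟩
  have hB := isWeightBasis_indBasis hN b hk hJ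
  -- The L_0-component keeps only the constant monomial, and the following J_0-component keeps a
  -- single ground state because `k` is injective.
  obtain ⟨w1, hw1, r1, hr1, h1, h1'⟩ := exists_component (indBasis hN b) hB.apply_L0
    (Y := Y.restrictScalars ℂ) (fun v hv => L0_mem Y hv) hw (relWeight i h)
  obtain ⟨w2, hw2, r2, hr2, h2, h2'⟩ := exists_component (indBasis hN b) hB.apply_J
    (Y := Y.restrictScalars ℂ) (fun v hv => Y.smul_mem _ hv) hw1 (j + k x)
  have hx1 : (indWeight i h j k (0, x)).2.2 = relWeight i h := by
    simp [indWeight, oscDegree]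
  have hx2 : (indWeight i h j k (0, x)).2.1 = j + k x := by
    simp [indWeight, oscChargeOf]
  have hw : w2 = (r2 * (r1 * (indBasis hN b).repr w (0, x))) • inclusion N (b x) := by
    have e : inclusion N (b x) = indBasis hN b (0, x) := by
      rw [indBasis_apply]
      change _ = hatPoly hN 1 _
      rw [map_one, Module.End.one_apply]
    rw [e]
    refine (indBasis hN b).repr.injective (Finsupp.ext fun y => ?_)
    rw [map_smul, Module.Basis.repr_self, Finsupp.smul_apply, smul_eq_mul]
    by_cases hy : y = (0, x)
    · subst hy
      rw [h2 _ hx2, h1 _ hx1, Finsupp.single_eq_same, mul_one]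
    · rw [Finsupp.single_eq_of_ne hy, mul_zero]
      by_cases hy2 : (indWeight i h j k y).2.1 = j + k x
      · rw [h2 y hy2, h1', mul_zero]
        intro hy1
        obtain ⟨m', x'⟩ := y
        have : oscDegree m' = 0 := by
          simpa [indWeight] using hy1
        obtain rfl := oscDegree_eq_zero.1 this
        have h3 : (k x' : ℂ) = k x := by
          simpa [indWeight, oscChargeOf] using hy2
        obtain rfl : x' = x := hk (by exact_mod_cast h3)
        exact hy rfl
      · exact h2' y hy2
  rw [hw] at hw2
  exact ((Y.restrictScalars ℂ).smul_mem_iff (mul_ne_zero hr2 (mul_ne_zero hr1 hwx))).1 hw2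

/-! ### The maximal submodules -/

include b in
theorem specialSubmodule_ne_top [Nonempty B] : specialSubmodule hN hs ≠ ⊤ := by
  intro htop
  obtain ⟨x⟩ := ‹Nonempty B›
  have : indBasis hN b (0, x) ∈ specialSubmodule hN hs := htop ▸ Submodule.mem_top
  rw [mem_specialSubmodule hN b] at this
  exact this (0, x) (by simp) rfl

include hs hk hJ in
theorem eq_top_of_not_le [Nonempty B]
    (hgen : ∀ x, ∃ a : UH4, a • b x = N.mkQ 1) {Y : Submodule UAff (Induced N)}
    (hY : ¬ Y ≤ specialSubmodule hN hs) : Y = ⊤ := by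
  obtain ⟨x, hx⟩ := exists_inclusion_mem hN b hk hJ hs hY
  obtain ⟨a, ha⟩ := hgen x
  have h1 : (inducedIdeal N).mkQ 1 ∈ Y := by
    have := Y.smul_mem (zeroModeU a) hx
    rwa [← inclusion_smul, ha, inclusion_mkQ, map_one] at this
  rw [eq_top_iff]
  rintro v -
  obtain ⟨c, rfl⟩ := (inducedIdeal N).mkQ_surjective v
  have := Y.smul_mem c h1
  rwa [← map_smul, smul_eq_mul, mul_one] at this

include hk hJ in
theorem sSup_proper [Nonempty B] (hgen : ∀ x, ∃ a : UH4, a • b x = N.mkQ 1) :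
    sSup {Y : Submodule UAff (Induced N) | Y ≠ ⊤} = specialSubmodule hN hs := by
  refine le_antisymm (sSup_le fun Y hY => ?_) (le_sSup (specialSubmodule_ne_top hN b hs))
  by_contra hc
  exact hY (eq_top_of_not_le hN b hk hJ hs hgen hc)

include hk hJ in
theorem isCoatom_specialSubmodule [Nonempty B] (hgen : ∀ x, ∃ a : UH4, a • b x = N.mkQ 1) :
    IsCoatom (specialSubmodule hN hs) :=
  ⟨specialSubmodule_ne_top hN b hs, fun _ hY =>
    eq_top_of_not_le hN b hk hJ hs hgen hY.not_ge⟩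

-- Unlike in the Verma case the inducing module need not be irreducible: a submodule not contained
-- in the special one already contains a ground state. Conversely, monomials divisible by x_s have
-- positive degree, so the special submodule contains no nonzero ground state.
include hk hJ in
theorem sSup_zero_inter : sSup {Y : Submodule UAff (Induced N) |
    Y.restrictScalars ℂ ⊓ (L0 (Induced N)).maxGenEigenspace (relWeight i h) = ⊥} =
      specialSubmodule hN hs := by
  have hB := isWeightBasis_indBasis hN b hk hJ
  refine le_antisymm (sSup_le fun Y hY => ?_) (le_sSup ?_)
  · by_contra hc
    obtain ⟨x, hx⟩ := exists_inclusion_mem hN b hk hJ hs hc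
    have e : inclusion N (b x) = indBasis hN b (0, x) := by
      rw [indBasis_apply]
      change _ = hatPoly hN 1 _
      rw [map_one, Module.End.one_apply]
    have h0 : inclusion N (b x) ∈ (⊥ : Submodule ℂ (Induced N)) := by
      rw [← show _ = ⊥ from hY]
      refine ⟨hx, (Module.End.mem_maxGenEigenspace _ _ _).2 ⟨1, ?_⟩⟩
      rw [pow_one, LinearMap.sub_apply, L0_inclusion hN]
      simp
    rw [Submodule.mem_bot, e] at h0
    exact (indBasis hN b).ne_zero _ h0
  · refine (Submodule.eq_bot_iff _).2 fun v hv => ?_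
    refine (indBasis hN b).repr.map_eq_zero_iff.1 (Finsupp.ext fun x => ?_)
    by_contra hx
    have h1 := repr_of_mem_maxGenEigenspace _ hB.apply_L0 hv.2 hx
    have h2 := (mem_specialSubmodule hN b hs v).1 hv.1 x hx
    have h3 : oscDegree x.1 = 0 := by simpa [indWeight] using h1
    rw [oscDegree_eq_zero.1 h3] at h2
    exact h2 rfl

/-- The special creation operators for integral eigenvalues of `I`. -/
def specialOsc (i : ℤ) : Osc := (if 0 < i then 0 else 1, i.natAbs - 1)

/-- The coefficient attached to the variable (τ, n) is n + 1 - i · charge τ. As n + 1 > 0, it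
vanishes only for charge sgn i and n + 1 = |i|. -/
theorem isSpecial_specialOsc {i : ℤ} (hi : i ≠ 0) : IsSpecial i (specialOsc i) := by
  rintro ⟨τ, n⟩
  have key : kappa i (dual τ) ((n : ℤ) + 1) = 0 ↔ (n : ℤ) + 1 - i * (![1, -1, 0, 0] : Fin 4 → ℤ) τ = 0 := by
    rw [kappa, charge_dual, ← Int.cast_eq_zero (α := ℂ)]
    fin_cases τ <;> simp [charge, sub_eq_add_neg]
  refine key.trans ?_
  rw [specialOsc, Prod.mk.injEq]
  rcases lt_or_gt_of_ne hi with h | h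
  · rw [if_neg h.not_gt]
    fin_cases τ <;> simp <;> omega
  · rw [if_pos h]
    fin_cases τ <;> simp <;> omega

end InducedBasis

/-! ### Modules over the finite-dimensional algebra -/

section Finite

variable {N : Submodule UH4 UH4} {i h : ℂ} (hN : IsCentralIdeal N i h)

variable (N) in
/-- The weight vectors of a cyclic module. -/
def finVec (k : ℤ) : UH4 ⧸ N :=
  N.mkQ (if 0 ≤ k then u H4.E ^ k.toNat else u H4.F ^ (-k).toNat)

theorem finVec_zero : finVec N 0 = N.mkQ 1 := by simp [finVec]

theorem finVec_natCast (n : ℕ) : finVec N n = N.mkQ (u H4.E ^ n) := by simp [finVec]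

theorem finVec_neg_natCast (n : ℕ) : finVec N (-n) = N.mkQ (u H4.F ^ n) := by
  rcases Nat.eq_zero_or_pos n with rfl | hn
  · simp [finVec]
  · rw [finVec, if_neg (by omega), neg_neg, Int.toNat_natCast]

theorem E_finVec_of_nonneg {k : ℤ} (hk : 0 ≤ k) : u H4.E • finVec N k = finVec N (k + 1) := by
  obtain ⟨n, rfl⟩ := Int.eq_ofNat_of_zero_le hk
  rw [finVec_natCast, ← map_smul, smul_eq_mul, ← pow_succ', ← finVec_natCast, Nat.cast_succ]

theorem F_finVec_of_nonpos {k : ℤ} (hk : k ≤ 0) : u H4.F • finVec N k = finVec N (k - 1) := by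
  obtain ⟨n, rfl⟩ : ∃ n : ℕ, k = -n := ⟨(-k).toNat, by omega⟩
  rw [finVec_neg_natCast, ← map_smul, smul_eq_mul, ← pow_succ', ← finVec_neg_natCast]
  congr 1
  push_cast
  ring

variable {j : ℂ} (hj : u H4.J - algebraMap ℂ UH4 j ∈ N)

theorem J_E_smul (v : UH4 ⧸ N) : u H4.J • u H4.E • v = u H4.E • u H4.J • v + u H4.E • v := by
  rw [← mul_smul, ← mul_smul, ← add_smul]
  congr 1
  have := u_mul_sub H4.J H4.E
  rw [H4.lie_J_E, sub_eq_iff_eq_add'] at this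
  exact this

theorem J_F_smul (v : UH4 ⧸ N) : u H4.J • u H4.F • v = u H4.F • u H4.J • v - u H4.F • v := by
  rw [← mul_smul, ← mul_smul, ← sub_smul]
  congr 1
  have := u_mul_sub H4.J H4.F
  rw [H4.lie_J_F, u, u, u, map_neg, sub_eq_iff_eq_add'] at this
  exact this.trans (sub_eq_add_neg _ _).symm

include hj in
theorem J_finVec (k : ℤ) : u H4.J • finVec N k = (j + k : ℂ) • finVec N k := by
  have h0 : u H4.J • finVec N 0 = j • finVec N 0 := by
    rw [finVec_zero, ← map_smul, ← LinearMap.map_smul_of_tower, ← sub_eq_zero, ← map_sub,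
      Submodule.mkQ_apply, Submodule.Quotient.mk_eq_zero, smul_eq_mul, mul_one,
      ← Algebra.algebraMap_eq_smul_one]
    exact hj
  induction k using Int.induction_on with
  | zero => rw [h0, Int.cast_zero, add_zero]
  | succ n ih =>
    rw [← E_finVec_of_nonneg (Int.natCast_nonneg n), J_E_smul, ih, smul_comm,
      Int.cast_add, Int.cast_one, ← add_assoc, add_smul _ (1 : ℂ), one_smul]
  | pred n ih =>
    rw [← F_finVec_of_nonpos (by omega), J_F_smul, ih, smul_comm,
      Int.cast_sub, Int.cast_one, ← add_sub_assoc, sub_smul _ (1 : ℂ), one_smul]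

include hN hj

theorem F_E_finVec (k : ℤ) : u H4.F • u H4.E • finVec N k = (h - i * (j + k)) • finVec N k := by
  have hQ := LinearMap.congr_fun hN.finAct_Q (finVec N k)
  have hI := LinearMap.congr_fun hN.finAct_I (u H4.J • finVec N k)
  rw [finAct_apply] at hQ hI
  rw [add_smul, mul_smul, mul_smul, hI, J_finVec hj] at hQ
  rw [eq_sub_of_add_eq hQ]
  simp only [LinearMap.smul_apply, Module.End.one_apply]
  module

theorem E_F_finVec (k : ℤ) : u H4.E • u H4.F • finVec N (k + 1) = (h - i * (j + k)) • finVec N (k + 1) := by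
  have hI := LinearMap.congr_fun hN.finAct_I (finVec N (k + 1))
  rw [finAct_apply] at hI
  have := u_mul_sub H4.E H4.F
  rw [H4.lie_E_F, sub_eq_iff_eq_add] at this
  rw [← mul_smul, this, add_smul, mul_smul, hI, F_E_finVec hN hj]
  simp only [LinearMap.smul_apply, Module.End.one_apply]
  push_cast
  module

theorem E_finVec_of_neg {k : ℤ} (hk : k < 0) :
    u H4.E • finVec N k = (h - i * (j + k)) • finVec N (k + 1) := by
  rw [← E_F_finVec hN hj, F_finVec_of_nonpos (by omega), add_sub_cancel_right]

theorem F_finVec_of_pos {k : ℤ} (hk : 0 ≤ k) :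
    u H4.F • finVec N (k + 1) = (h - i * (j + k)) • finVec N k := by
  rw [← F_E_finVec hN hj, E_finVec_of_nonneg hk]

theorem span_finVec : Submodule.span ℂ (Set.range (finVec N)) = ⊤ := by
  rw [eq_top_iff]
  rintro v -
  obtain ⟨a, rfl⟩ := N.mkQ_surjective v
  set Y := Submodule.span ℂ (Set.range (finVec N)) with hY
  have hmem (k : ℤ) : finVec N k ∈ Y := Submodule.subset_span ⟨k, rfl⟩
  have hst {x : H4} (hx : ∀ k, u x • finVec N k ∈ Y) : ∀ v ∈ Y, finAct N (u x) v ∈ Y := by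
    intro v hv
    refine Submodule.span_induction (p := fun v _ => finAct N (u x) v ∈ Y) ?_ ?_ ?_ ?_ hv
    · rintro _ ⟨k, rfl⟩
      exact hx k
    · rw [map_zero]; exact Y.zero_mem
    · intro v w _ _ hv hw
      rw [map_add]; exact Y.add_mem hv hw
    · intro c v _ hv
      rw [map_smul]; exact Y.smul_mem c hv
  have := uH4_stable (finAct N) Y (hst fun k => ?_) (hst fun k => ?_) (hst fun k => ?_)
    (hst fun k => ?_) a (finVec N 0) (hmem 0)
  · rwa [finVec_zero, finAct_apply, ← map_smul, smul_eq_mul, mul_one] at this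
  · rcases lt_or_ge k 0 with hk | hk
    · rw [E_finVec_of_neg hN hj hk]; exact Y.smul_mem _ (hmem _)
    · rw [E_finVec_of_nonneg hk]; exact hmem _
  · rcases lt_or_ge 0 k with hk | hk
    · obtain ⟨l, rfl⟩ : ∃ l, k = l + 1 := ⟨k - 1, by ring⟩
      rw [F_finVec_of_pos hN hj (by omega)]; exact Y.smul_mem _ (hmem _)
    · rw [F_finVec_of_nonpos hk]; exact hmem _
  · have := LinearMap.congr_fun hN.finAct_I (finVec N k)
    rw [finAct_apply] at this
    rw [this]
    exact Y.smul_mem _ (hmem _)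
  · rw [J_finVec hj]; exact Y.smul_mem _ (hmem _)

/-- The nonzero weight vectors form a basis. -/
theorem exists_finBasis : ∃ b : Module.Basis {k : ℤ // finVec N k ≠ 0} ℂ (UH4 ⧸ N),
    ∀ k, b k = finVec N k := by
  have hli : LinearIndependent ℂ (fun k : {k : ℤ // finVec N k ≠ 0} => finVec N k) := by
    refine Module.End.eigenvectors_linearIndependent' (finAct N (u H4.J))
      (fun k : {k : ℤ // finVec N k ≠ 0} => (j + k : ℂ)) ?_ _ fun k =>
        ⟨Module.End.mem_eigenspace_iff.2 (J_finVec hj k), k.2⟩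
    intro k l hkl
    have : (j + (k : ℤ) : ℂ) = j + (l : ℤ) := hkl
    exact Subtype.ext (by exact_mod_cast add_left_cancel this)
  refine ⟨Module.Basis.mk hli ?_, fun k => Module.Basis.mk_apply _ _ _⟩
  rw [← span_finVec hN hj, Submodule.span_le]
  rintro _ ⟨k, rfl⟩
  by_cases hk : finVec N k = 0
  · rw [hk]; exact zero_mem _
  · exact Submodule.subset_span ⟨⟨k, hk⟩, rfl⟩

omit hN hj

/-! ### Nonvanishing of weight vectors -/

/-- The operator moving the weight vectors of `ℤ →₀ ℂ` by `s`. -/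
def shiftOp (s : ℤ) (a : ℤ → ℂ) : Module.End ℂ (ℤ →₀ ℂ) :=
  Finsupp.lsum ℂ fun k => a k • Finsupp.lsingle (k + s)

theorem shiftOp_single (s : ℤ) (a : ℤ → ℂ) (k : ℤ) (c : ℂ) :
    shiftOp s a (Finsupp.single k c) = Finsupp.single (k + s) (a k * c) := by
  simp [shiftOp]

theorem shiftOp_mul (s t : ℤ) (a a' : ℤ → ℂ) :
    shiftOp s a * shiftOp t a' = shiftOp (s + t) fun k => a (k + t) * a' k := by
  refine Finsupp.lhom_ext fun k c => ?_
  rw [Module.End.mul_apply, shiftOp_single, shiftOp_single, shiftOp_single, mul_assoc, add_assoc,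
    add_comm t s]

theorem shiftOp_sub (s : ℤ) (a a' : ℤ → ℂ) :
    shiftOp s a - shiftOp s a' = shiftOp s fun k => a k - a' k := by
  refine Finsupp.lhom_ext fun k c => ?_
  rw [LinearMap.sub_apply, shiftOp_single, shiftOp_single, shiftOp_single, ← Finsupp.single_sub,
    sub_mul]

theorem shiftOp_neg (s : ℤ) (a : ℤ → ℂ) : - shiftOp s a = shiftOp s fun k => - a k := by
  refine Finsupp.lhom_ext fun k c => ?_
  rw [LinearMap.neg_apply, shiftOp_single, shiftOp_single, ← Finsupp.single_neg, neg_mul]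

variable (i j) in
/-- The representation of the finite algebra on `ℤ →₀ ℂ`. -/
def modelRep (e f : ℤ → ℂ) (hef : ∀ k, f (k + 1) * e k = h - i * (j + k)) :
    UH4 →ₐ[ℂ] Module.End ℂ (ℤ →₀ ℂ) :=
  UniversalEnvelopingAlgebra.lift ℂ <|
    h4Rep (shiftOp 1 e) (shiftOp (-1) f) (shiftOp 0 fun _ => i) (shiftOp 0 fun k => j + k)
      -- Only the products f_{k+1} e_k enter: EF - FE acts on the k-th vector by the difference of
      -- consecutive values of h - i (j + k), which is i.
      (by
        rw [shiftOp_mul, shiftOp_mul, neg_add_cancel, add_neg_cancel, shiftOp_sub]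
        congr 1
        ext1 k
        have h1 := hef k
        have h2 := hef (k + -1)
        rw [neg_add_cancel_right] at h2
        push_cast at h2
        linear_combination h2 - h1)
      (by
        rw [shiftOp_mul, shiftOp_mul, add_comm 1 0, zero_add, shiftOp_sub]
        congr 1
        ext1 k
        push_cast
        rw [add_zero]
        ring)
      (by
        rw [shiftOp_mul, shiftOp_mul, add_zero, zero_add, shiftOp_sub, shiftOp_neg]
        congr 1
        ext1 k
        push_cast
        rw [add_zero]
        ring)
      (by rw [commute_iff_eq, shiftOp_mul, shiftOp_mul, add_comm]; simp only [add_zero, mul_comm])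
      (by rw [commute_iff_eq, shiftOp_mul, shiftOp_mul, add_comm]; simp only [add_zero, mul_comm])
      (by rw [commute_iff_eq, shiftOp_mul, shiftOp_mul]; simp only [add_zero, mul_comm])

section Model

variable {e f : ℤ → ℂ} (hef : ∀ k, f (k + 1) * e k = h - i * (j + k))

theorem modelRep_E : modelRep i j e f hef (u H4.E) = shiftOp 1 e := by
  rw [modelRep, UniversalEnvelopingAlgebra.lift_ι_apply]; exact h4Op_E _ _ _ _

theorem modelRep_F : modelRep i j e f hef (u H4.F) = shiftOp (-1) f := by
  rw [modelRep, UniversalEnvelopingAlgebra.lift_ι_apply]; exact h4Op_F _ _ _ _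

theorem modelRep_I : modelRep i j e f hef (u H4.I) = shiftOp 0 fun _ => i := by
  rw [modelRep, UniversalEnvelopingAlgebra.lift_ι_apply]; exact h4Op_I _ _ _ _

theorem modelRep_J : modelRep i j e f hef (u H4.J) = shiftOp 0 fun k => j + k := by
  rw [modelRep, UniversalEnvelopingAlgebra.lift_ι_apply]; exact h4Op_J _ _ _ _

theorem modelRep_I_sub : modelRep i j e f hef (u H4.I - algebraMap ℂ UH4 i) (Finsupp.single 0 1) = 0 := by
  rw [map_sub, modelRep_I, AlgHom.commutes, LinearMap.sub_apply, shiftOp_single,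
    Module.algebraMap_end_apply]
  simp

theorem modelRep_J_sub : modelRep i j e f hef (u H4.J - algebraMap ℂ UH4 j) (Finsupp.single 0 1) = 0 := by
  rw [map_sub, modelRep_J, AlgHom.commutes, LinearMap.sub_apply, shiftOp_single,
    Module.algebraMap_end_apply]
  simp

theorem modelRep_Q_sub : modelRep i j e f hef
    (u H4.F * u H4.E + u H4.I * u H4.J - algebraMap ℂ UH4 h) (Finsupp.single 0 1) = 0 := by
  have h0 := hef 0
  rw [map_sub, map_add, map_mul, map_mul, modelRep_E, modelRep_F, modelRep_I, modelRep_J,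
    AlgHom.commutes, LinearMap.sub_apply, LinearMap.add_apply, shiftOp_mul, shiftOp_mul,
    shiftOp_single, shiftOp_single, Module.algebraMap_end_apply, h0]
  simp

theorem modelRep_pow_E (n : ℕ) (hn : ∀ k : ℤ, 0 ≤ k → e k ≠ 0) :
    ∃ c : ℂ, c ≠ 0 ∧ modelRep i j e f hef (u H4.E ^ n) (Finsupp.single 0 1) = Finsupp.single (n : ℤ) c := by
  induction n with
  | zero => exact ⟨1, one_ne_zero, by simp⟩
  | succ n ih =>
    obtain ⟨c, hc, h1⟩ := ih
    refine ⟨e n * c, mul_ne_zero (hn _ (by omega)) hc, ?_⟩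
    rw [pow_succ', map_mul, Module.End.mul_apply, h1, modelRep_E, shiftOp_single, Nat.cast_succ]

theorem modelRep_pow_F (n : ℕ) (hn : ∀ k : ℤ, k ≤ 0 → f k ≠ 0) :
    ∃ c : ℂ, c ≠ 0 ∧
      modelRep i j e f hef (u H4.F ^ n) (Finsupp.single 0 1) = Finsupp.single (-n : ℤ) c := by
  induction n with
  | zero => exact ⟨1, one_ne_zero, by simp⟩
  | succ n ih =>
    obtain ⟨c, hc, h1⟩ := ih
    refine ⟨f (-n) * c, mul_ne_zero (hn _ (by omega)) hc, ?_⟩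
    rw [pow_succ', map_mul, Module.End.mul_apply, h1, modelRep_F, shiftOp_single, Nat.cast_succ,
      neg_add]

theorem modelRep_eq_zero {s : Set UH4}
    (hs : ∀ a ∈ s, modelRep i j e f hef a (Finsupp.single 0 1) = 0) {a : UH4}
    (ha : a ∈ Submodule.span UH4 s) : modelRep i j e f hef a (Finsupp.single 0 1) = 0 := by
  refine Submodule.span_induction
    (p := fun a _ => modelRep i j e f hef a (Finsupp.single 0 1) = 0) hs ?_ ?_ ?_ ha
  · rw [map_zero, LinearMap.zero_apply]
  · intro a b _ _ ha hb
    rw [map_add, LinearMap.add_apply, ha, hb, add_zero]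
  · intro a b _ hb
    rw [smul_eq_mul, map_mul, Module.End.mul_apply, hb, map_zero]

/-- A generator-preserving map to a shift model detects the weight vectors, provided no coefficient
vanishes going up with E from 0 or down with F from 0. Since only f_{k+1} e_k is prescribed, the
zeros can be placed away from these directions. -/
theorem finVec_ne_zero {s : Set UH4}
    (hs : ∀ a ∈ s, modelRep i j e f hef a (Finsupp.single 0 1) = 0)
    (he : ∀ k : ℤ, 0 ≤ k → e k ≠ 0) (hf : ∀ k : ℤ, k ≤ 0 → f k ≠ 0) (k : ℤ) :
    finVec (Submodule.span UH4 s) k ≠ 0 := by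
  intro hk
  rcases le_total 0 k with h0 | h0
  · obtain ⟨n, rfl⟩ := Int.eq_ofNat_of_zero_le h0
    rw [finVec_natCast, Submodule.mkQ_apply, Submodule.Quotient.mk_eq_zero] at hk
    obtain ⟨c, hc, h1⟩ := modelRep_pow_E hef n he
    rw [modelRep_eq_zero hef hs hk, eq_comm, Finsupp.single_eq_zero] at h1
    exact hc h1
  · obtain ⟨n, rfl⟩ : ∃ n : ℕ, k = -n := ⟨(-k).toNat, by omega⟩
    rw [finVec_neg_natCast, Submodule.mkQ_apply, Submodule.Quotient.mk_eq_zero] at hk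
    obtain ⟨c, hc, h1⟩ := modelRep_pow_F hef n hf
    rw [modelRep_eq_zero hef hs hk, eq_comm, Finsupp.single_eq_zero] at h1
    exact hc h1

theorem finVec_zero_ne_zero {s : Set UH4}
    (hs : ∀ a ∈ s, modelRep i j e f hef a (Finsupp.single 0 1) = 0) :
    finVec (Submodule.span UH4 s) 0 ≠ 0 := by
  intro hk
  rw [finVec_zero, Submodule.mkQ_apply, Submodule.Quotient.mk_eq_zero] at hk
  have := modelRep_eq_zero hef hs hk
  rw [map_one, Module.End.one_apply, Finsupp.single_eq_zero] at this
  exact one_ne_zero this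

end Model

end Finite

/-! ### The characters -/

section Characters

variable {N : Submodule UH4 UH4} {i : ℤ} {h j : ℂ}

theorem charge_specialOsc (hi : i ≠ 0) : charge (specialOsc i).1 = (i.sign : ℂ) := by
  rw [specialOsc]
  rcases lt_or_gt_of_ne hi with h | h
  · rw [if_neg h.not_gt, Int.sign_eq_neg_one_of_neg h]; simp [charge]
  · rw [if_pos h, Int.sign_eq_one_of_pos h]; simp [charge]

theorem degree_specialOsc (hi : i ≠ 0) : (((specialOsc i).2 + 1 : ℕ) : ℂ) = (|i| : ℤ) := by
  have : (((specialOsc i).2 + 1 : ℕ) : ℤ) = |i| := by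
    rw [specialOsc, Int.abs_eq_natAbs]
    simp only
    omega
  rw [← this]
  push_cast
  rfl

/-- Two ground-state labels are allowed so that multiplication by x_s can be combined with a shift
of the ground state, as the relaxed case requires. -/
theorem indWeight_add_single {B : Type*} (c : ℂ) (k : B → ℤ) (hi : i ≠ 0) (m : Osc →₀ ℕ) (x y : B) :
    indWeight c h j k (m + Finsupp.single (specialOsc i) 1, y) =
      indWeight c h j k (m, x) + ((0 : ℂ), (i.sign + k y - k x : ℂ), ((|i| : ℤ) : ℂ)) := by
  rw [indWeight, indWeight, oscChargeOf_add_single, oscDegree_add_single, charge_specialOsc hi,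
    Nat.cast_add, degree_specialOsc hi]
  refine Prod.ext (add_zero _).symm (Prod.ext ?_ ?_)
  · change j + k y + (oscChargeOf m + _) = j + k x + oscChargeOf m + _
    ring
  · change relWeight c h + (_ + _) = relWeight c h + _ + _
    ring

theorem mem_range_add_single {s : Osc} {m : Osc →₀ ℕ} :
    (∃ m', m' + Finsupp.single s 1 = m) ↔ m s ≠ 0 := by
  constructor
  · rintro ⟨m', rfl⟩
    simp
  · intro hm
    exact ⟨m - Finsupp.single s 1, tsub_add_cancel_of_le (by
      rw [Finsupp.single_le_iff]; exact Nat.one_le_iff_ne_zero.2 hm)⟩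

theorem verma_character (hi : i ≠ 0) (hN : IsCentralIdeal N (i : ℂ) h)
    (hj : u H4.J - algebraMap ℂ UH4 j ∈ N) (h0 : finVec N 0 ≠ 0)
    (hgen : ∀ k, finVec N k ≠ 0 → ∃ a : UH4, a • finVec N k = N.mkQ 1) :
    IsSimpleModule UAff (IrredQuotient (Induced N)) ∧ IsWeight (Induced N) ∧
      IsWeight (IrredQuotient (Induced N)) ∧ ch (IrredQuotient (Induced N)) =
        mulFormal (1 - mono 0 (i.sign : ℂ) (|i| : ℤ)) (ch (Induced N)) := by
  obtain ⟨b, hb⟩ := exists_finBasis hN hj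
  have hk : Function.Injective (Subtype.val : {k : ℤ // finVec N k ≠ 0} → ℤ) :=
    Subtype.val_injective
  have hJ (x : {k : ℤ // finVec N k ≠ 0}) : u H4.J • b x = (j + (x : ℤ) : ℂ) • b x := by
    rw [hb, J_finVec hj]
  have hne : Nonempty {k : ℤ // finVec N k ≠ 0} := ⟨⟨0, h0⟩⟩
  have hg (x) : ∃ a : UH4, a • b x = N.mkQ 1 := by
    rw [hb]; exact hgen _ x.2
  have hs := isSpecial_specialOsc hi
  have hS := sSup_proper hN b hk hJ hs hg
  have hW := isWeightBasis_indBasis hN b hk hJ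
  -- Multiplication by x_s on the indices of the basis.
  let σ : (Osc →₀ ℕ) × {k : ℤ // finVec N k ≠ 0} → (Osc →₀ ℕ) × {k : ℤ // finVec N k ≠ 0} :=
    fun x => (x.1 + Finsupp.single (specialOsc i) 1, x.2)
  have hσ : σ.Injective := fun x y hxy =>
    Prod.ext (add_right_cancel (congrArg Prod.fst hxy)) (congrArg (fun z => z.2) hxy)
  have hr (x) : x ∈ Set.range σ ↔ x.1 (specialOsc i) ≠ 0 := by
    rw [← mem_range_add_single]
    constructor
    · rintro ⟨y, rfl⟩
      exact ⟨y.1, rfl⟩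
    · rintro ⟨m, hm⟩
      exact ⟨(m, x.2), Prod.ext hm rfl⟩
  have hq := hW.quotient (sSup {Y : Submodule UAff (Induced N) | Y ≠ ⊤}) hσ
    (by rw [hS]; exact specialSubmodule_eq_span hN b hs _ hr)
    (t := (0, (i.sign : ℂ), ((|i| : ℤ) : ℂ))) (fun x => by
      rw [indWeight_add_single _ _ hi x.1 x.2, add_sub_cancel_right])
  refine ⟨isSimpleModule_iff_isCoatom.2 ?_, hW.isWeight, hq.1, hq.2⟩
  rw [hS]
  exact isCoatom_specialSubmodule hN b hk hJ hs hg

theorem relaxed_character (hi : i ≠ 0) (hN : IsCentralIdeal (finDense i j h) (i : ℂ) h)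
    (hj : u H4.J - algebraMap ℂ UH4 j ∈ finDense i j h) (h0 : ∀ k, finVec (finDense i j h) k ≠ 0) :
    IsWeight (Rel i j h) ∧ IsWeight (RelQuotient i j h) ∧
      ch (RelQuotient i j h) = mulFormal (1 - mono 0 0 (|i| : ℤ)) (ch (Rel i j h)) := by
  obtain ⟨b, hb⟩ := exists_finBasis hN hj
  have hk : Function.Injective (Subtype.val : {k : ℤ // finVec (finDense i j h) k ≠ 0} → ℤ) :=
    Subtype.val_injective
  have hJ (x : {k : ℤ // finVec (finDense i j h) k ≠ 0}) :
      u H4.J • b x = (j + (x : ℤ) : ℂ) • b x := by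
    rw [hb, J_finVec hj]
  have hs := isSpecial_specialOsc hi
  have hS := sSup_zero_inter hN b hk hJ hs
  have hW := isWeightBasis_indBasis hN b hk hJ
  -- The ground state is also moved by -sgn i, cancelling the charge of x_s. This is possible
  -- because all weight vectors are nonzero, and the range is unchanged: all monomials divisible by
  -- x_s.
  let σ : (Osc →₀ ℕ) × {k : ℤ // finVec (finDense i j h) k ≠ 0} →
      (Osc →₀ ℕ) × {k : ℤ // finVec (finDense i j h) k ≠ 0} :=
    fun x => (x.1 + Finsupp.single (specialOsc i) 1, ⟨x.2 - i.sign, h0 _⟩)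
  have hσ : σ.Injective := fun x y hxy =>
    Prod.ext (add_right_cancel (congrArg Prod.fst hxy))
      (Subtype.ext (sub_left_injective (congrArg (fun z => (z.2 : ℤ)) hxy)))
  have hr (x) : x ∈ Set.range σ ↔ x.1 (specialOsc i) ≠ 0 := by
    rw [← mem_range_add_single]
    constructor
    · rintro ⟨y, rfl⟩
      exact ⟨y.1, rfl⟩
    · rintro ⟨m, hm⟩
      exact ⟨(m, ⟨x.2 + i.sign, h0 _⟩), Prod.ext hm (Subtype.ext (add_sub_cancel_right _ _))⟩
  have hq := hW.quotient (sSup {Y : Submodule UAff (Rel i j h) |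
      Y.restrictScalars ℂ ⊓ groundStates i j h = ⊥}) hσ
    (by rw [← specialSubmodule_eq_span hN b hs _ hr, ← hS]; rfl)
    (t := (0, 0, ((|i| : ℤ) : ℂ))) (fun x => by
      rw [indWeight_add_single _ _ hi x.1 x.2]
      congr 3
      push_cast
      ring)
  exact ⟨hW.isWeight, hq.1, hq.2⟩

theorem casimir_sub_mem {a c : ℂ} {x : UH4} (hx : x ∈ N)
    (hI : u H4.I - algebraMap ℂ UH4 a ∈ N) (hJ : u H4.J - algebraMap ℂ UH4 c ∈ N) :
    x + u H4.I * u H4.J - algebraMap ℂ UH4 (a * c) ∈ N := by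
  have e : x + u H4.I * u H4.J - algebraMap ℂ UH4 (a * c) = x + u H4.I * (u H4.J - algebraMap ℂ UH4 c) +
      algebraMap ℂ UH4 c * (u H4.I - algebraMap ℂ UH4 a) := by
    rw [map_mul, mul_sub, mul_sub, ← Algebra.commutes c (u H4.I), Algebra.commutes c (algebraMap ℂ UH4 a)]
    abel
  rw [e]
  exact N.add_mem (N.add_mem hx (N.smul_mem _ hJ)) (N.smul_mem _ hI)

/-- E kills the generator, so Q = FE + IJ reduces to IJ. -/
theorem isCentralIdeal_finVermaPlus (c : ℂ) : IsCentralIdeal (finVermaPlus c j) c (c * j) where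
  I_mem := Submodule.subset_span (by simp)
  Q_mem := casimir_sub_mem ((finVermaPlus c j).smul_mem _ (Submodule.subset_span (by simp)))
    (Submodule.subset_span (by simp)) (Submodule.subset_span (by simp))

/-- Here F kills the generator and FE = EF - I, so Q reduces to I (J - 1). -/
theorem isCentralIdeal_finVermaMinus (c : ℂ) :
    IsCentralIdeal (finVermaMinus c j) c (c * (j - 1)) where
  I_mem := Submodule.subset_span (by simp)
  Q_mem := by
    have hI : u H4.I - algebraMap ℂ UH4 c ∈ finVermaMinus c j := Submodule.subset_span (by simp)
    have h1 := sub_mem (casimir_sub_mem ((finVermaMinus c j).smul_mem (u H4.E)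
      (Submodule.subset_span (show u H4.F ∈ _ by simp))) hI
        (Submodule.subset_span (show u H4.J - algebraMap ℂ UH4 j ∈ _ by simp))) hI
    have h2 := u_mul_sub H4.E H4.F
    rw [H4.lie_E_F, sub_eq_iff_eq_add] at h2
    rw [smul_eq_mul, h2] at h1
    convert h1 using 1
    rw [mul_sub, mul_one, map_sub]
    abel

theorem isCentralIdeal_finDense (c : ℂ) : IsCentralIdeal (finDense c j h) c h where
  I_mem := Submodule.subset_span (by simp)
  Q_mem := Submodule.subset_span (by simp)

/-- F steps back down with the nonzero factors h - i (j + k), so the generator can be recovered. -/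
theorem exists_smul_finVec_pos (hN : IsCentralIdeal N (i : ℂ) h)
    (hj : u H4.J - algebraMap ℂ UH4 j ∈ N) (hne : ∀ k : ℤ, 0 ≤ k → h - i * (j + k) ≠ 0) (n : ℕ) :
    ∃ a : UH4, a • finVec N n = N.mkQ 1 := by
  induction n with
  | zero => exact ⟨1, by rw [one_smul, Nat.cast_zero, finVec_zero]⟩
  | succ n ih =>
    obtain ⟨a, ha⟩ := ih
    have h0 := hne n (by omega)
    refine ⟨(h - i * (j + (n : ℤ)) : ℂ)⁻¹ • (a * u H4.F), ?_⟩
    rw [smul_assoc, mul_smul, Nat.cast_succ, F_finVec_of_pos hN hj (by omega), smul_comm a, ha,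
      smul_smul, inv_mul_cancel₀ h0, one_smul]

theorem exists_smul_finVec_neg (hN : IsCentralIdeal N (i : ℂ) h)
    (hj : u H4.J - algebraMap ℂ UH4 j ∈ N) (hne : ∀ k : ℤ, k < 0 → h - i * (j + k) ≠ 0) (n : ℕ) :
    ∃ a : UH4, a • finVec N (-n) = N.mkQ 1 := by
  induction n with
  | zero => exact ⟨1, by rw [one_smul, Nat.cast_zero, neg_zero, finVec_zero]⟩
  | succ n ih =>
    obtain ⟨a, ha⟩ := ih
    have h0 := hne (-(n + 1 : ℕ)) (by omega)
    refine ⟨(h - i * (j + (-(n + 1 : ℕ) : ℤ)) : ℂ)⁻¹ • (a * u H4.E), ?_⟩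
    rw [smul_assoc, mul_smul, E_finVec_of_neg hN hj (by omega),
      show -((n + 1 : ℕ) : ℤ) + 1 = -n by push_cast; ring, smul_comm a, ha,
      smul_smul, inv_mul_cancel₀ h0, one_smul]

theorem finVec_eq_zero_of_pos (hE : u H4.E ∈ N) {n : ℕ} (hn : n ≠ 0) : finVec N n = 0 := by
  obtain ⟨m, rfl⟩ := Nat.exists_eq_succ_of_ne_zero hn
  rw [finVec_natCast, Submodule.mkQ_apply, Submodule.Quotient.mk_eq_zero, pow_succ]
  exact N.smul_mem _ hE

theorem finVec_eq_zero_of_neg (hF : u H4.F ∈ N) {n : ℕ} (hn : n ≠ 0) : finVec N (-n) = 0 := by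
  obtain ⟨m, rfl⟩ := Nat.exists_eq_succ_of_ne_zero hn
  rw [finVec_neg_natCast, Submodule.mkQ_apply, Submodule.Quotient.mk_eq_zero, pow_succ]
  exact N.smul_mem _ hF

theorem vermaPlus_character (hi : i ≠ 0) (j : ℂ) :
    IsSimpleModule UAff (LPlus i j) ∧ IsWeight (VPlus i j) ∧ IsWeight (LPlus i j) ∧
      ch (LPlus i j) = mulFormal (1 - mono 0 (i.sign : ℂ) (|i| : ℤ)) (ch (VPlus i j)) := by
  have hiC : (i : ℂ) ≠ 0 := Int.cast_ne_zero.2 hi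
  have hN := isCentralIdeal_finVermaPlus (j := j) (i : ℂ)
  have hj : u H4.J - algebraMap ℂ UH4 j ∈ finVermaPlus i j := Submodule.subset_span (by simp)
  refine verma_character hi hN hj ?_ fun k hk => ?_
  · refine finVec_zero_ne_zero (i := i) (j := j) (h := i * j) (e := fun k => -(i * k)) (f := fun _ => 1)
      (fun k => by ring) ?_
    rintro a (rfl | rfl | rfl)
    · rw [modelRep_E, shiftOp_single]; simp
    · exact modelRep_I_sub _
    · exact modelRep_J_sub _
  · rcases lt_or_ge 0 k with h0 | h0
    · obtain ⟨n, rfl⟩ := Int.eq_ofNat_of_zero_le h0.le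
      exact absurd (finVec_eq_zero_of_pos (Submodule.subset_span (by simp)) (by omega)) hk
    · obtain ⟨n, rfl⟩ : ∃ n : ℕ, k = -n := ⟨(-k).toNat, by omega⟩
      refine exists_smul_finVec_neg hN hj (fun k hk => ?_) n
      rw [show (i : ℂ) * j - i * (j + k) = -(i * k) by ring, neg_ne_zero]
      exact mul_ne_zero hiC (Int.cast_ne_zero.2 hk.ne)

theorem vermaMinus_character (hi : i ≠ 0) (j : ℂ) :
    IsSimpleModule UAff (LMinus i j) ∧ IsWeight (VMinus i j) ∧ IsWeight (LMinus i j) ∧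
      ch (LMinus i j) = mulFormal (1 - mono 0 (i.sign : ℂ) (|i| : ℤ)) (ch (VMinus i j)) := by
  have hiC : (i : ℂ) ≠ 0 := Int.cast_ne_zero.2 hi
  have hN := isCentralIdeal_finVermaMinus (j := j) (i : ℂ)
  have hj : u H4.J - algebraMap ℂ UH4 j ∈ finVermaMinus i j := Submodule.subset_span (by simp)
  refine verma_character hi hN hj ?_ fun k hk => ?_
  · refine finVec_zero_ne_zero (i := i) (j := j) (h := i * (j - 1)) (e := fun _ => 1)
      (f := fun k => -(i * k)) (fun k => by push_cast; ring) ?_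
    rintro a (rfl | rfl | rfl)
    · rw [modelRep_F, shiftOp_single]; simp
    · exact modelRep_I_sub _
    · exact modelRep_J_sub _
  · rcases lt_or_ge k 0 with h0 | h0
    · obtain ⟨n, rfl⟩ : ∃ n : ℕ, k = -n := ⟨(-k).toNat, by omega⟩
      exact absurd (finVec_eq_zero_of_neg (Submodule.subset_span (by simp)) (by omega)) hk
    · obtain ⟨n, rfl⟩ := Int.eq_ofNat_of_zero_le h0
      refine exists_smul_finVec_pos hN hj (fun k hk => ?_) n
      rw [show (i : ℂ) * (j - 1) - i * (j + k) = -(i * (k + 1 : ℤ)) by push_cast; ring, neg_ne_zero]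
      exact mul_ne_zero hiC (Int.cast_ne_zero.2 (by omega))

theorem relaxedPlus_character (hi : i ≠ 0) (h : ℂ) (n : ℕ) :
    IsWeight (RPlus i h n) ∧ IsWeight (EPlus i h n) ∧
      ch (EPlus i h n) = mulFormal (1 - mono 0 0 (|i| : ℤ)) (ch (RPlus i h n)) := by
  have hiC : (i : ℂ) ≠ 0 := Int.cast_ne_zero.2 hi
  refine relaxed_character hi (isCentralIdeal_finDense _) (Submodule.subset_span (by simp)) ?_
  -- For j = h/i + 1 + n the prescribed product -(i (1 + n + k)) is nonzero for k ≥ 0, so it can be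
  -- carried by `e` with `f` constant.
  refine finVec_ne_zero (i := i) (j := h / i + 1 + n) (h := h) (e := fun k => -(i * (1 + n + k : ℤ)))
    (f := fun _ => 1) (fun k => by push_cast; field_simp; ring) ?_ (fun k hk => ?_)
    fun k _ => one_ne_zero
  · rintro a (rfl | rfl | rfl)
    · exact modelRep_I_sub _
    · exact modelRep_J_sub _
    · exact modelRep_Q_sub _
  · rw [neg_ne_zero]
    exact mul_ne_zero hiC (Int.cast_ne_zero.2 (by omega))

theorem relaxedMinus_character (hi : i ≠ 0) (h : ℂ) (n : ℕ) :
    IsWeight (RMinus i h n) ∧ IsWeight (EMinus i h n) ∧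
      ch (EMinus i h n) = mulFormal (1 - mono 0 0 (|i| : ℤ)) (ch (RMinus i h n)) := by
  have hiC : (i : ℂ) ≠ 0 := Int.cast_ne_zero.2 hi
  refine relaxed_character hi (isCentralIdeal_finDense _) (Submodule.subset_span (by simp)) ?_
  -- For j = h/i - n the prescribed product is i (n - k), so f_k = i (n + 1 - k), which is nonzero
  -- for k ≤ 0.
  refine finVec_ne_zero (i := i) (j := h / i - n) (h := h) (e := fun _ => 1)
    (f := fun k => i * (n + 1 - k : ℤ)) (fun k => by push_cast; field_simp; ring) ?_
    (fun k _ => one_ne_zero) fun k hk => ?_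
  · rintro a (rfl | rfl | rfl)
    · exact modelRep_I_sub _
    · exact modelRep_J_sub _
    · exact modelRep_Q_sub _
  · exact mul_ne_zero hiC (Int.cast_ne_zero.2 (by omega))

end Characters

end NappiWitten

end

open NappiWitten in
theorem mainTheorem6 (i : ℤ) (hi : i ≠ 0) :
    (∀ j : ℂ,
      (IsSimpleModule UAff (LPlus i j) ∧ IsWeight (VPlus i j) ∧ IsWeight (LPlus i j) ∧
        ch (LPlus i j) = mulFormal (1 - mono 0 (i.sign : ℂ) (|i| : ℤ)) (ch (VPlus i j))) ∧
      (IsSimpleModule UAff (LMinus i j) ∧ IsWeight (VMinus i j) ∧ IsWeight (LMinus i j) ∧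
        ch (LMinus i j) = mulFormal (1 - mono 0 (i.sign : ℂ) (|i| : ℤ)) (ch (VMinus i j)))) ∧
    (∀ (h : ℂ) (n : ℕ),
      (IsWeight (RPlus i h n) ∧ IsWeight (EPlus i h n) ∧
        ch (EPlus i h n) = mulFormal (1 - mono 0 0 (|i| : ℤ)) (ch (RPlus i h n))) ∧
      (IsWeight (RMinus i h n) ∧ IsWeight (EMinus i h n) ∧
        ch (EMinus i h n) = mulFormal (1 - mono 0 0 (|i| : ℤ)) (ch (RMinus i h n)))) :=
  ⟨fun j => ⟨vermaPlus_character hi j, vermaMinus_character hi j⟩,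
    fun h n => ⟨relaxedPlus_character hi h n, relaxedMinus_character hi h n⟩⟩
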